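/- **Conventions.** $n$ is the security parameter. A function $f:\mathbb N\to\mathbb N$ is *polynomially bounded* if $f(n)\le p(n)$ for some polynomial $p$ and all large $n$; $\varepsilon:\mathbb N\to\mathbb R$ is *negligible* if for every $c\in\mathbb N$, $\varepsilon(n)\le n^{-c}$ for all large $n$. Quantum adversaries are non-uniform families of quantum circuits, starting in $|0\dots0\rangle$, over the (controlled) gates $X,H,T$, with oracle queries, whose number of qubits plus number of gates and queries is polynomially bounded in $n$. Superposition access to a function $f:\{0,1\}^a\to\{0,1\}^l$ is of *type (1)*: $|x\rangle|y\rangle\mapsto|x\rangle|y\oplus f(x)\rangle$, or (for injective $f$) of *type (2)*: the register holding $x$ is sent to an external party that applies $|x\rangle\mapsto|f(x)\rangle$ and returns only the result. No inverse queries are given. Fix a set $Q$ of admissible access types that contains type (2) (so only type (2), or both types). **Pseudorandom permutations.** Let $\Pi=(\Pi_N)_N$ be a family of keyed permutations $\pi_k$ of $\{0,1\}^N$, with a key distribution $\mathcal I(1^N)$ for each $N$, and let $m,\tau,\mu:\mathbb N\to\mathbb N$ be polynomially bounded. $\Pi_{m+\tau}$ is a *quantum-secure pseudorandom permutation family (qPRP)*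 (with respect to $Q$) if for every polynomial-size quantum oracle circuit family $D$ making queries of types in $Q$, $$\Big|\Pr_{k\leftarrow\mathcal I(1^{m(n)+\tau(n)})}\big[D_n^{|\pi_k\rangle}=1\big]-\Pr_{\pi\leftarrow S_{2^{m(n)+\tau(n)}}}\big[D_n^{|\pi\rangle}=1\big]\Big|$$ is negligible in $n$. **Scheme (randomized ECB).** $\mathsf{Gen}(1^n)$ outputs $k\leftarrow\mathcal I(1^{m+\tau})$. To encrypt $x=x_1\|\dots\|x_\mu$ with $x_i\in\{0,1\}^m$, pick independent uniform $r_1,\dots,r_\mu\in\{0,1\}^\tau$ and output $\pi_k(x_1\|r_1)\|\dots\|\pi_k(x_\mu\|r_\mu)$. To decrypt $y_1\|\dots\|y_\mu$, output the concatenation of the first $m$ bits of each $\pi_k^{-1}(y_i)$. **Security notions.** In both games a key $k\leftarrow\mathsf{Gen}(1^n)$ is fixed; the adversary has a learning phase before and one after the challenge phase, in which it makes superposition queries, of types in $Q$, to $\mathsf{Enc}_k$ (each query uses fresh randomness, the same in all branches of the superposition). In the end it outputs a bit. * *gqIND challenge:* the adversary sends two plaintext registers, in an arbitrary joint state that may be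 entangled with its memory. The challenger picks a uniform bit $b$, traces out register $1-b$, applies the type-(2) operator $|x\rangle\mapsto|\mathsf{Enc}_k(x;r)\rangle$ with fresh random $r$ to register $b$, and returns the result. * *qIND challenge:* the adversary sends two classical bit strings, each describing a polynomial-size quantum circuit that prepares a plaintext state from $|0\dots0\rangle$. The challenger picks a uniform bit $b$, builds the $b$-th state, applies the type-(2) operator with fresh random $r$ to it, and returns the result. The scheme is *gqIND-qCPA* (resp. *qIND-qCPA*) *secure* if for every polynomial-size quantum adversary the probability of outputting $b$ exceeds $1/2$ by at most a negligible amount. **Theorem.** Suppose that $2^{-\tau(n)}$ is negligible and that $\Pi_{m+\tau}$ is a qPRP with respect to $Q$. Then the randomized-ECB scheme is gqIND-qCPA secure, and it is also qIND-qCPA secure, both with learning queries of the types in $Q$. -/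

import Mathlib

open Filter

noncomputable section

namespace QEnc

/-! ### Asymptotics -/

/-- `f = poly(n)`. -/
def PolyBounded (f : ℕ → ℕ) : Prop :=
  ∃ p : Polynomial ℕ, ∀ᶠ n in atTop, f n ≤ p.eval n

/-- `ε = negl(n)`: eventually below every inverse polynomial. -/
def Negligible (ε : ℕ → ℝ) : Prop :=
  ∀ c : ℕ, ∀ᶠ n : ℕ in atTop, ε n ≤ 1 / (n : ℝ) ^ c

/-! ### Registers, states and elementary operations -/

/-- Bit strings of length `N`; they index the computational basis of `N` qubits. -/
abbrev Bits (N : ℕ) : Type := Fin N → Bool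

/-- Operators on `w` qubits; states are density operators. -/
abbrev QState (w : ℕ) : Type := Matrix (Bits w) (Bits w) ℂ

/-- The state `|0…0⟩⟨0…0|`. -/
def zeroState (w : ℕ) : QState w :=
  Matrix.of fun s t => if s = (fun _ => false) ∧ t = (fun _ => false) then 1 else 0

/-- The operation `ρ ↦ tr_E (V ρ V†)` for the operator `V |s⟩ = |(F s).1⟩ ⊗ |(F s).2⟩_E`, which is
an isometry when `F` is injective. -/
def basisChannel {w : ℕ} (F : Bits w → Bits w × Bits w) (ρ : QState w) : QState w :=
  Matrix.of fun t t' => ∑ s, ∑ s',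
    if (F s).1 = t ∧ (F s').1 = t' ∧ (F s).2 = (F s').2 then ρ s s' else 0

/-- The probability of outcome `b` when qubit `i` is measured in the computational basis. -/
def measureProb {w : ℕ} (i : Fin w) (b : Bool) (ρ : QState w) : ℝ :=
  ∑ s : Bits w, if s i = b then (ρ s s).re else 0

/-- The single-qubit gates: NOT, Hadamard, and the `π/8` gate `T`. -/
inductive GateKind
  | X
  | H
  | T

/-- The `2 × 2` unitary of a single-qubit gate. -/
def GateKind.mat : GateKind → Matrix Bool Bool ℂ
  | .X => Matrix.of fun a b => if a = b then 0 else 1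
  | .H => Matrix.of fun a b => (if a && b then -1 else 1) / (Real.sqrt 2 : ℂ)
  | .T => Matrix.of fun a b =>
      if a = b then (if a then Complex.exp (Complex.I * Real.pi / 4) else 1) else 0

/-- A single-qubit gate acting on `target`, controlled by the qubits in `controls` (so `CNOT` and
Toffoli are `X` gates with one and two controls). Up to a polynomial overhead this is the
Clifford+T gate set. -/
structure Gate (w : ℕ) where
  kind : GateKind
  target : Fin w
  controls : Finset (Fin w)
  target_notMem : target ∉ controls

/-- The unitary on `w` qubits implemented by a gate. -/
def Gate.mat {w : ℕ} (g : Gate w) : Matrix (Bits w) (Bits w) ℂ :=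
  Matrix.of fun s t =>
    if ∀ c ∈ g.controls, t c = true then
      (if ∀ i, i ≠ g.target → s i = t i then g.kind.mat (s g.target) (t g.target) else 0)
    else (if s = t then 1 else 0)

/-- The action of a gate on states. -/
def Gate.apply {w : ℕ} (g : Gate w) (ρ : QState w) : QState w :=
  g.mat * ρ * g.mat.conjTranspose

/-! ### Superposition access to a function -/

/-- Type-(1) evaluation `|x⟩|y⟩ ↦ |x⟩|y ⊕ f x⟩`; `e` lists the qubits holding `x` and `y`. -/
def typeOne {w a l : ℕ} (f : Bits a → Bits l) (e : Fin a ⊕ Fin l ↪ Fin w) (ρ : QState w) :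
    QState w :=
  basisChannel (fun s =>
    (Function.extend (fun j : Fin l => e (Sum.inr j))
      (fun j => xor (s (e (Sum.inr j))) (f (fun i => s (e (Sum.inl i))) j)) s,
     fun _ => false)) ρ

/-- Type-(2) evaluation `|x⟩ ↦ |f x⟩` of an injective `f` by an external party. The qubits `inp`
(holding `x`), `drop` and `out` are handed over; the old contents of those that are not in `inp`
are discarded; `|f x⟩` is returned in `out`, and all the other qubits handed over come back as
`|0⟩`, so that the input is not relayed. -/
def typeTwo {w a l : ℕ} (f : Bits a → Bits l) (inp : Fin a ↪ Fin w) (drop : Finset (Fin w))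
    (out : Fin l ↪ Fin w) (ρ : QState w) : QState w :=
  basisChannel (fun s =>
    (Function.extend out (f (fun i => s (inp i)))
      (fun i => if i ∈ drop ∨ (∃ j, inp j = i) then false else s i),
     fun i => if (i ∈ drop ∨ ∃ j, out j = i) ∧ ¬ (∃ j, inp j = i) then s i else false)) ρ

/-- The two forms of superposition access. -/
inductive QueryType
  | one
  | two

/-- One step of a quantum oracle circuit on `w` qubits, for an oracle from `a` to `l` bits: a gate,
a query of type (1), or a query of type (2). There are no inverse queries. -/
inductive Step (w a l : ℕ)
  | gate (g : Gate w)
  | query₁ (e : Fin a ⊕ Fin l ↪ Fin w)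
  | query₂ (inp : Fin a ↪ Fin w) (out : Fin l ↪ Fin w)

/-- Only queries whose type lies in `Q` are used. -/
def Step.Allowed {w a l : ℕ} (Q : Set QueryType) : Step w a l → Prop
  | .gate _ => True
  | .query₁ _ => QueryType.one ∈ Q
  | .query₂ _ _ => QueryType.two ∈ Q

/-- Average of a family of states over uniformly random coins. -/
def coinAverage {w : ℕ} {R : Type} [Fintype R] (ρ : R → QState w) : QState w :=
  (Fintype.card R : ℂ)⁻¹ • ∑ r, ρ r

/-- Effect of a step, for a randomized oracle `f`: each query uses fresh uniform coins `r`, the same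
in all branches of the superposition. -/
def Step.run {w a l : ℕ} {R : Type} [Fintype R] (f : R → Bits a → Bits l) :
    Step w a l → QState w → QState w
  | .gate g, ρ => g.apply ρ
  | .query₁ e, ρ => coinAverage fun r => typeOne (f r) e ρ
  | .query₂ inp out, ρ => coinAverage fun r => typeTwo (f r) inp ∅ out ρ

/-- Run the steps of an oracle circuit in order. -/
def runSteps {w a l : ℕ} {R : Type} [Fintype R] (f : R → Bits a → Bits l)
    (C : List (Step w a l)) (ρ : QState w) : QState w :=
  C.foldl (fun σ step => step.run f σ) ρ

/-! ### Permutation families and pseudorandomness -/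

/-- A keyed family of permutations of `{0,1}^N`, for each block length `N`, with the key
distribution of its initialization algorithm. -/
structure PermFamily where
  Key : ℕ → Type
  keyDist : ∀ N, PMF (Key N)
  perm : ∀ N, Key N → Equiv.Perm (Bits N)

/-- A quantum circuit with an oracle on `N`-bit strings; it outputs the bit on qubit `result`. -/
structure Distinguisher (N : ℕ) where
  width : ℕ
  steps : List (Step width N N)
  result : Fin width

/-- Number of qubits plus number of gates and queries. -/
def Distinguisher.size {N : ℕ} (D : Distinguisher N) : ℕ := D.width + D.steps.length

/-- `Pr[D^{|π⟩} = 1]`. -/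
def Distinguisher.acceptProb {N : ℕ} (D : Distinguisher N) (π : Equiv.Perm (Bits N)) : ℝ :=
  measureProb D.result true (runSteps (fun _ : Unit => ⇑π) D.steps (zeroState D.width))

/-- At security parameter `n` the permutations of `{0,1}^(ℓ n)` in the family are indistinguishable
from uniformly random ones by polynomial-size quantum oracle circuits with superposition access of
the types in `Q`. -/
def IsQPRP (Q : Set QueryType) (P : PermFamily) (ℓ : ℕ → ℕ) : Prop :=
  ∀ D : (n : ℕ) → Distinguisher (ℓ n),
    (∀ n, ∀ step ∈ (D n).steps, step.Allowed Q) →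
    PolyBounded (fun n => (D n).size) →
    Negligible (fun n =>
      |(∑' k, (P.keyDist (ℓ n) k).toReal * (D n).acceptProb (P.perm (ℓ n) k)) -
        (∑ π : Equiv.Perm (Bits (ℓ n)), (D n).acceptProb π) /
          (Fintype.card (Equiv.Perm (Bits (ℓ n))) : ℝ)|)

/-! ### Secret-key encryption -/

/-- A secret-key encryption scheme, with the uniform coins of the encryption made explicit. -/
structure EncScheme where
  msgLen : ℕ → ℕ
  ctLen : ℕ → ℕ
  Key : ℕ → Type
  Coins : ℕ → Type
  coinsFintype : ∀ n, Fintype (Coins n)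
  coinsNonempty : ∀ n, Nonempty (Coins n)
  gen : ∀ n, PMF (Key n)
  enc : ∀ n, Key n → Coins n → Bits (msgLen n) → Bits (ctLen n)
  dec : ∀ n, Key n → Bits (ctLen n) → Bits (msgLen n)
  correct : ∀ n, ∀ k ∈ (gen n).support, ∀ r x, dec n k (enc n k r x) = x

attribute [instance] EncScheme.coinsFintype EncScheme.coinsNonempty

/-- The `i`-th of `μ` consecutive blocks of `N` bits. -/
def block {μ N : ℕ} (x : Bits (μ * N)) (i : Fin μ) : Bits N :=
  fun j => x (finProdFinEquiv (i, j))

/-- Concatenation of `μ` blocks of `N` bits. -/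
def unblock {μ N : ℕ} (y : Fin μ → Bits N) : Bits (μ * N) :=
  fun p => y (finProdFinEquiv.symm p).1 (finProdFinEquiv.symm p).2

/-- `y_1‖…‖y_μ` with `y_i = π (x_i‖r_i)`. -/
def ecbEnc {m τ μ : ℕ} (π : Equiv.Perm (Bits (m + τ))) (r : Fin μ → Bits τ) (x : Bits (μ * m)) :
    Bits (μ * (m + τ)) :=
  unblock fun i => π (Fin.append (block x i) (r i))

/-- `x_1‖…‖x_μ`, where `x_i` consists of the first `m` bits of `π⁻¹ (y_i)`. -/
def ecbDec {m τ μ : ℕ} (π : Equiv.Perm (Bits (m + τ))) (y : Bits (μ * (m + τ))) : Bits (μ * m) :=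
  unblock fun i => fun j => π.symm (block y i) (Fin.castAdd τ j)

theorem ecb_correct {m τ μ : ℕ} (π : Equiv.Perm (Bits (m + τ))) (r : Fin μ → Bits τ)
    (x : Bits (μ * m)) : ecbDec π (ecbEnc π r x) = x := by
  funext p
  have h : ∀ i : Fin μ, block (ecbEnc π r x) i = π (Fin.append (block x i) (r i)) := by
    intro i
    funext j
    simp [block, ecbEnc, unblock]
  simp only [ecbDec, unblock, h, Equiv.symm_apply_apply, Fin.append_left]
  simp only [block, Prod.mk.eta, Equiv.apply_symm_apply]

/-- The randomized-ECB scheme with `μ n` blocks of `m n` bits and `τ n` random bits per block. -/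
def randomizedECB (P : PermFamily) (m τ μ : ℕ → ℕ) : EncScheme where
  msgLen n := μ n * m n
  ctLen n := μ n * (m n + τ n)
  Key n := P.Key (m n + τ n)
  Coins n := Fin (μ n) → Bits (τ n)
  coinsFintype _ := inferInstance
  coinsNonempty _ := inferInstance
  gen n := P.keyDist (m n + τ n)
  enc n k r x := ecbEnc (P.perm (m n + τ n) k) r x
  dec n k y := ecbDec (P.perm (m n + τ n) k) y
  correct n k _ r x := ecb_correct (P.perm (m n + τ n) k) r x

/-! ### The gqIND-qCPA game -/

/-- An adversary circuit for message length `a` and ciphertext length `l`: the first learning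
phase, the two plaintext registers sent to the challenger (arbitrary, possibly entangled, states),
the register receiving the challenge ciphertext, the second learning phase, and the qubit holding
the guess. -/
structure GQINDAdversary (a l : ℕ) where
  width : ℕ
  first : List (Step width a l)
  plain : Bool × Fin a ↪ Fin width
  cipher : Fin l ↪ Fin width
  second : List (Step width a l)
  result : Fin width

/-- Number of qubits plus number of gates and queries. -/
def GQINDAdversary.size {a l : ℕ} (A : GQINDAdversary a l) : ℕ :=
  A.width + A.first.length + A.second.length

/-- The plaintext register with label `b`. -/
def GQINDAdversary.plainReg {a l : ℕ} (A : GQINDAdversary a l) (b : Bool) : Fin a ↪ Fin A.width :=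
  (Function.Embedding.sectR b (Fin a)).trans A.plain

/-- The challenge phase: register `1 - b` is traced out, register `b` is encrypted by the type-(2)
operator with fresh coins and returned. -/
def GQINDAdversary.challenge {a l : ℕ} {R : Type} [Fintype R] (A : GQINDAdversary a l)
    (f : R → Bits a → Bits l) (b : Bool) (ρ : QState A.width) : QState A.width :=
  coinAverage fun r =>
    typeTwo (f r) (A.plainReg b) (Finset.univ.map (A.plainReg (!b))) A.cipher ρ

/-- The probability of guessing the uniformly random challenge bit. -/
def GQINDAdversary.winProb {a l : ℕ} {R : Type} [Fintype R] (A : GQINDAdversary a l)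
    (f : R → Bits a → Bits l) : ℝ :=
  (∑ b : Bool, measureProb A.result b
    (runSteps f A.second (A.challenge f b (runSteps f A.first (zeroState A.width))))) / 2

/-- gqIND-qCPA security; learning queries are of the types in `Q`. -/
def GQINDqCPASecure (Q : Set QueryType) (E : EncScheme) : Prop :=
  ∀ A : (n : ℕ) → GQINDAdversary (E.msgLen n) (E.ctLen n),
    (∀ n, ∀ step ∈ (A n).first ++ (A n).second, step.Allowed Q) →
    PolyBounded (fun n => (A n).size) →
    Negligible (fun n => (∑' k, (E.gen n k).toReal * (A n).winProb (E.enc n k)) - 1 / 2)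

/-! ### The qIND-qCPA game -/

/-- All gates `H`, `T` and `CNOT` on `v` qubits. -/
def elementaryGates (v : ℕ) : List (Gate v) :=
  (List.finRange v).flatMap fun i =>
    ⟨.H, i, ∅, by simp⟩ :: ⟨.T, i, ∅, by simp⟩ ::
      (List.finRange v).filterMap fun j =>
        if h : j ≠ i then some ⟨.X, j, {i}, by simpa using h⟩ else none

/-- The list of all elementary gates on `v` qubits, repeated `g` times. -/
def gateTable (v g : ℕ) : List (Gate v) :=
  (List.replicate g (elementaryGates v)).flatten

/-- The circuit described by a bit string: bit `i` tells whether entry `i` of the table is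
applied. Every circuit of at most `g` elementary gates on `v` qubits has such a description. -/
def describedCircuit {v g : ℕ} (z : Bits (gateTable v g).length) : List (Gate v) :=
  (List.finRange (gateTable v g).length).filterMap fun i =>
    if z i then some ((gateTable v g).get i) else none

/-- The state of the qubits `o` of a `v`-qubit state; the other qubits are traced out. -/
def reducedState {v a : ℕ} (o : Fin a ↪ Fin v) (σ : QState v) : QState a :=
  Matrix.of fun x x' => ∑ u, ∑ u',
    if (∀ i, u (o i) = x i) ∧ (∀ i, u' (o i) = x' i) ∧ (∀ i, (∀ j, o j ≠ i) → u i = u' i)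
    then σ u u' else 0

/-- The state on the qubits `o` produced from `|0…0⟩` by the circuit described by `z`. -/
def describedState {v g a : ℕ} (o : Fin a ↪ Fin v) (z : Bits (gateTable v g).length) : QState a :=
  reducedState o ((describedCircuit z).foldl (fun σ gt => gt.apply σ) (zeroState v))

/-- An adversary circuit that sends classical descriptions: `desc` holds the two descriptions, of
circuits on `prepWidth` qubits whose outputs are the qubits `prepOut`. -/
structure QINDAdversary (a l : ℕ) where
  width : ℕ
  prepWidth : ℕ
  prepRounds : ℕ
  prepOut : Fin a ↪ Fin prepWidth
  first : List (Step width a l)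
  desc : Bool × Fin (gateTable prepWidth prepRounds).length ↪ Fin width
  cipher : Fin l ↪ Fin width
  second : List (Step width a l)
  result : Fin width

/-- Number of qubits plus number of gates and queries, and the size of the described circuits. -/
def QINDAdversary.size {a l : ℕ} (A : QINDAdversary a l) : ℕ :=
  A.width + A.prepWidth + A.prepRounds + A.first.length + A.second.length

/-- The challenge phase: both descriptions are measured in the computational basis, the state with
description `b` is built and encrypted by the type-(2) operator with fresh coins, and the result
replaces the contents of the register `cipher`. -/
def QINDAdversary.challenge {a l : ℕ} {R : Type} [Fintype R] (A : QINDAdversary a l)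
    (f : R → Bits a → Bits l) (b : Bool) (ρ : QState A.width) : QState A.width :=
  coinAverage fun r => Matrix.of fun t t' => ∑ s, ∑ s', ∑ x, ∑ x',
    if (∀ p, s (A.desc p) = s' (A.desc p)) ∧ (∀ j, s (A.cipher j) = s' (A.cipher j)) ∧
      Function.extend A.cipher (f r x) s = t ∧ Function.extend A.cipher (f r x') s' = t'
    then describedState A.prepOut (fun i => s (A.desc (b, i))) x x' * ρ s s' else 0

/-- The probability of guessing the uniformly random challenge bit. -/
def QINDAdversary.winProb {a l : ℕ} {R : Type} [Fintype R] (A : QINDAdversary a l)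
    (f : R → Bits a → Bits l) : ℝ :=
  (∑ b : Bool, measureProb A.result b
    (runSteps f A.second (A.challenge f b (runSteps f A.first (zeroState A.width))))) / 2

/-- qIND-qCPA security; learning queries are of the types in `Q`. -/
def QINDqCPASecure (Q : Set QueryType) (E : EncScheme) : Prop :=
  ∀ A : (n : ℕ) → QINDAdversary (E.msgLen n) (E.ctLen n),
    (∀ n, ∀ step ∈ (A n).first ++ (A n).second, step.Allowed Q) →
    PolyBounded (fun n => (A n).size) →
    Negligible (fun n => (∑' k, (E.gen n k).toReal * (A n).winProb (E.enc n k)) - 1 / 2)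

end QEnc

end

noncomputable section

namespace QEnc

open scoped ComplexOrder Matrix

set_option linter.unusedSectionVars false

/-! The proof has a computational half and an information-theoretic half.

Computational half. A whole game, including the encryption queries and the challenge, can be run by
a polynomial-size circuit that only has oracle access to the permutation. Encryption coins are
ancillas put into uniform superposition by Hadamard gates and never touched again; discarding them
turns the superposition into a uniform mixture (`implements_coins`). The permutation is applied
block by block, and every ancilla that should not stay correlated with the data is uncomputed
(`simulable_oneFun`, `simulable_twoFun`). For each value of the challenge bit this gives one
distinguisher (`Simulable.exists_distinguisher`), so by the qPRP property the keyed permutation may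
be replaced by a uniformly random one (`negligible_of_simulable`).

Information-theoretic half. The coins of one block are identified with a product `A × B` of two sets
of about 2^(τ/2) elements; the first component is called the class of the coins. Fix the challenge
coins and a block j whose coins have class p. Multiplying a random permutation π on the right by the
shift (z, p, b) ↦ (z + g, p, b + h z) of the class p gives again a random permutation. If no other
coins of the game lie in the class p, only block j of the challenge notices the shift. On average
over g and h, matrix entries between equal values of the plaintext block do not depend on that
value, while entries between different values see independent uniform coins and contribute at most
1/|B| in total. So block j may be replaced by zeros, with its old contents discarded
(`sum_shifted_sub`, `twirl_bound`, `eraseBlock_bound`).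

The assumption on the other coins fails rarely. In a learning query the coins are the same in all
branches, so each query is a classical mixture over coins, and dropping the coins that hit the class
p costs at most μ/|A| per query (`runStepsW_sub`, `sum_sub_avoidW`). A collision with another block
of the challenge has average weight at most μ/|A| (`card_coin_class`). With q steps in the learning
phases, erasing all blocks costs μ(1/|B| + (q + 1)μ/|A|) (`hybrid_good_bound`, `hybrid_bound`),
which is negligible.

Once all blocks are erased, the challenge depends only on the state left when the plaintext register
is traced out (`eraseHead_all`). In both games this state is the same for the two values of the
challenge bit (the two `sum_preState` lemmas), so the guess is right with probability exactly 1/2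
(`guess_random_perm_le`). -/

/-! ### Positive maps -/

section Channels

variable {Y T S E E' : Type} [Fintype Y] [Fintype T] [Fintype S]

/-- A linear map that preserves positive semidefiniteness. -/
structure IsPos (Φ : Matrix Y Y ℂ → Matrix T T ℂ) : Prop where
  lin : IsLinearMap ℂ Φ
  psd : ∀ X, X.PosSemidef → (Φ X).PosSemidef

/-- A positive map that preserves the trace. -/
structure IsChannel (Φ : Matrix Y Y ℂ → Matrix T T ℂ) : Prop extends IsPos Φ where
  trace_eq : ∀ X, (Φ X).trace = X.trace

/-- A real functional with `0 ≤ F X ≤ tr X` for positive semidefinite `X`. -/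
structure IsEffect (F : Matrix Y Y ℂ → ℝ) : Prop where
  lin : IsLinearMap ℝ F
  nonneg : ∀ X, X.PosSemidef → 0 ≤ F X
  le_trace : ∀ X, X.PosSemidef → F X ≤ X.trace.re

theorem IsPos.map_sub {Φ : Matrix Y Y ℂ → Matrix T T ℂ} (h : IsPos Φ) (X X' : Matrix Y Y ℂ) :
    Φ (X - X') = Φ X - Φ X' := h.lin.map_sub X X'

theorem IsPos.comp {Φ : Matrix Y Y ℂ → Matrix T T ℂ} {Ψ : Matrix T T ℂ → Matrix S S ℂ}
    (hΨ : IsPos Ψ) (hΦ : IsPos Φ) : IsPos (fun X => Ψ (Φ X)) where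
  lin := ⟨fun x y => by rw [hΦ.lin.map_add, hΨ.lin.map_add],
    fun c x => by rw [hΦ.lin.map_smul, hΨ.lin.map_smul]⟩
  psd X hX := hΨ.psd _ (hΦ.psd X hX)

theorem IsChannel.comp {Φ : Matrix Y Y ℂ → Matrix T T ℂ} {Ψ : Matrix T T ℂ → Matrix S S ℂ}
    (hΨ : IsChannel Ψ) (hΦ : IsChannel Φ) : IsChannel (fun X => Ψ (Φ X)) where
  toIsPos := hΨ.toIsPos.comp hΦ.toIsPos
  trace_eq X := by rw [hΨ.trace_eq, hΦ.trace_eq]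

theorem re_trace_nonneg {X : Matrix Y Y ℂ} (h : X.PosSemidef) : 0 ≤ X.trace.re :=
  (Complex.nonneg_iff.1 h.trace_nonneg).1

theorem isPos_sum {ι : Type} (s : Finset ι) (w : ι → ℝ) (hw : ∀ i, 0 ≤ w i)
    {Φ : ι → Matrix Y Y ℂ → Matrix T T ℂ} (h : ∀ i, IsPos (Φ i)) :
    IsPos (fun X => ∑ i ∈ s, (w i : ℂ) • Φ i X) where
  lin := by
    constructor
    · intro x y
      simp [(h _).lin.map_add, smul_add, Finset.sum_add_distrib]
    · intro c x
      simp only [(h _).lin.map_smul, Finset.smul_sum]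
      exact Finset.sum_congr rfl fun i _ => smul_comm _ _ _
  psd X hX := Matrix.posSemidef_sum _ fun i _ =>
    ((h i).psd X hX).smul (by simpa using hw i)

/-- The operation `ρ ↦ tr_E (V ρ V†)` for `V |s⟩ = |(F s).1⟩ ⊗ |(F s).2⟩_E`, over arbitrary finite
index types. -/
def isoChannel [DecidableEq T] [DecidableEq E] (F : Y → T × E) (ρ : Matrix Y Y ℂ) :
    Matrix T T ℂ :=
  Matrix.of fun t t' => ∑ s, ∑ s',
    if (F s).1 = t ∧ (F s').1 = t' ∧ (F s).2 = (F s').2 then ρ s s' else 0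

theorem basisChannel_eq {w : ℕ} (F : Bits w → Bits w × Bits w) (ρ : QState w) :
    basisChannel F ρ = isoChannel F ρ := rfl

variable [DecidableEq T] [DecidableEq S]

/-- The Kraus form, with one operator ⟨e|V for each value e of the environment; linearity and
positivity are read off from it. -/
theorem isoChannel_eq_sum [Fintype E] [DecidableEq E] (F : Y → T × E) (ρ : Matrix Y Y ℂ) :
    isoChannel F ρ = ∑ e, (Matrix.of fun t s => if F s = (t, e) then (1 : ℂ) else 0) * ρ *
      (Matrix.of fun t s => if F s = (t, e) then (1 : ℂ) else 0)ᴴ := by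
  ext t t'
  rw [Matrix.sum_apply]
  have star_ite : ∀ p : Prop, ∀ _ : Decidable p, star (if p then (1 : ℂ) else 0) = if p then 1 else 0 := by
    intro p _; split_ifs <;> simp
  simp only [isoChannel, Matrix.of_apply, Matrix.mul_apply, Matrix.conjTranspose_apply, Finset.sum_mul,
    star_ite]
  conv_rhs => rw [Finset.sum_comm]
  conv_rhs => enter [2, s]; rw [Finset.sum_comm]
  conv_lhs => rw [Finset.sum_comm]
  refine Finset.sum_congr rfl fun s' _ => Finset.sum_congr rfl fun s _ => ?_
  rw [Finset.sum_eq_single (F s').2]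
  · by_cases h1 : (F s).1 = t <;> by_cases h2 : (F s').1 = t' <;>
      by_cases h3 : (F s).2 = (F s').2 <;> simp [Prod.ext_iff, h1, h2, h3]
  · intro e _ he
    have : F s' ≠ (t', e) := fun h => he (by rw [h])
    simp [this]
  · simp

theorem isoChannel_isPos [Finite E] [DecidableEq E] (F : Y → T × E) : IsPos (isoChannel F) := by
  have := Fintype.ofFinite E
  constructor
  · constructor
    · intro x y
      simp only [isoChannel_eq_sum, Matrix.mul_add, Matrix.add_mul, Finset.sum_add_distrib]
    · intro c x
      simp only [isoChannel_eq_sum, Finset.smul_sum, Matrix.mul_smul, Matrix.smul_mul]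
  · intro X hX
    rw [isoChannel_eq_sum]
    exact Matrix.posSemidef_sum _ fun e _ => hX.mul_mul_conjTranspose_same _

/-- In the trace, the pair (s, s') survives only if `F s = F s'`, so injectivity leaves the diagonal
of X. -/
theorem isoChannel_trace [DecidableEq E] {F : Y → T × E} (hF : Function.Injective F)
    (X : Matrix Y Y ℂ) : (isoChannel F X).trace = X.trace := by
  classical
  simp only [isoChannel, Matrix.trace, Matrix.diag, Matrix.of_apply]
  rw [Finset.sum_comm]
  refine Finset.sum_congr rfl fun s _ => ?_
  rw [Finset.sum_comm, Finset.sum_eq_single s]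
  · simp
  · intro s' _ hs'
    refine Finset.sum_eq_zero fun t _ => if_neg ?_
    rintro ⟨h1, h2, h3⟩
    exact hs' (hF (Prod.ext (h2.trans h1.symm) h3.symm))
  · simp

theorem isoChannel_isChannel [Finite E] [DecidableEq E] {F : Y → T × E}
    (hF : Function.Injective F) : IsChannel (isoChannel F) :=
  ⟨isoChannel_isPos F, isoChannel_trace hF⟩

/-- Only the equality kernel of the environment matters. -/
theorem isoChannel_congr [DecidableEq E] [DecidableEq E'] {F : Y → T × E} {G : Y → T × E'}
    (h1 : ∀ s, (F s).1 = (G s).1)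
    (h2 : ∀ s s', (F s).2 = (F s').2 ↔ (G s).2 = (G s').2) (X : Matrix Y Y ℂ) :
    isoChannel F X = isoChannel G X := by
  ext t t'
  simp only [isoChannel, Matrix.of_apply, h1, h2]

/-- Discarding twice is discarding a pair. Composites are therefore again given by functions on
basis states, and can be compared through `isoChannel_congr`. -/
theorem isoChannel_comp [DecidableEq E] [DecidableEq E'] (G : T → S × E') (F : Y → T × E)
    (X : Matrix Y Y ℂ) : isoChannel G (isoChannel F X) =
      isoChannel (fun s => ((G (F s).1).1, ((F s).2, (G (F s).1).2))) X := by
  ext t t'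
  simp only [isoChannel, Matrix.of_apply]
  have : ∀ u u' : T, (if (G u).1 = t ∧ (G u').1 = t' ∧ (G u).2 = (G u').2 then
      ∑ s, ∑ s', (if (F s).1 = u ∧ (F s').1 = u' ∧ (F s).2 = (F s').2 then X s s' else 0) else 0)
      = ∑ s, ∑ s', if (F s).1 = u then if (F s').1 = u' then
        (if (G (F s).1).1 = t ∧ (G (F s').1).1 = t' ∧ (F s).2 = (F s').2 ∧
          (G (F s).1).2 = (G (F s').1).2 then X s s' else 0) else 0 else 0 := by
    intro u u'
    split_ifs with h
    · refine Finset.sum_congr rfl fun s _ => Finset.sum_congr rfl fun s' _ => ?_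
      by_cases h1 : (F s).1 = u <;> by_cases h2 : (F s').1 = u' <;>
        simp [h1, h2, h]
    · refine (Finset.sum_eq_zero fun s _ => Finset.sum_eq_zero fun s' _ => ?_).symm
      split_ifs with h1 h2 h3
      · rw [h1, h2] at h3
        exact absurd ⟨h3.1, h3.2.1, h3.2.2.2⟩ h
      all_goals rfl
  simp_rw [this]
  simp_rw [Finset.sum_comm (s := (Finset.univ : Finset T)) (t := (Finset.univ : Finset Y))]
  refine Finset.sum_congr rfl fun s _ => Finset.sum_congr rfl fun s' _ => ?_
  simp [Prod.ext_iff]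

end Channels

/-! ### Gates and queries are channels -/

theorem sum_agree_off {w : ℕ} (a : Fin w) (t : Bits w) (φ : Bits w → ℂ) :
    (∑ u : Bits w, if ∀ i, i ≠ a → u i = t i then φ u else 0) =
      ∑ b, φ (Function.update t a b) := by
  rw [← Finset.sum_filter]
  symm
  refine Finset.sum_bij (fun b _ => Function.update t a b) ?_ ?_ ?_ ?_
  · intro b _
    simp +contextual [Function.update_of_ne]
  · intro b _ b' _ h
    simpa using congrFun h a
  · intro u hu
    refine ⟨u a, Finset.mem_univ _, ?_⟩
    ext i
    by_cases h : i = a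
    · subst h; simp
    · rw [Function.update_of_ne h]; exact ((Finset.mem_filter.1 hu).2 i h).symm
  · intros; rfl

theorem GateKind.mat_unitary (k : GateKind) : k.matᴴ * k.mat = 1 := by
  have h2 : ((Real.sqrt 2 : ℝ) : ℂ) * ((Real.sqrt 2 : ℝ) : ℂ) = 2 := by
    rw [← Complex.ofReal_mul, Real.mul_self_sqrt (by norm_num)]; norm_num
  have hs : ((Real.sqrt 2 : ℝ) : ℂ) ≠ 0 := by
    intro h; rw [h] at h2; norm_num at h2
  ext a b
  rw [Matrix.mul_apply]
  cases k
  · cases a <;> cases b <;> simp [GateKind.mat]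
  · cases a <;> cases b <;>
      simp [GateKind.mat] <;> field_simp <;>
      simp only [pow_two, h2] <;> norm_num
  · cases a <;> cases b <;> simp [GateKind.mat]
    rw [← Complex.exp_conj, ← Complex.exp_add]
    have h4 : (starRingEnd ℂ) 4 = 4 := Complex.conj_ofNat 4
    simp [h4, neg_div]

/-- The target is not a control, so two basis states that agree off the target satisfy the controls
simultaneously. The matrix thus splits into copies of the 2 × 2 unitary and of the identity. -/
theorem Gate.mat_unitary {w : ℕ} (g : Gate w) : g.matᴴ * g.mat = 1 := by
  ext s t
  rw [Matrix.mul_apply]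
  simp only [Matrix.conjTranspose_apply, Gate.mat, Matrix.of_apply]
  have key : ∀ s t : Bits w, (∀ i, i ≠ g.target → s i = t i) →
      ((∀ c ∈ g.controls, t c = true) ↔ (∀ c ∈ g.controls, s c = true)) := by
    intro s t h
    refine forall₂_congr fun c hc => ?_
    rw [h c fun h => g.target_notMem (h ▸ hc)]
  by_cases ht : ∀ c ∈ g.controls, t c = true
  · by_cases hs : ∀ c ∈ g.controls, s c = true
    · simp only [if_pos ht, if_pos hs]
      have : ∀ u : Bits w, (star (if ∀ i, i ≠ g.target → u i = s i then
          g.kind.mat (u g.target) (s g.target) else 0) *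
          if ∀ i, i ≠ g.target → u i = t i then g.kind.mat (u g.target) (t g.target) else 0) =
          if ∀ i, i ≠ g.target → u i = t i then (star (if ∀ i, i ≠ g.target → u i = s i then
          g.kind.mat (u g.target) (s g.target) else 0) * g.kind.mat (u g.target) (t g.target))
          else 0 := by
        intro u; split_ifs <;> simp
      simp_rw [this]
      rw [sum_agree_off]
      have h2 : ∀ b, (∀ i, i ≠ g.target → Function.update t g.target b i = s i) ↔
          ∀ i, i ≠ g.target → t i = s i := fun b =>
        forall₂_congr fun i hi => by rw [Function.update_of_ne hi]
      simp only [h2, Function.update_self]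
      have h3 := congrFun (congrFun g.kind.mat_unitary (s g.target)) (t g.target)
      rw [Matrix.mul_apply] at h3
      simp only [Matrix.conjTranspose_apply] at h3
      by_cases h : ∀ i, i ≠ g.target → t i = s i
      · simp only [if_pos h]
        have hh := h3
        simp only [Matrix.one_apply] at hh ⊢
        by_cases hst : s = t
        · subst hst; simpa using hh
        · have : s g.target ≠ t g.target := fun h' => hst <| by
            ext i; by_cases hi : i = g.target
            · rw [hi, h']
            · rw [h i hi]
          simpa [hst, this] using hh
      · have : s ≠ t := fun h' => h fun i _ => by rw [h']
        simp only [if_neg h]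
        simp [this]
    · have hst : s ≠ t := fun h => hs (h ▸ ht)
      simp only [if_pos ht, if_neg hs]
      rw [Matrix.one_apply_ne hst, Finset.sum_eq_single s]
      · rw [if_neg (c := ∀ i, i ≠ g.target → s i = t i) fun h => hs ((key s t h).1 ht), mul_zero]
      · intro u _ hu; simp [hu]
      · simp
  · simp only [if_neg ht]
    rw [Finset.sum_eq_single t]
    · by_cases hs : ∀ c ∈ g.controls, s c = true
      · have hst : s ≠ t := fun h => ht (h ▸ hs)
        rw [Matrix.one_apply_ne hst, if_pos hs, if_neg fun h => ht ((key t s h).1 hs)]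
        simp
      · simp only [if_neg hs, Matrix.one_apply, eq_comm (a := t)]
        split_ifs <;> simp
    · intro u _ hu; simp [hu]
    · simp

theorem Gate.apply_isChannel {w : ℕ} (g : Gate w) : IsChannel g.apply where
  lin := ⟨fun x y => by simp [Gate.apply, mul_add, add_mul], fun c x => by simp [Gate.apply]⟩
  psd X hX := hX.mul_mul_conjTranspose_same _
  trace_eq X := by
    rw [Gate.apply, Matrix.trace_mul_comm, ← Matrix.mul_assoc, g.mat_unitary, Matrix.one_mul]

/-- The wires holding x are not overwritten, so x is known from the output and the XOR can be
undone. -/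
theorem typeOne_isChannel {w a l : ℕ} (f : Bits a → Bits l) (e : Fin a ⊕ Fin l ↪ Fin w) :
    IsChannel (typeOne f e) := by
  refine isoChannel_isChannel ?_
  intro s s' h
  simp only [Prod.mk.injEq, and_true] at h
  have hinj : Function.Injective fun j : Fin l => e (Sum.inr j) := fun j j' h => by simpa using h
  have hoff : ∀ i, (¬ ∃ j, e (Sum.inr j) = i) → s i = s' i := by
    intro i hi
    have := congrFun h i
    rwa [Function.extend_apply' _ _ _ hi, Function.extend_apply' _ _ _ hi] at this
  have hx : (fun i => s (e (Sum.inl i))) = fun i => s' (e (Sum.inl i)) := by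
    ext i
    rw [hoff]
    rintro ⟨j, hj⟩
    simp at hj
  ext i
  by_cases hi : ∃ j, e (Sum.inr j) = i
  · obtain ⟨j, rfl⟩ := hi
    have := congrFun h (e (Sum.inr j))
    erw [hinj.extend_apply, hinj.extend_apply] at this
    rw [hx] at this
    simpa using this
  · rw [hoff i hi]

/-- The input is recovered from the output wires by injectivity of `f`, the overwritten and dropped
wires from the environment, and all the others are unchanged. -/
theorem typeTwo_isChannel {w a l : ℕ} {f : Bits a → Bits l} (hf : Function.Injective f)
    (inp : Fin a ↪ Fin w) (drop : Finset (Fin w)) (out : Fin l ↪ Fin w) :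
    IsChannel (typeTwo f inp drop out) := by
  refine isoChannel_isChannel ?_
  intro s s' h
  simp only [Prod.mk.injEq] at h
  obtain ⟨h1, h2⟩ := h
  have hx : (fun i => s (inp i)) = fun i => s' (inp i) := by
    apply hf
    ext j
    have := congrFun h1 (out j)
    rwa [out.injective.extend_apply, out.injective.extend_apply] at this
  ext i
  by_cases hi : ∃ j, inp j = i
  · obtain ⟨j, rfl⟩ := hi
    rw [congrFun hx j]
  · by_cases ho : i ∈ drop ∨ ∃ j, out j = i
    · have := congrFun h2 i
      simp only [ho, hi, not_false_eq_true, and_self, if_true] at this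
      rw [this]
    · have := congrFun h1 i
      rw [not_or] at ho
      rw [Function.extend_apply' _ _ _ ho.2, Function.extend_apply' _ _ _ ho.2] at this
      simp only [ho.1, hi, or_self, if_false] at this
      rw [this]

/-! ### Runs with weighted coins -/

section Weighted

variable {w a l : ℕ} {R : Type} [Fintype R]

/-- A step whose coins are weighted by `c` instead of uniform. -/
def Step.runW (c : R → ℝ) (f : R → Bits a → Bits l) : Step w a l → QState w → QState w
  | .gate g, ρ => g.apply ρ
  | .query₁ e, ρ => ∑ r, (c r : ℂ) • typeOne (f r) e ρ
  | .query₂ inp out, ρ => ∑ r, (c r : ℂ) • typeTwo (f r) inp ∅ out ρ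

/-- The steps of an oracle circuit with coins weighted by `c`. -/
def runStepsW (c : R → ℝ) (f : R → Bits a → Bits l) (C : List (Step w a l)) (ρ : QState w) :
    QState w :=
  C.foldl (fun σ step => step.runW c f σ) ρ

theorem Step.run_eq_runW (f : R → Bits a → Bits l) (s : Step w a l) :
    s.run f = s.runW (fun _ => (Fintype.card R : ℝ)⁻¹) f := by
  ext ρ : 1
  cases s <;> simp [Step.run, Step.runW, coinAverage, Finset.smul_sum]

theorem runSteps_eq_runStepsW (f : R → Bits a → Bits l) (C : List (Step w a l)) :
    runSteps f C = runStepsW (fun _ => (Fintype.card R : ℝ)⁻¹) f C := by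
  ext ρ : 1
  simp only [runSteps, runStepsW, Step.run_eq_runW]

variable {f : R → Bits a → Bits l} {c d : R → ℝ}

/-- Coins of weight zero never occur. This is how a change of the permutation on a class of coins
goes unnoticed by queries whose coins avoid the class. -/
theorem Step.runW_congr {f' : R → Bits a → Bits l} (h : ∀ r, c r ≠ 0 → f r = f' r)
    (s : Step w a l) : s.runW c f = s.runW c f' := by
  ext ρ : 1
  cases s <;> simp only [Step.runW]
  all_goals
    refine Finset.sum_congr rfl fun r _ => ?_
    by_cases hr : c r = 0
    · simp [hr]
    · rw [h r hr]

theorem runStepsW_congr {f' : R → Bits a → Bits l} (h : ∀ r, c r ≠ 0 → f r = f' r)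
    (C : List (Step w a l)) : runStepsW c f C = runStepsW c f' C := by
  ext ρ : 1
  simp only [runStepsW, Step.runW_congr h]

theorem Step.runW_isPos (hc : ∀ r, 0 ≤ c r) (hf : ∀ r, Function.Injective (f r))
    (s : Step w a l) : IsPos (s.runW c f) := by
  cases s with
  | gate g => exact g.apply_isChannel.toIsPos
  | query₁ e => exact isPos_sum _ c hc fun r => (typeOne_isChannel (f r) e).toIsPos
  | query₂ i o => exact isPos_sum _ c hc fun r => (typeTwo_isChannel (hf r) i ∅ o).toIsPos

theorem runStepsW_isPos (hc : ∀ r, 0 ≤ c r) (hf : ∀ r, Function.Injective (f r))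
    (C : List (Step w a l)) : IsPos (runStepsW c f C) := by
  induction C with
  | nil => exact ⟨⟨fun _ _ => rfl, fun _ _ => rfl⟩, fun _ h => h⟩
  | cons s C ih => exact ih.comp (s.runW_isPos hc hf)

theorem Step.runW_trace (hd : ∑ r, d r = 1) (hf : ∀ r, Function.Injective (f r))
    (s : Step w a l) (X : QState w) : (s.runW d f X).trace = X.trace := by
  have hd' : ∑ r, (d r : ℂ) = 1 := by exact_mod_cast congrArg ((↑) : ℝ → ℂ) hd
  cases s with
  | gate g => exact g.apply_isChannel.trace_eq X
  | query₁ e =>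
    simp only [Step.runW, Matrix.trace_sum, Matrix.trace_smul, (typeOne_isChannel _ e).trace_eq,
      ← Finset.sum_smul, hd', one_smul]
  | query₂ i o =>
    simp only [Step.runW, Matrix.trace_sum, Matrix.trace_smul,
      (typeTwo_isChannel (hf _) i ∅ o).trace_eq, ← Finset.sum_smul, hd', one_smul]

theorem runStepsW_isChannel (h0 : ∀ r, 0 ≤ d r) (hd : ∑ r, d r = 1)
    (hf : ∀ r, Function.Injective (f r)) (C : List (Step w a l)) :
    IsChannel (runStepsW d f C) := by
  refine ⟨runStepsW_isPos h0 hf C, ?_⟩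
  induction C with
  | nil => intro X; rfl
  | cons s C ih => intro X; exact (ih _).trans (s.runW_trace hd hf X)

/-- The difference of two weighted mixtures is the mixture with weights `d - c ≥ 0`, hence positive,
and its trace is scaled by the total of these weights. -/
theorem Step.runW_sub (hcd : ∀ r, c r ≤ d r) (hf : ∀ r, Function.Injective (f r)) {δ : ℝ}
    (hδ : 0 ≤ δ) (hdc : ∑ r, (d r - c r) ≤ δ) (s : Step w a l) {X : QState w}
    (hX : X.PosSemidef) :
    (s.runW d f X - s.runW c f X).PosSemidef ∧
      (s.runW d f X - s.runW c f X).trace.re ≤ δ * X.trace.re := by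
  have key : ∀ Φ : R → QState w → QState w, (∀ r, IsChannel (Φ r)) →
      (∑ r, (d r : ℂ) • Φ r X - ∑ r, (c r : ℂ) • Φ r X).PosSemidef ∧
      (∑ r, (d r : ℂ) • Φ r X - ∑ r, (c r : ℂ) • Φ r X).trace.re ≤ δ * X.trace.re := by
    intro Φ hΦ
    have : ∑ r, (d r : ℂ) • Φ r X - ∑ r, (c r : ℂ) • Φ r X =
        ∑ r, ((d r - c r : ℝ) : ℂ) • Φ r X := by
      simp [sub_smul]
    rw [this]
    refine ⟨(isPos_sum _ (fun r => d r - c r) (fun r => sub_nonneg.2 (hcd r))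
      fun r => (hΦ r).toIsPos).psd X hX, ?_⟩
    simp only [Matrix.trace_sum, Matrix.trace_smul, (hΦ _).trace_eq, smul_eq_mul,
      ← Finset.sum_mul]
    rw [← Complex.ofReal_sum, Complex.re_ofReal_mul]
    exact mul_le_mul_of_nonneg_right hdc (re_trace_nonneg hX)
  cases s with
  | gate g =>
    simp only [Step.runW, sub_self]
    exact ⟨Matrix.PosSemidef.zero, by simpa using mul_nonneg hδ (re_trace_nonneg hX)⟩
  | query₁ e => exact key _ fun r => typeOne_isChannel (f r) e
  | query₂ i o => exact key _ fun r => typeTwo_isChannel (hf r) i ∅ o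

/-- The lowered weights are dominated by a probability distribution, which preserves the trace; by
`Step.runW_sub` the difference of the two is positive. -/
theorem runStepsW_trace_le (hc : ∀ r, 0 ≤ c r) (hcd : ∀ r, c r ≤ d r) (hd : ∑ r, d r = 1)
    (hf : ∀ r, Function.Injective (f r)) (C : List (Step w a l)) {X : QState w}
    (hX : X.PosSemidef) : (runStepsW c f C X).trace.re ≤ X.trace.re := by
  induction C generalizing X with
  | nil => exact le_rfl
  | cons s C ih =>
    refine (ih ((s.runW_isPos hc hf).psd X hX)).trans ?_
    have h := (s.runW_sub hcd hf (δ := ∑ r, (d r - c r))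
      (Finset.sum_nonneg fun r _ => sub_nonneg.2 (hcd r)) le_rfl hX).1
    have := re_trace_nonneg h
    rw [Matrix.trace_sub, Complex.sub_re, s.runW_trace hd hf] at this
    linarith

/-- Lowering the weights of the coins by a total of `δ` loses at most `δ` per step. -/
theorem runStepsW_sub (hc : ∀ r, 0 ≤ c r) (hcd : ∀ r, c r ≤ d r) (hd : ∑ r, d r = 1)
    (hf : ∀ r, Function.Injective (f r)) {δ : ℝ} (hδ : 0 ≤ δ) (hdc : ∑ r, (d r - c r) ≤ δ)
    (C : List (Step w a l)) {X : QState w} (hX : X.PosSemidef) :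
    (runStepsW d f C X - runStepsW c f C X).PosSemidef ∧
      (runStepsW d f C X - runStepsW c f C X).trace.re ≤ C.length * δ * X.trace.re := by
  have h0 : ∀ r, 0 ≤ d r := fun r => (hc r).trans (hcd r)
  induction C generalizing X with
  | nil =>
    simp only [runStepsW, List.foldl_nil, sub_self]
    exact ⟨Matrix.PosSemidef.zero, by simp⟩
  | cons s C ih =>
    have h1 := ih ((s.runW_isPos h0 hf).psd X hX)
    have h2 := s.runW_sub hcd hf hδ hdc hX
    have hpos := runStepsW_isPos hc hf C
    -- The weights are lowered first in the later steps and then in `s`. The loss in `s` is a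
    -- positive matrix, and the remaining steps do not increase its trace.
    have e : runStepsW d f (s :: C) X - runStepsW c f (s :: C) X =
        (runStepsW d f C (s.runW d f X) - runStepsW c f C (s.runW d f X)) +
          runStepsW c f C (s.runW d f X - s.runW c f X) := by
      rw [hpos.map_sub]
      simp [runStepsW]
    rw [e]
    refine ⟨h1.1.add (hpos.psd _ h2.1), ?_⟩
    rw [Matrix.trace_add, Complex.add_re]
    have h3 := runStepsW_trace_le hc hcd hd hf C h2.1
    have h4 := h1.2
    rw [s.runW_trace hd hf] at h4
    push_cast [List.length_cons]
    linarith [h2.2]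

end Weighted

theorem measureProb_isEffect {w : ℕ} (i : Fin w) (b : Bool) : IsEffect (measureProb i b) where
  lin := by
    constructor
    · intro x y
      simp only [measureProb, ← Finset.sum_add_distrib]
      exact Finset.sum_congr rfl fun s _ => by split_ifs <;> simp
    · intro c x
      simp only [measureProb, Finset.smul_sum]
      exact Finset.sum_congr rfl fun s _ => by split_ifs <;> simp
  nonneg X hX := Finset.sum_nonneg fun s _ => by
    split_ifs
    · exact (Complex.nonneg_iff.1 hX.diag_nonneg).1
    · exact le_rfl
  le_trace X hX := by
    rw [Matrix.trace, Complex.re_sum]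
    refine Finset.sum_le_sum fun s _ => ?_
    split_ifs
    · exact le_rfl
    · exact (Complex.nonneg_iff.1 hX.diag_nonneg).1

theorem measureProb_add {w : ℕ} (i : Fin w) (X : QState w) :
    measureProb i true X + measureProb i false X = X.trace.re := by
  simp only [measureProb, Matrix.trace, Complex.re_sum, ← Finset.sum_add_distrib]
  exact Finset.sum_congr rfl fun s _ => by cases s i <;> simp

theorem zeroState_eq {w : ℕ} : zeroState w =
    Matrix.vecMulVec (Pi.single (fun _ => false) 1) (star (Pi.single (fun _ => false) 1)) := by
  ext s t
  simp only [zeroState, Matrix.of_apply, Matrix.vecMulVec_apply, Pi.star_apply, Pi.single_apply]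
  split_ifs <;> simp_all

theorem zeroState_posSemidef {w : ℕ} : (zeroState w).PosSemidef := by
  rw [zeroState_eq]; exact Matrix.posSemidef_vecMulVec_self_star _

theorem zeroState_trace {w : ℕ} : (zeroState w).trace = 1 := by
  simp [zeroState, Matrix.trace]

/-! ### Twirling -/

/-- The values of a uniformly random function at two points are independent and uniform. -/
theorem sum_fun_pair {Z B : Type} [Fintype Z] [DecidableEq Z] [AddCommGroup B] [Fintype B]
    {z z' : Z} (h : z ≠ z') (φ : B → B → ℂ) :
    (Fintype.card B : ℂ) ^ 2 * ∑ k : Z → B, φ (k z) (k z') =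
      Fintype.card (Z → B) * ∑ b, ∑ b', φ b b' := by
  -- Translating `k` at the two points z ≠ z' is a bijection of the functions, and it moves the pair
  -- of values by an arbitrary (b, b').
  have shift : ∀ b b' : B, ∑ k : Z → B, φ (k z) (k z') = ∑ k : Z → B, φ (k z + b) (k z' + b') := by
    intro b b'
    refine (Fintype.sum_equiv (Equiv.addRight (Pi.single z b + Pi.single z' b')) _ _ fun k => ?_).symm
    simp [h, h.symm]
  have : ∑ b : B, ∑ b' : B, ∑ k : Z → B, φ (k z + b) (k z' + b') =
      ∑ b : B, ∑ b' : B, ∑ k : Z → B, φ (k z) (k z') :=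
    Finset.sum_congr rfl fun b _ => Finset.sum_congr rfl fun b' _ => (shift b b').symm
  simp only [Finset.sum_const, Finset.card_univ, nsmul_eq_mul] at this
  rw [pow_two, mul_assoc, ← this]
  have h2 : ∀ k : Z → B, ∑ b : B, ∑ b' : B, φ (k z + b) (k z' + b') = ∑ b, ∑ b', φ b b' := by
    intro k
    refine Fintype.sum_equiv (Equiv.addLeft (k z)) _ _ fun b => ?_
    exact Fintype.sum_equiv (Equiv.addLeft (k z')) _ _ fun b' => rfl
  calc _ = ∑ b : B, ∑ k : Z → B, ∑ b' : B, φ (k z + b) (k z' + b') :=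
        Finset.sum_congr rfl fun b _ => Finset.sum_comm
    _ = ∑ k : Z → B, ∑ b : B, ∑ b' : B, φ (k z + b) (k z' + b') := Finset.sum_comm
    _ = _ := by simp [h2]

section Twirl

variable {Y T E Z B : Type} [Fintype Y] [DecidableEq Y] [Fintype T] [DecidableEq T] [DecidableEq E]
  [AddCommGroup Z] [Fintype Z] [DecidableEq Z] [AddCommGroup B] [Fintype B]

/-- `W y` with its second argument moved by the random shift `p`. -/
def shifted (z : Y → Z) (W : Y → Z × B → T × E) (b₀ : B) (p : Z × (Z → B)) (y : Y) : T × E :=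
  W y (z y + p.1, b₀ + p.2 (z y))

/-- The identity behind the erasure. Entries with `z y = z y'` cancel on the left because of the
random translation of z, and entries with `z y ≠ z y'` see two independent uniform elements of B.
The right side isolates the latter entries as a difference of two operations: on ω tensored with the
all-ones matrix on B, without and with z kept in the environment. Both are positive with known
trace, which makes the difference easy to bound. -/
theorem sum_shifted_sub (z : Y → Z) (W : Y → Z × B → T × E) (y₀ : Y → Y) (z₀ : Z) (b₀ : B)
    (hz : ∀ y, z (y₀ y) = z₀) (hW : ∀ y, W (y₀ y) = W y) (ω : Matrix Y Y ℂ) :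
    ∑ p, (isoChannel (shifted z W b₀ p) ω -
        isoChannel (shifted z W b₀ p) (isoChannel (fun y => (y₀ y, z y)) ω)) =
      ∑ g, ((Fintype.card (Z → B) / (Fintype.card B : ℝ) ^ 2 : ℝ) : ℂ) •
        (isoChannel (fun q : Y × B => W q.1 (z q.1 + g, q.2)) (ω.submatrix Prod.fst Prod.fst) -
          isoChannel (fun q : Y × B => ((W q.1 (z q.1 + g, q.2)).1,
            ((W q.1 (z q.1 + g, q.2)).2, z q.1))) (ω.submatrix Prod.fst Prod.fst)) := by
  classical
  simp only [isoChannel_comp]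
  ext t t'
  simp only [Matrix.sum_apply, Matrix.sub_apply, Matrix.smul_apply, isoChannel, Matrix.of_apply,
    Matrix.submatrix_apply, smul_eq_mul, ← Finset.sum_sub_distrib, Fintype.sum_prod_type, shifted,
    hW, hz]
  set N : ℂ := ((Fintype.card (Z → B) / (Fintype.card B : ℝ) ^ 2 : ℝ) : ℂ) with hN
  have hcB : (Fintype.card B : ℂ) ≠ 0 := by simp
  -- move the sums over `y`, `y'` outside
  have lhs : ∀ Φ : Z → (Z → B) → Y → Y → ℂ, ∑ g, ∑ h, ∑ y, ∑ y', Φ g h y y' =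
      ∑ y, ∑ y', ∑ g, ∑ h, Φ g h y y' := by
    intro Φ
    simp_rw [Finset.sum_comm (s := (Finset.univ : Finset (Z → B))) (t := (Finset.univ : Finset Y))]
    simp_rw [Finset.sum_comm (s := (Finset.univ : Finset Z)) (t := (Finset.univ : Finset Y))]
  have rhs : ∀ Φ : Z → Y → B → Y → B → ℂ, ∑ g, N * ∑ y, ∑ b, ∑ y', ∑ b', Φ g y b y' b' =
      ∑ y, ∑ y', ∑ g, N * ∑ b, ∑ b', Φ g y b y' b' := by
    intro Φ
    simp_rw [Finset.mul_sum]
    simp_rw [Finset.sum_comm (s := (Finset.univ : Finset B)) (t := (Finset.univ : Finset Y))]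
    simp_rw [Finset.sum_comm (s := (Finset.univ : Finset Z)) (t := (Finset.univ : Finset Y))]
  rw [lhs, rhs]
  refine Finset.sum_congr rfl fun y _ => Finset.sum_congr rfl fun y' _ => ?_
  by_cases h : z y = z y'
  · simp only [h, Prod.mk.injEq, and_true, true_and, sub_self, Finset.sum_const_zero, mul_zero]
    simp only [Finset.sum_sub_distrib]
    rw [sub_eq_zero, ← Fintype.sum_prod_type', ← Fintype.sum_prod_type']
    -- The reindexing g ↦ g + (z y' - z₀), together with the matching translation of the argument of
    -- h, turns the unerased term into the erased one: z₀ + g becomes z y' + g, and h z₀ becomes h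
    -- (z y').
    refine Fintype.sum_equiv ((Equiv.addRight (z y' - z₀)).prodCongr
      (Equiv.arrowCongr (Equiv.addRight (z₀ - z y')) (Equiv.refl B))) _ _ fun p => ?_
    have e : z₀ - (z₀ - z y') = z y' := by abel
    have e2 : z₀ + (p.1 + (z y' - z₀)) = z y' + p.1 := by abel
    simp [Equiv.arrowCongr, e2]
  -- Here the environment of the erased version distinguishes y from y', so only the unerased term
  -- is left.
  · simp only [h, Prod.mk.injEq, and_false, false_and, if_false, sub_zero]
    refine Finset.sum_congr rfl fun g _ => ?_
    have := sum_fun_pair h fun b b' =>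
      if (W y (z y + g, b₀ + b)).1 = t ∧ (W y' (z y' + g, b₀ + b')).1 = t' ∧
        (W y (z y + g, b₀ + b)).2 = (W y' (z y' + g, b₀ + b')).2 then ω y y' else 0
    have h2 : ∑ b, ∑ b', (if (W y (z y + g, b₀ + b)).1 = t ∧ (W y' (z y' + g, b₀ + b')).1 = t' ∧
        (W y (z y + g, b₀ + b)).2 = (W y' (z y' + g, b₀ + b')).2 then ω y y' else 0) =
        ∑ b, ∑ b', (if (W y (z y + g, b)).1 = t ∧ (W y' (z y' + g, b')).1 = t' ∧
        (W y (z y + g, b)).2 = (W y' (z y' + g, b')).2 then ω y y' else 0) := by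
      refine Fintype.sum_equiv (Equiv.addLeft b₀) _ _ fun b => ?_
      exact Fintype.sum_equiv (Equiv.addLeft b₀) _ _ fun b' => rfl
    rw [h2] at this
    rw [hN]
    push_cast
    rw [div_mul_eq_mul_div, eq_div_iff (pow_ne_zero 2 hcB), mul_comm]
    exact this

/-- Under a random shift, an arbitrary register is almost as good as an erased one. -/
theorem twirl_bound [Finite E] (z : Y → Z) (W : Y → Z × B → T × E) (y₀ : Y → Y) (z₀ : Z) (b₀ : B)
    (hz : ∀ y, z (y₀ y) = z₀) (hW : ∀ y, W (y₀ y) = W y)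
    (hinj : ∀ g, Function.Injective fun q : Y × B => W q.1 (z q.1 + g, q.2))
    {F : Matrix T T ℂ → ℝ} (hF : IsEffect F) {ω : Matrix Y Y ℂ} (hω : ω.PosSemidef) :
    |∑ p, (F (isoChannel (shifted z W b₀ p) ω) -
        F (isoChannel (shifted z W b₀ p) (isoChannel (fun y => (y₀ y, z y)) ω)))| ≤
      Fintype.card (Z × (Z → B)) * (1 / Fintype.card B * ω.trace.re) := by
  classical
  have hcB : (Fintype.card B : ℝ) ≠ 0 := by simp
  simp only [← hF.lin.map_sub]
  have hs : ∀ {ι : Type} [Fintype ι] (f : ι → Matrix T T ℂ), ∑ i, F (f i) = F (∑ i, f i) :=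
    fun f => (map_sum (IsLinearMap.mk' F hF.lin) f Finset.univ).symm
  rw [hs, sum_shifted_sub z W y₀ z₀ b₀ hz hW, ← hs]
  refine (Finset.abs_sum_le_sum_abs _ _).trans ?_
  -- This submatrix is ω tensored with the all-ones matrix on B: positive, with trace |B| tr ω.
  -- Divided by |B|², it leaves the factor 1/|B|.
  have hJ : (ω.submatrix (Prod.fst : Y × B → Y) Prod.fst).PosSemidef := hω.submatrix _
  have htr : (ω.submatrix (Prod.fst : Y × B → Y) Prod.fst).trace.re =
      Fintype.card B * ω.trace.re := by
    simp [Matrix.trace, Fintype.sum_prod_type, ← Finset.mul_sum]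
  have bound : ∀ {E' : Type} [Finite E'] [DecidableEq E'] (G : Y × B → T × E'),
      Function.Injective G →
      0 ≤ F (isoChannel G (ω.submatrix Prod.fst Prod.fst)) ∧
      F (isoChannel G (ω.submatrix Prod.fst Prod.fst)) ≤ Fintype.card B * ω.trace.re := by
    intro E' _ _ G hG
    have h := (isoChannel_isPos G).psd _ hJ
    refine ⟨hF.nonneg _ h, (hF.le_trace _ h).trans_eq ?_⟩
    rw [isoChannel_trace hG, htr]
  have key : ∀ g ∈ (Finset.univ : Finset Z), |F (((Fintype.card (Z → B) /
      (Fintype.card B : ℝ) ^ 2 : ℝ) : ℂ) •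
        (isoChannel (fun q : Y × B => W q.1 (z q.1 + g, q.2)) (ω.submatrix Prod.fst Prod.fst) -
          isoChannel (fun q : Y × B => ((W q.1 (z q.1 + g, q.2)).1,
            ((W q.1 (z q.1 + g, q.2)).2, z q.1))) (ω.submatrix Prod.fst Prod.fst)))| ≤
      Fintype.card (Z → B) * (1 / Fintype.card B * ω.trace.re) := by
    intro g _
    rw [Complex.coe_smul, hF.lin.map_smul, hF.lin.map_sub, smul_eq_mul, abs_mul,
      abs_of_nonneg (by positivity)]
    have h1 := bound _ (hinj g)
    have h2 := bound (fun q : Y × B => ((W q.1 (z q.1 + g, q.2)).1,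
            ((W q.1 (z q.1 + g, q.2)).2, z q.1))) fun q q' hq => hinj g <| by
      simp only [Prod.mk.injEq] at hq
      exact Prod.ext hq.1 hq.2.1
    have h3 := abs_sub_le_of_nonneg_of_le h1.1 h1.2 h2.1 h2.2
    calc _ ≤ (Fintype.card (Z → B) / (Fintype.card B : ℝ) ^ 2 : ℝ) *
          (Fintype.card B * ω.trace.re) := mul_le_mul_of_nonneg_left h3 (by positivity)
      _ = _ := by field_simp
  refine (Finset.sum_le_sum key).trans_eq ?_
  rw [Finset.sum_const, Finset.card_univ, nsmul_eq_mul, Fintype.card_prod]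
  push_cast
  ring

end Twirl

/-! ### Blocks -/

theorem block_unblock {μ N : ℕ} (y : Fin μ → Bits N) (i : Fin μ) : block (unblock y) i = y i := by
  funext j
  simp [block, unblock]

theorem unblock_block {μ N : ℕ} (x : Bits (μ * N)) : unblock (block x) = x := by
  funext p
  simp only [block, unblock, Prod.mk.eta, Equiv.apply_symm_apply]

theorem unblock_injective {μ N : ℕ} : Function.Injective (unblock (μ := μ) (N := N)) :=
  fun y y' h => funext fun i => by rw [← block_unblock y, h, block_unblock]

theorem block_injective {μ N : ℕ} : Function.Injective (block (μ := μ) (N := N)) :=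
  fun y y' h => by rw [← unblock_block y, h, unblock_block]

theorem append_inj {m τ : ℕ} {x x' : Bits m} {r r' : Bits τ}
    (h : Fin.append x r = Fin.append x' r') : x = x' ∧ r = r' := by
  constructor
  · funext i; simpa using congrFun h (Fin.castAdd τ i)
  · funext i; simpa using congrFun h (Fin.natAdd m i)

theorem ecbEnc_injective {m τ μ : ℕ} (π : Equiv.Perm (Bits (m + τ))) (r : Fin μ → Bits τ) :
    Function.Injective (ecbEnc π r) :=
  fun x x' h => by rw [← ecb_correct π r x, h, ecb_correct]

/-! ### Shifting the permutation on one class of coins -/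

section Shift

variable {m τ μ w : ℕ} {A B Z : Type} [DecidableEq A] [AddCommGroup B] [AddCommGroup Z]

/-- The shift `(z, p, b) ↦ (z + g, p, b + h z)` of the class `p`. -/
def classShift (p : A) (g : Z) (h : Z → B) : Equiv.Perm (Z × (A × B)) where
  toFun u := if u.2.1 = p then (u.1 + g, (u.2.1, u.2.2 + h u.1)) else u
  invFun u := if u.2.1 = p then (u.1 - g, (u.2.1, u.2.2 - h (u.1 - g))) else u
  left_inv u := by
    obtain ⟨z, a, b⟩ := u
    by_cases hu : a = p <;> simp [hu]
  right_inv u := by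
    obtain ⟨z, a, b⟩ := u
    by_cases hu : a = p <;> simp [hu]

/-- `classShift` on strings `x‖r`. -/
def coinShift (ζ : Bits m ≃ Z) (θ : Bits τ ≃ A × B) (p : A) (q : Z × (Z → B)) :
    Equiv.Perm (Bits (m + τ)) :=
  ((Fin.appendEquiv m τ).symm.trans (ζ.prodCongr θ)).permCongr.symm (classShift p q.1 q.2)

variable (ζ : Bits m ≃ Z) (θ : Bits τ ≃ A × B)

theorem coinShift_append (p : A) (q : Z × (Z → B)) (x : Bits m) (r : Bits τ) :
    coinShift ζ θ p q (Fin.append x r) = if (θ r).1 = p then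
      Fin.append (ζ.symm (ζ x + q.1)) (θ.symm (p, (θ r).2 + q.2 (ζ x))) else Fin.append x r := by
  have h : (Fin.appendEquiv m τ).symm (Fin.append x r) = (x, r) :=
    (Equiv.symm_apply_eq _).2 rfl
  have h' : ∀ y, (Fin.appendEquiv (α := Bool) m τ) y = Fin.append y.1 y.2 := fun _ => rfl
  by_cases hr : (θ r).1 = p
  · simp [coinShift, Equiv.permCongr, Equiv.equivCongr, h, h', classShift, hr]
  · simp [coinShift, Equiv.permCongr, Equiv.equivCongr, h, h', classShift, hr]

/-- The shift fixes every string whose coins lie outside the class `p`. -/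
theorem ecbEnc_mul_coinShift (π : Equiv.Perm (Bits (m + τ))) {p : A} (q : Z × (Z → B))
    {r : Fin μ → Bits τ} (hr : ∀ i, (θ (r i)).1 ≠ p) :
    ecbEnc (π * coinShift ζ θ p q) r = ecbEnc π r := by
  funext x
  simp only [ecbEnc, Equiv.Perm.mul_apply, coinShift_append, hr, if_false]

/-- Encryption of the register `x` into the qubits `cipher`, whose contents are discarded. -/
def encOut {a l : ℕ} (f : Bits a → Bits l) (cipher : Fin l ↪ Fin w) (y : Bits a × Bits w) :
    Bits w × Bits l :=
  (Function.extend cipher (f y.1) y.2, fun j => y.2 (cipher j))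

theorem encOut_injective {a l : ℕ} {f : Bits a → Bits l} (hf : Function.Injective f)
    (cipher : Fin l ↪ Fin w) : Function.Injective (encOut f cipher) := by
  rintro ⟨x, s⟩ ⟨x', s'⟩ h
  simp only [encOut, Prod.mk.injEq] at h
  have h1 : f x = f x' := by
    funext j
    simpa [cipher.injective.extend_apply] using congrFun h.1 (cipher j)
  refine Prod.ext (hf h1) (funext fun i => ?_)
  by_cases hi : ∃ j, cipher j = i
  · obtain ⟨j, rfl⟩ := hi
    exact congrFun h.2 j
  · have := congrFun h.1 i
    rwa [Function.extend_apply' _ _ _ hi, Function.extend_apply' _ _ _ hi] at this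

/-- Erase the `j`-th block of the plaintext register. -/
def eraseBlock (j : Fin μ) (y : Bits (μ * m) × Bits w) : (Bits (μ * m) × Bits w) × Bits m :=
  ((unblock (Function.update (block y.1) j fun _ => false), y.2), block y.1 j)

variable [Fintype Z] [Fintype B] [DecidableEq Z]

/-- `twirl_bound` with z the j-th plaintext block and B the second half of its coins. The coins of
the other blocks lie in other classes, so the shift acts on block j only, and the rest of the
encryption does not depend on that block. -/
theorem eraseBlock_bound (π : Equiv.Perm (Bits (m + τ))) (r : Fin μ → Bits τ) (j : Fin μ)
    (hr : ∀ i, i ≠ j → (θ (r i)).1 ≠ (θ (r j)).1) (cipher : Fin (μ * (m + τ)) ↪ Fin w)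
    {F : QState w → ℝ} (hF : IsEffect F)
    {ω : Matrix (Bits (μ * m) × Bits w) (Bits (μ * m) × Bits w) ℂ} (hω : ω.PosSemidef) :
    |∑ q, (F (isoChannel (encOut (ecbEnc (π * coinShift ζ θ (θ (r j)).1 q) r) cipher) ω) -
        F (isoChannel (encOut (ecbEnc (π * coinShift ζ θ (θ (r j)).1 q) r) cipher)
          (isoChannel (eraseBlock j) ω)))| ≤
      Fintype.card (Z × (Z → B)) * (1 / Fintype.card B * ω.trace.re) := by
  let z : Bits (μ * m) × Bits w → Z := fun y => ζ (block y.1 j)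
  let W : Bits (μ * m) × Bits w → Z × B → Bits w × Bits (μ * (m + τ)) := fun y u =>
    (Function.extend cipher (unblock fun i => π (if i = j then
      Fin.append (ζ.symm u.1) (θ.symm ((θ (r j)).1, u.2)) else Fin.append (block y.1 i) (r i))) y.2,
      fun k => y.2 (cipher k))
  let y₀ : Bits (μ * m) × Bits w → Bits (μ * m) × Bits w := fun y => (eraseBlock j y).1
  have hsh : ∀ q, encOut (ecbEnc (π * coinShift ζ θ (θ (r j)).1 q) r) cipher =
      shifted z W (θ (r j)).2 q := by
    intro q
    funext y
    simp only [encOut, shifted, W, z, ecbEnc]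
    congr 3
    funext i
    rw [Equiv.Perm.mul_apply, coinShift_append]
    by_cases hi : i = j
    · subst hi; simp
    · simp [hi, hr i hi]
  have her : isoChannel (eraseBlock j) ω = isoChannel (fun y => (y₀ y, z y)) ω := by
    apply isoChannel_congr
    · intro y; rfl
    · intro y y'
      exact (ζ.apply_eq_iff_eq (x := block y.1 j) (y := block y'.1 j)).symm
  simp only [hsh, her]
  refine twirl_bound z W y₀ (ζ fun _ => false) _ ?_ ?_ ?_ hF hω
  · intro y
    simp [z, y₀, eraseBlock, block_unblock]
  · intro y
    funext u
    simp only [W, y₀, eraseBlock, block_unblock]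
    congr 3
    funext i
    by_cases hi : i = j
    · simp [hi]
    · simp [hi]
  -- π is undone block by block: block j yields `b` and, for the fixed translation `g`, the
  -- plaintext block; the other blocks yield the rest of `x`. The overwritten wires are in the
  -- environment.
  · rintro g ⟨⟨x, s⟩, b⟩ ⟨⟨x', s'⟩, b'⟩ h
    simp only [W, z, Prod.mk.injEq] at h
    have h1 := unblock_injective (funext fun k => by
      simpa [cipher.injective.extend_apply] using congrFun h.1 (cipher k) :
        unblock (N := m + τ) _ = unblock _)
    have h2 := fun i => π.injective (congrFun h1 i)
    have hj := h2 j
    simp only [if_true] at hj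
    have hj' := append_inj hj
    have hb : b = b' := by simpa using hj'.2
    have hx : x = x' := by
      refine block_injective (funext fun i => ?_)
      by_cases hi : i = j
      · subst hi; simpa using hj'.1
      · have := h2 i
        simp only [hi, if_false] at this
        exact (append_inj this).1
    have hs : s = s' := by
      funext i
      by_cases hi : ∃ k, cipher k = i
      · obtain ⟨k, rfl⟩ := hi
        exact congrFun h.2 k
      · have := congrFun h.1 i
        rwa [Function.extend_apply' _ _ _ hi, Function.extend_apply' _ _ _ hi] at this
    rw [hb, hx, hs]

end Shift

/-! ### Erasing the blocks one after the other -/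

section Hybrid

variable {m μ w : ℕ}

/-- Erase the first `k` blocks of the plaintext register. -/
def eraseHead (k : ℕ) (y : Bits (μ * m) × Bits w) :
    (Bits (μ * m) × Bits w) × (Fin μ → Bits m) :=
  ((unblock fun i => if i.1 < k then fun _ => false else block y.1 i, y.2),
    fun i => if i.1 < k then block y.1 i else fun _ => false)

theorem eraseHead_injective (k : ℕ) :
    Function.Injective (eraseHead k : Bits (μ * m) × Bits w → _) := by
  rintro ⟨x, s⟩ ⟨x', s'⟩ h
  simp only [eraseHead, Prod.mk.injEq] at h
  refine Prod.ext (block_injective (funext fun i => ?_)) h.1.2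
  have h1 := congrFun (unblock_injective h.1.1) i
  have h2 := congrFun h.2 i
  by_cases hi : i.1 < k
  · simpa [hi] using h2
  · simpa [hi] using h1

/-- One hybrid step: after the first j blocks are erased, erasing block j adds exactly that block to
the environment. -/
theorem eraseHead_succ (j : Fin μ)
    (ω : Matrix (Bits (μ * m) × Bits w) (Bits (μ * m) × Bits w) ℂ) :
    isoChannel (eraseHead (j + 1)) ω = isoChannel (eraseBlock j) (isoChannel (eraseHead j) ω) := by
  rw [isoChannel_comp]
  refine isoChannel_congr ?_ ?_ ω
  · rintro ⟨x, s⟩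
    simp only [eraseHead, eraseBlock, block_unblock, Prod.mk.injEq, and_true]
    congr 1
    funext i
    by_cases hi : i = j
    · simp [hi]
    · have : i.1 < j.1 + 1 ↔ i.1 < j.1 := by
        have : i.1 ≠ j.1 := fun h => hi (Fin.ext h)
        omega
      simp only [Function.update_of_ne hi, block_unblock, this]
  · rintro ⟨x, s⟩ ⟨x', s'⟩
    simp only [eraseHead, eraseBlock, block_unblock, Prod.mk.injEq, lt_irrefl, if_false,
      funext_iff (f := fun i : Fin μ => if _ then _ else _)]
    constructor
    · intro h
      refine ⟨fun i => ?_, ?_⟩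
      · have := h i
        by_cases hi : i.1 < j.1
        · have h3 : i.1 < j.1 + 1 := by omega
          simpa only [if_pos hi, if_pos h3] using this
        · simp only [if_neg hi]
      · simpa using h j
    · rintro ⟨h1, h2⟩ i
      by_cases hi : i.1 < j.1 + 1
      · simp only [if_pos hi]
        by_cases hi' : i.1 < j.1
        · simpa only [if_pos hi'] using h1 i
        · have : i = j := Fin.ext (by omega)
          rw [this]; exact h2
      · simp only [if_neg hi]

theorem isoChannel_id {Y E : Type} [Fintype Y] [DecidableEq Y] [DecidableEq E] {F : Y → Y × E}
    (h1 : ∀ y, (F y).1 = y) (h2 : ∀ y y', (F y).2 = (F y').2) (ω : Matrix Y Y ℂ) :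
    isoChannel F ω = ω := by
  ext t t'
  simp only [isoChannel, Matrix.of_apply, h1]
  rw [Finset.sum_eq_single t, Finset.sum_eq_single t']
  · simp [h2 t t']
  · intro b _ hb; simp [hb]
  · simp
  · intro b _ hb; simp [hb]
  · simp

theorem eraseHead_zero (ω : Matrix (Bits (μ * m) × Bits w) (Bits (μ * m) × Bits w) ℂ) :
    isoChannel (eraseHead 0) ω = ω :=
  isoChannel_id (fun y => by simp [eraseHead, unblock_block]) (fun y y' => by simp [eraseHead]) ω

/-- Keeping exactly the X-component in the environment is tracing it out, and a fixed value `c`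
takes its place. -/
theorem isoChannel_erase {X S E : Type} [Fintype X] [DecidableEq X] [Fintype S] [DecidableEq S]
    [DecidableEq E] {F : X × S → (X × S) × E} (c : X) (h1 : ∀ y, (F y).1 = (c, y.2))
    (h2 : ∀ y y', (F y).2 = (F y').2 ↔ y.1 = y'.1) (ω : Matrix (X × S) (X × S) ℂ) (t t' : X × S) :
    isoChannel F ω t t' = if t.1 = c ∧ t'.1 = c then ∑ x, ω (x, t.2) (x, t'.2) else 0 := by
  simp only [isoChannel, Matrix.of_apply, h1, h2, Fintype.sum_prod_type]
  by_cases h : t.1 = c ∧ t'.1 = c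
  · rw [if_pos h]
    refine Finset.sum_congr rfl fun x _ => ?_
    rw [Finset.sum_eq_single t.2, Finset.sum_eq_single x, Finset.sum_eq_single t'.2]
    · rw [if_pos ⟨Prod.ext h.1.symm rfl, Prod.ext h.2.symm rfl, rfl⟩]
    · intro s _ hs; exact if_neg fun h' => hs (by rw [← h'.2.1])
    · simp
    · intro x' _ hx'
      exact Finset.sum_eq_zero fun s _ => if_neg fun h' => hx' h'.2.2.symm
    · simp
    · intro s _ hs
      exact Finset.sum_eq_zero fun x' _ => Finset.sum_eq_zero fun s' _ =>
        if_neg fun h' => hs (by rw [← h'.1])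
    · simp
  · rw [if_neg h]
    refine Finset.sum_eq_zero fun x _ => Finset.sum_eq_zero fun s _ => Finset.sum_eq_zero fun x' _ =>
      Finset.sum_eq_zero fun s' _ => if_neg fun h' => h ?_
    rw [← h'.1, ← h'.2.1]
    exact ⟨rfl, rfl⟩

/-- With all blocks erased, only the partial trace over the plaintext register is left. -/
theorem eraseHead_all {ω ω' : Matrix (Bits (μ * m) × Bits w) (Bits (μ * m) × Bits w) ℂ}
    (h : ∀ s s', ∑ x, ω (x, s) (x, s') = ∑ x, ω' (x, s) (x, s')) :
    isoChannel (eraseHead μ) ω = isoChannel (eraseHead μ) ω' := by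
  have h1 : ∀ y : Bits (μ * m) × Bits w, (eraseHead μ y).1 = (unblock fun _ _ => false, y.2) := by
    simp [eraseHead]
  have h2 : ∀ y y' : Bits (μ * m) × Bits w,
      (eraseHead μ y).2 = (eraseHead μ y').2 ↔ y.1 = y'.1 := fun y y' => by
    simp only [eraseHead, Fin.is_lt, if_true]
    exact block_injective.eq_iff (a := y.1) (b := y'.1)
  ext t t'
  rw [isoChannel_erase _ h1 h2, isoChannel_erase _ h1 h2, h]

end Hybrid

/-! ### Counting coins -/

/-- Translating the class of `r i` by an element of A permutes the coins and leaves `c r` fixed, so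
each class is hit equally often. It serves with constant `c` for learning queries, and with `c` the
class of another block for collisions inside the challenge. -/
theorem card_coin_class {μ τ : ℕ} {A B : Type} [AddCommGroup A] [Fintype A] [DecidableEq A]
    (θ : Bits τ ≃ A × B) (i : Fin μ) (c : (Fin μ → Bits τ) → A)
    (hc : ∀ r v, c (Function.update r i v) = c r) :
    ∑ r : Fin μ → Bits τ, (if (θ (r i)).1 = c r then (1 : ℝ) else 0) =
      Fintype.card (Fin μ → Bits τ) / Fintype.card A := by
  let σ : A → Equiv.Perm (Bits τ) := fun a =>
    θ.permCongr.symm ((Equiv.addRight a).prodCongr (Equiv.refl B))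
  have hσ : ∀ a x, (θ (σ a x)).1 = (θ x).1 + a := fun a x => by
    simp [σ, Equiv.permCongr, Equiv.equivCongr]
  have shift : ∀ a, ∑ r : Fin μ → Bits τ, (if (θ (r i)).1 = c r then (1 : ℝ) else 0) =
      ∑ r : Fin μ → Bits τ, if (θ (r i)).1 + a = c r then (1 : ℝ) else 0 := by
    intro a
    refine (Fintype.sum_equiv (Equiv.piCongrRight
      (Function.update (fun _ => Equiv.refl (Bits τ)) i (σ a))) _ _ fun r => ?_).symm
    have h : (Equiv.piCongrRight (Function.update (fun _ => Equiv.refl (Bits τ)) i (σ a))) r =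
        Function.update r i (σ a (r i)) := by
      funext k
      by_cases hk : k = i
      · subst hk; simp
      · simp [hk]
    rw [h, hc, Function.update_self, hσ]
  have hA : (Fintype.card A : ℝ) ≠ 0 := by simp
  rw [eq_div_iff hA, mul_comm]
  calc _ = ∑ a : A, ∑ r : Fin μ → Bits τ, (if (θ (r i)).1 = c r then (1 : ℝ) else 0) := by simp
    _ = ∑ a : A, ∑ r : Fin μ → Bits τ, if (θ (r i)).1 + a = c r then (1 : ℝ) else 0 :=
        Finset.sum_congr rfl fun a _ => shift a
    _ = ∑ r : Fin μ → Bits τ, ∑ a : A, if (θ (r i)).1 + a = c r then (1 : ℝ) else 0 :=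
        Finset.sum_comm
    _ = _ := by simp [add_comm (_ : A), ← eq_sub_iff_add_eq]

/-! ### Games with weighted coins -/

theorem IsEffect.comp {Y T : Type} [Fintype Y] [Fintype T] {F : Matrix T T ℂ → ℝ}
    (hF : IsEffect F) {Φ : Matrix Y Y ℂ → Matrix T T ℂ} (hΦ : IsPos Φ)
    (htr : ∀ X, X.PosSemidef → (Φ X).trace.re ≤ X.trace.re) : IsEffect fun X => F (Φ X) where
  lin := ⟨fun x y => by rw [hΦ.lin.map_add, hF.lin.map_add], fun c x => by
    rw [← Complex.coe_smul, hΦ.lin.map_smul, Complex.coe_smul, hF.lin.map_smul]⟩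
  nonneg X hX := hF.nonneg _ (hΦ.psd X hX)
  le_trace X hX := (hF.le_trace _ (hΦ.psd X hX)).trans (htr X hX)

section Game

variable {w a l : ℕ} {R : Type} [Fintype R]

/-- The probability of reading `b` on qubit `i` after the two learning phases with weighted coins,
separated by the operation `Ψ`. -/
def gameProb (c : R → ℝ) (f : R → Bits a → Bits l) (C₁ C₂ : List (Step w a l))
    (Ψ : QState w → QState w) (i : Fin w) (b : Bool) : ℝ :=
  measureProb i b (runStepsW c f C₂ (Ψ (runStepsW c f C₁ (zeroState w))))

variable {c d : R → ℝ} {f : R → Bits a → Bits l} {C₁ C₂ : List (Step w a l)}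
  {Ψ : QState w → QState w}

theorem gameProb_mem (h0 : ∀ r, 0 ≤ d r) (hd : ∑ r, d r = 1) (hf : ∀ r, Function.Injective (f r))
    (hΨ : IsChannel Ψ) (i : Fin w) (b : Bool) :
    0 ≤ gameProb d f C₁ C₂ Ψ i b ∧ gameProb d f C₁ C₂ Ψ i b ≤ 1 := by
  have h := (runStepsW_isChannel h0 hd hf C₂).comp (hΨ.comp (runStepsW_isChannel h0 hd hf C₁))
  have hp := h.psd _ (zeroState_posSemidef (w := w))
  refine ⟨(measureProb_isEffect i b).nonneg _ hp, ((measureProb_isEffect i b).le_trace _ hp).trans ?_⟩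
  rw [h.trace_eq, zeroState_trace, Complex.one_re]

theorem gameProb_add (h0 : ∀ r, 0 ≤ d r) (hd : ∑ r, d r = 1) (hf : ∀ r, Function.Injective (f r))
    (hΨ : IsChannel Ψ) (i : Fin w) :
    gameProb d f C₁ C₂ Ψ i true + gameProb d f C₁ C₂ Ψ i false = 1 := by
  have h := (runStepsW_isChannel h0 hd hf C₂).comp (hΨ.comp (runStepsW_isChannel h0 hd hf C₁))
  rw [gameProb, gameProb, measureProb_add, h.trace_eq, zeroState_trace, Complex.one_re]

/-- Both learning phases use lowered weights, so the loss per step adds up over their total length.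
That the gap is also nonnegative is what later prevents a doubling of the error. -/
theorem gameProb_gap (hc : ∀ r, 0 ≤ c r) (hcd : ∀ r, c r ≤ d r) (hd : ∑ r, d r = 1)
    (hf : ∀ r, Function.Injective (f r)) (hΨ : IsChannel Ψ) {δ : ℝ} (hδ : 0 ≤ δ)
    (hdc : ∑ r, (d r - c r) ≤ δ) (i : Fin w) (b : Bool) :
    0 ≤ gameProb d f C₁ C₂ Ψ i b - gameProb c f C₁ C₂ Ψ i b ∧
      gameProb d f C₁ C₂ Ψ i b - gameProb c f C₁ C₂ Ψ i b ≤ (C₁.length + C₂.length) * δ := by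
  have h0 : ∀ r, 0 ≤ d r := fun r => (hc r).trans (hcd r)
  have hm := measureProb_isEffect i b
  have hD := runStepsW_isChannel h0 hd hf C₂
  have h1 := runStepsW_sub hc hcd hd hf hδ hdc C₁ (zeroState_posSemidef (w := w))
  have hpc := (runStepsW_isPos hc hf C₁).psd _ (zeroState_posSemidef (w := w))
  have hΨc := hΨ.psd _ hpc
  have h2 := runStepsW_sub hc hcd hd hf hδ hdc C₂ hΨc
  have e : gameProb d f C₁ C₂ Ψ i b - gameProb c f C₁ C₂ Ψ i b =
      measureProb i b (runStepsW d f C₂ (Ψ (runStepsW d f C₁ (zeroState w) -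
        runStepsW c f C₁ (zeroState w)))) +
      measureProb i b (runStepsW d f C₂ (Ψ (runStepsW c f C₁ (zeroState w))) -
        runStepsW c f C₂ (Ψ (runStepsW c f C₁ (zeroState w)))) := by
    rw [hΨ.map_sub, hD.map_sub, hm.lin.map_sub, hm.lin.map_sub, gameProb, gameProb]
    ring
  have p1 := hD.psd _ (hΨ.psd _ h1.1)
  rw [e]
  refine ⟨add_nonneg (hm.nonneg _ p1) (hm.nonneg _ h2.1), ?_⟩
  have b1 := hm.le_trace _ p1
  rw [hD.trace_eq, hΨ.trace_eq] at b1
  have b2 := hm.le_trace _ h2.1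
  have t1 := h1.2
  rw [zeroState_trace, Complex.one_re, mul_one] at t1
  have t2 := runStepsW_trace_le hc hcd hd hf C₁ (zeroState_posSemidef (w := w))
  rw [zeroState_trace, Complex.one_re] at t2
  have t3 := h2.2
  rw [hΨ.trace_eq] at t3
  have t4 : C₂.length * δ * (runStepsW c f C₁ (zeroState w)).trace.re ≤ C₂.length * δ * 1 :=
    mul_le_mul_of_nonneg_left t2 (by positivity)
  linarith

end Game

/-! ### Random permutations -/

section RandomPerm

variable {m τ μ w : ℕ} {A B Z : Type} [AddCommGroup A] [Fintype A] [DecidableEq A]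
  [AddCommGroup B] [Fintype B] [AddCommGroup Z] [Fintype Z] [DecidableEq Z]
  (ζ : Bits m ≃ Z) (θ : Bits τ ≃ A × B)
  (C₁ C₂ : List (Step w (μ * m) (μ * (m + τ))))
  {pre : QState w → Matrix (Bits (μ * m) × Bits w) (Bits (μ * m) × Bits w) ℂ}
  (hpre : IsChannel pre)
  (cipher : Fin (μ * (m + τ)) ↪ Fin w) (i : Fin w) (b : Bool)

/-- The challenge in which the first `k` blocks are erased before the encryption. -/
def hybridChallenge (pre : QState w → Matrix (Bits (μ * m) × Bits w) (Bits (μ * m) × Bits w) ℂ)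
    (cipher : Fin (μ * (m + τ)) ↪ Fin w) (k : ℕ) (π : Equiv.Perm (Bits (m + τ)))
    (r : Fin μ → Bits τ) (ρ : QState w) : QState w :=
  isoChannel (encOut (ecbEnc π r) cipher) (isoChannel (eraseHead k) (pre ρ))

include hpre in
theorem hybridChallenge_isChannel (k : ℕ) (π : Equiv.Perm (Bits (m + τ))) (r : Fin μ → Bits τ) :
    IsChannel (hybridChallenge pre cipher k π r) :=
  (isoChannel_isChannel (encOut_injective (ecbEnc_injective π r) cipher)).comp
    ((isoChannel_isChannel (eraseHead_injective k)).comp hpre)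

/-- The uniform weights. -/
abbrev unifW (R : Type) [Fintype R] : R → ℝ := fun _ => (Fintype.card R : ℝ)⁻¹

theorem sum_unifW (R : Type) [Fintype R] [Nonempty R] : ∑ r, unifW R r = 1 := by
  simp [unifW]

/-- The uniform weights restricted to coins outside the class `p`. -/
def avoidW (θ : Bits τ ≃ A × B) (p : A) (r : Fin μ → Bits τ) : ℝ :=
  if ∀ k, (θ (r k)).1 ≠ p then unifW _ r else 0

/-- A union bound over the μ blocks, each of which hits the class `p` with probability 1/|A|. -/
theorem sum_sub_avoidW (p : A) :
    ∑ r, (unifW (Fin μ → Bits τ) r - avoidW θ p r) ≤ μ / Fintype.card A := by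
  have h : ∀ r : Fin μ → Bits τ, unifW (Fin μ → Bits τ) r - avoidW θ p r ≤
      ∑ k : Fin μ, unifW (Fin μ → Bits τ) r * (if (θ (r k)).1 = p then (1 : ℝ) else 0) := by
    intro r
    rw [avoidW]
    have hn : ∀ k ∈ (Finset.univ : Finset (Fin μ)), 0 ≤ unifW (Fin μ → Bits τ) r *
        (if (θ (r k)).1 = p then (1 : ℝ) else 0) := fun k _ => by
      split_ifs <;> simp [unifW]
    split_ifs with hr
    · rw [sub_self]
      exact Finset.sum_nonneg hn
    · push Not at hr
      obtain ⟨k, hk⟩ := hr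
      refine le_trans ?_ (Finset.single_le_sum hn (Finset.mem_univ k))
      simp [hk]
  refine (Finset.sum_le_sum fun r _ => h r).trans_eq ?_
  rw [Finset.sum_comm]
  simp only [unifW, ← Finset.mul_sum, card_coin_class θ _ (fun _ => p) (fun _ _ => rfl)]
  have : (Fintype.card (Fin μ → Bits τ) : ℝ) ≠ 0 := by
    exact_mod_cast Fintype.card_ne_zero
  rw [Finset.sum_const, Finset.card_univ, Fintype.card_fin, nsmul_eq_mul]
  field_simp

-- Three moves: the learning coins are restricted to those avoiding the class of `r j`, π is
-- multiplied by a random shift of that class, and `eraseBlock_bound` is applied for each fixed π.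
-- The first move costs the term with |A|, the last the term 1/|B|.
include ζ hpre in
theorem hybrid_good_bound (r : Fin μ → Bits τ) (j : Fin μ)
    (hr : ∀ k, k ≠ j → (θ (r k)).1 ≠ (θ (r j)).1) :
    |∑ π, (gameProb (unifW _) (ecbEnc π) C₁ C₂ (hybridChallenge pre cipher j π r) i b -
        gameProb (unifW _) (ecbEnc π) C₁ C₂ (hybridChallenge pre cipher (j + 1) π r) i b)| ≤
      Fintype.card (Equiv.Perm (Bits (m + τ))) *
        (1 / Fintype.card B + (C₁.length + C₂.length) * (μ / Fintype.card A)) := by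
  set p := (θ (r j)).1 with hp
  have h0 : ∀ r, 0 ≤ avoidW (μ := μ) θ p r := fun r => by
    rw [avoidW]; split_ifs <;> simp [unifW]
  have hcd : ∀ r, avoidW (μ := μ) θ p r ≤ unifW (Fin μ → Bits τ) r := fun r => by
    rw [avoidW]; split_ifs <;> simp [unifW]
  have hd := sum_unifW (Fin μ → Bits τ)
  have hδ : (0 : ℝ) ≤ μ / Fintype.card A := by positivity
  have hgap := fun k π => gameProb_gap (C₁ := C₁) (C₂ := C₂) h0 hcd hd (ecbEnc_injective π)
    (hybridChallenge_isChannel hpre cipher k π r) hδ (sum_sub_avoidW θ p) i b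
  set D := fun k π => gameProb (unifW _) (ecbEnc π) C₁ C₂ (hybridChallenge pre cipher k π r) i b
  set G := fun k π => gameProb (avoidW θ p) (ecbEnc π) C₁ C₂
    (hybridChallenge pre cipher k π r) i b
  set N := Fintype.card (Z × (Z → B)) with hN
  have hN0 : (0 : ℝ) < N := by
    rw [hN]; exact_mod_cast Fintype.card_pos
  -- Right multiplication by a fixed permutation permutes the summation range, so averaging over all
  -- shifts is free.
  have hshift : ∀ q, ∑ π, (G j π - G (j + 1) π) = ∑ π, (G j (π * coinShift ζ θ p q) -
      G (j + 1) (π * coinShift ζ θ p q)) := fun q =>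
    (Fintype.sum_equiv (Equiv.mulRight (coinShift ζ θ p q)) _ _ fun π => rfl).symm
  have hπ : ∀ π, |∑ q, (G j (π * coinShift ζ θ p q) - G (j + 1) (π * coinShift ζ θ p q))| ≤
      N * (1 / Fintype.card B) := by
    intro π
    -- With restricted coins the learning phases do not depend on the shift `q`. The first phase can
    -- thus be absorbed into a fixed state ω, and the second, with the measurement, into a fixed
    -- effect F.
    have hcongr : ∀ q, ∀ C : List (Step w (μ * m) (μ * (m + τ))),
        runStepsW (avoidW θ p) (ecbEnc (π * coinShift ζ θ p q)) C =
          runStepsW (avoidW θ p) (ecbEnc π) C := fun q C => runStepsW_congr (fun s hs =>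
      ecbEnc_mul_coinShift ζ θ π q fun k hk => hs (if_neg fun h => h k hk)) C
    have hF : IsEffect fun X => measureProb i b (runStepsW (avoidW θ p) (ecbEnc π) C₂ X) :=
      (measureProb_isEffect i b).comp (runStepsW_isPos h0 (ecbEnc_injective π) C₂)
        fun X hX => runStepsW_trace_le h0 hcd hd (ecbEnc_injective π) C₂ hX
    have hω := (isoChannel_isPos (eraseHead (m := m) (w := w) (j : ℕ))).psd _ (hpre.psd _
      ((runStepsW_isPos h0 (ecbEnc_injective π) C₁).psd _ (zeroState_posSemidef (w := w))))
    have key := eraseBlock_bound ζ θ π r j hr cipher hF hω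
    simp only [G, gameProb, hybridChallenge, hcongr, eraseHead_succ]
    refine key.trans (mul_le_mul_of_nonneg_left ?_ hN0.le)
    rw [isoChannel_trace (eraseHead_injective _), hpre.trace_eq]
    have t := runStepsW_trace_le h0 hcd hd (ecbEnc_injective π) C₁ (zeroState_posSemidef (w := w))
    rw [zeroState_trace, Complex.one_re] at t
    exact (mul_le_mul_of_nonneg_left t (by positivity)).trans_eq (mul_one _)
  have hG : |∑ π, (G j π - G (j + 1) π)| ≤
      Fintype.card (Equiv.Perm (Bits (m + τ))) * (1 / Fintype.card B) := by
    have e : (N : ℝ) * ∑ π, (G j π - G (j + 1) π) = ∑ π, ∑ q,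
        (G j (π * coinShift ζ θ p q) - G (j + 1) (π * coinShift ζ θ p q)) := by
      rw [Finset.sum_comm, ← Finset.sum_congr rfl fun q _ => hshift q]
      rw [Finset.sum_const, Finset.card_univ, nsmul_eq_mul, hN]
    have h1 : |(N : ℝ) * ∑ π, (G j π - G (j + 1) π)| ≤
        Fintype.card (Equiv.Perm (Bits (m + τ))) * (N * (1 / Fintype.card B)) := by
      rw [e]
      refine (Finset.abs_sum_le_sum_abs _ _).trans
        ((Finset.sum_le_sum fun π _ => hπ π).trans_eq ?_)
      simp
    rw [abs_mul, abs_of_pos hN0, mul_left_comm] at h1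
    exact le_of_mul_le_mul_left h1 hN0
  -- The gaps for j and j + 1 lie in one and the same interval starting at 0, so the bound is paid
  -- once and not twice.
  have hDG : |∑ π, ((D j π - D (j + 1) π) - (G j π - G (j + 1) π))| ≤
      Fintype.card (Equiv.Perm (Bits (m + τ))) *
        ((C₁.length + C₂.length) * (μ / Fintype.card A)) := by
    refine (Finset.abs_sum_le_sum_abs _ _).trans
      ((Finset.sum_le_sum (g := fun _ => (C₁.length + C₂.length) * (μ / Fintype.card A : ℝ))
        fun π _ => ?_).trans_eq ?_)
    · have h1 := hgap j π
      have h2 := hgap (j + 1) π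
      rw [abs_le]
      constructor <;> linarith [h1.1, h1.2, h2.1, h2.2]
    · simp
  rw [Finset.sum_sub_distrib] at hDG
  have := abs_sub_abs_le_abs_sub (∑ π, (D j π - D (j + 1) π)) (∑ π, (G j π - G (j + 1) π))
  refine le_trans ?_ (mul_add _ _ _).ge
  change |∑ π, (D j π - D (j + 1) π)| ≤ _
  linarith

include ζ θ hpre in
/-- Erasing the challenge plaintext has little effect for a random permutation. -/
theorem hybrid_bound :
    |∑ r : Fin μ → Bits τ, ∑ π,
      (gameProb (unifW _) (ecbEnc π) C₁ C₂ (hybridChallenge pre cipher 0 π r) i b -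
        gameProb (unifW _) (ecbEnc π) C₁ C₂ (hybridChallenge pre cipher μ π r) i b)| ≤
      Fintype.card (Fin μ → Bits τ) * (Fintype.card (Equiv.Perm (Bits (m + τ))) * (μ *
        (1 / Fintype.card B + (C₁.length + C₂.length + 1) * (μ / Fintype.card A)))) := by
  set P : ℝ := (Fintype.card (Equiv.Perm (Bits (m + τ))) : ℝ) with hP
  have hP0 : 0 ≤ P := by positivity
  set K : ℝ := (Fintype.card (Fin μ → Bits τ) : ℝ) with hK
  set D := fun k r π => gameProb (unifW _) (ecbEnc π) C₁ C₂ (hybridChallenge pre cipher k π r) i b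
  set ε : ℝ := 1 / Fintype.card B + (C₁.length + C₂.length) * (μ / Fintype.card A) with hε
  have hε0 : 0 ≤ ε := by positivity
  have hstep : ∀ j : Fin μ, |∑ r, ∑ π, (D j r π - D (j + 1) r π)| ≤
      K * (P * (ε + μ / Fintype.card A)) := by
    intro j
    -- If another block shares the class of block j, `hybrid_good_bound` does not apply. Each
    -- summand is then at most 1 in absolute value, and an indicator pays for the resulting total
    -- `P`. This is the source of the `+ 1` next to the lengths in the final bound.
    have hr : ∀ r : Fin μ → Bits τ, |∑ π, (D j r π - D (j + 1) r π)| ≤ P * ε +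
        ∑ k : Fin μ, P * (if k ≠ j ∧ (θ (r k)).1 = (θ (r j)).1 then 1 else 0) := by
      intro r
      have hn : ∀ k ∈ (Finset.univ : Finset (Fin μ)),
          0 ≤ P * (if k ≠ j ∧ (θ (r k)).1 = (θ (r j)).1 then (1 : ℝ) else 0) := fun k _ => by
        split_ifs <;> simp [hP0]
      by_cases hg : ∀ k, k ≠ j → (θ (r k)).1 ≠ (θ (r j)).1
      · have := hybrid_good_bound ζ θ C₁ C₂ hpre cipher i b r j hg
        exact this.trans (le_add_of_nonneg_right (Finset.sum_nonneg hn))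
      · push Not at hg
        obtain ⟨k, hk⟩ := hg
        have h1 : |∑ π, (D j r π - D (j + 1) r π)| ≤ P := by
          refine (Finset.abs_sum_le_sum_abs _ _).trans
            ((Finset.sum_le_sum (g := fun _ => 1) fun π _ => ?_).trans_eq (by simp [hP]))
          have hm := fun n => gameProb_mem (C₁ := C₁) (C₂ := C₂)
            (fun _ => by simp [unifW]) (sum_unifW (Fin μ → Bits τ))
            (ecbEnc_injective π) (hybridChallenge_isChannel hpre cipher n π r) i b
          have h1 := hm j
          have h2 := hm (j + 1)
          rw [abs_le]
          constructor <;> linarith [h1.1, h1.2, h2.1, h2.2]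
        have h2 := Finset.single_le_sum hn (Finset.mem_univ k)
        rw [if_pos hk, mul_one] at h2
        have := mul_nonneg hP0 hε0
        linarith
    refine (Finset.abs_sum_le_sum_abs _ _).trans ((Finset.sum_le_sum fun r _ => hr r).trans ?_)
    rw [Finset.sum_add_distrib, Finset.sum_comm]
    have hk : ∀ k ∈ (Finset.univ : Finset (Fin μ)), ∑ r : Fin μ → Bits τ,
        P * (if k ≠ j ∧ (θ (r k)).1 = (θ (r j)).1 then (1 : ℝ) else 0) ≤
        K * P / Fintype.card A := by
      intro k _
      rw [← Finset.mul_sum]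
      by_cases hkj : k = j
      · simp only [hkj, ne_eq, not_true, false_and, if_false, Finset.sum_const_zero, mul_zero]
        positivity
      · simp only [ne_eq, hkj, not_false_eq_true, true_and]
        -- For k ≠ j, resampling `r k` does not affect the class of `r j`, which plays the role of
        -- `c`.
        rw [card_coin_class θ k (fun r => (θ (r j)).1) fun r v => by
          rw [Function.update_of_ne (Ne.symm hkj)]]
        exact (by ring : P * (K / Fintype.card A) = K * P / Fintype.card A).le
    refine (add_le_add_right (Finset.sum_le_sum hk) _).trans_eq ?_
    simp only [Finset.sum_const, Finset.card_univ, nsmul_eq_mul, ← hK, Fintype.card_fin]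
    ring
  -- Consecutive hybrids telescope from no erased block to all μ of them.
  have tel : ∀ r π, D 0 r π - D μ r π = ∑ j : Fin μ, (D j r π - D (j + 1) r π) := by
    intro r π
    rw [Fin.sum_univ_eq_sum_range (fun j => D j r π - D (j + 1) r π) μ,
      Finset.sum_range_sub' fun j => D j r π]
  have e : ∑ r, ∑ π, (D 0 r π - D μ r π) =
      ∑ j : Fin μ, ∑ r, ∑ π, (D j r π - D (j + 1) r π) := by
    simp only [tel]
    rw [Finset.sum_comm]
    simp_rw [Finset.sum_comm (s := (Finset.univ : Finset (Equiv.Perm (Bits (m + τ)))))]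
    rw [Finset.sum_comm]
  change |∑ r, ∑ π, (D 0 r π - D μ r π)| ≤ _
  rw [e]
  refine (Finset.abs_sum_le_sum_abs _ _).trans
    ((Finset.sum_le_sum fun j _ => hstep j).trans_eq ?_)
  rw [Finset.sum_const, Finset.card_univ, Fintype.card_fin, nsmul_eq_mul, hε]
  ring

include ζ θ in
/-- With a random permutation, the challenge bit cannot be guessed if the traced-out challenge
states agree. -/
theorem guess_random_perm_le
    {pre : Bool → QState w → Matrix (Bits (μ * m) × Bits w) (Bits (μ * m) × Bits w) ℂ}
    (hpre : ∀ b, IsChannel (pre b))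
    (htr : ∀ ρ s s', ∑ x, pre true ρ (x, s) (x, s') = ∑ x, pre false ρ (x, s) (x, s')) :
    ∑ π : Equiv.Perm (Bits (m + τ)), (∑ b, measureProb i b (runSteps (ecbEnc π) C₂
      (coinAverage fun r => isoChannel (encOut (ecbEnc π r) cipher)
        (pre b (runSteps (ecbEnc π) C₁ (zeroState w)))))) / 2 ≤
      Fintype.card (Equiv.Perm (Bits (m + τ))) * (1 / 2 + μ *
        (1 / Fintype.card B + (C₁.length + C₂.length + 1) * (μ / Fintype.card A))) := by
  set P : ℝ := (Fintype.card (Equiv.Perm (Bits (m + τ))) : ℝ) with hP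
  set K : ℝ := (Fintype.card (Fin μ → Bits τ) : ℝ) with hK
  have hK0 : 0 < K := by rw [hK]; exact_mod_cast Fintype.card_pos
  set ε : ℝ := μ * (1 / Fintype.card B + (C₁.length + C₂.length + 1) * (μ / Fintype.card A))
    with hε
  set D : Bool → ℕ → (Fin μ → Bits τ) → Equiv.Perm (Bits (m + τ)) → ℝ := fun b k r π =>
    gameProb (unifW _) (ecbEnc π) C₁ C₂ (hybridChallenge (pre b) cipher k π r) i b with hD
  -- By linearity the average over the challenge coins moves outside; erasing zero blocks changes
  -- nothing.
  have h0 : ∀ (b : Bool) (π : Equiv.Perm (Bits (m + τ))), measureProb i b (runSteps (ecbEnc π) C₂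
      (coinAverage fun r => isoChannel (encOut (ecbEnc π r) cipher)
        (pre b (runSteps (ecbEnc π) C₁ (zeroState w))))) = K⁻¹ * ∑ r, D b 0 r π := by
    intro b π
    have hlin := (runStepsW_isPos (c := unifW _) (fun _ => by simp [unifW])
      (ecbEnc_injective π) C₂).lin
    have hm := (measureProb_isEffect i b).lin
    have hs : ∀ {ι : Type} [Fintype ι] (g : ι → QState w), runStepsW (unifW _) (ecbEnc π) C₂
        (∑ j, g j) = ∑ j, runStepsW (unifW _) (ecbEnc π) C₂ (g j) :=
      fun g => map_sum (IsLinearMap.mk' _ hlin) g Finset.univ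
    have hs' : ∀ {ι : Type} [Fintype ι] (g : ι → QState w), measureProb i b
        (∑ j, g j) = ∑ j, measureProb i b (g j) :=
      fun g => map_sum (IsLinearMap.mk' _ hm) g Finset.univ
    have hc : ((Fintype.card (Fin μ → Bits τ) : ℂ))⁻¹ = ((K⁻¹ : ℝ) : ℂ) := by
      rw [hK]; push_cast; rfl
    rw [runSteps_eq_runStepsW, runSteps_eq_runStepsW, coinAverage, hlin.map_smul, hc,
      Complex.coe_smul, hm.map_smul, hs, hs', smul_eq_mul]
    simp only [hD, gameProb, hybridChallenge, eraseHead_zero]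
  -- With everything erased both challenge bits lead to the same state, and its two outcome
  -- probabilities add up to 1.
  have hμ : ∀ r π, D true μ r π + D false μ r π = 1 := by
    intro r π
    have e : hybridChallenge (pre true) cipher μ π r = hybridChallenge (pre false) cipher μ π r := by
      funext ρ
      rw [hybridChallenge, hybridChallenge, eraseHead_all (htr ρ)]
    simp only [hD, e]
    exact gameProb_add (fun _ => by simp [unifW]) (sum_unifW _) (ecbEnc_injective π)
      (hybridChallenge_isChannel (hpre false) cipher μ π r) i
  have hb : ∀ b, ∑ r, ∑ π, D b 0 r π ≤ ∑ r, ∑ π, D b μ r π + K * (P * ε) := by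
    intro b
    have := (abs_le.1 (hybrid_bound ζ θ C₁ C₂ (hpre b) cipher i b)).2
    simp only [Finset.sum_sub_distrib] at this
    simp only [hD]
    linarith
  have hsum : ∑ r, ∑ π, D true μ r π + ∑ r, ∑ π, D false μ r π = K * P := by
    simp only [← Finset.sum_add_distrib, hμ]
    simp [hK, hP]
  simp only [h0, Fintype.sum_bool, ← Finset.sum_div, ← Finset.mul_sum,
    ← Finset.sum_add_distrib]
  rw [Finset.sum_comm]
  simp only [Finset.sum_add_distrib]
  have h1 := hb true
  have h2 := hb false
  rw [div_le_iff₀ two_pos, inv_mul_le_iff₀ hK0]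
  linarith

end RandomPerm

/-! ### The challenge states of the two games -/

/-- Tracing out a register amounts to moving it to the environment. -/
theorem sum_isoChannel {Y X S E : Type} [Fintype Y] [Fintype X] [DecidableEq X] [Fintype S]
    [DecidableEq S] [DecidableEq E] (F : Y → (X × S) × E) (ρ : Matrix Y Y ℂ) (s s' : S) :
    ∑ x, isoChannel F ρ (x, s) (x, s') =
      isoChannel (fun y => ((F y).1.2, ((F y).1.1, (F y).2))) ρ s s' := by
  simp only [isoChannel, Matrix.of_apply]
  rw [Finset.sum_comm]
  refine Finset.sum_congr rfl fun y _ => ?_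
  rw [Finset.sum_comm]
  refine Finset.sum_congr rfl fun y' _ => ?_
  rw [Finset.sum_eq_single (F y).1.1]
  · simp only [Prod.ext_iff, true_and]
    refine if_congr ?_ rfl rfl
    rw [eq_comm (a := (F y').1.1)]
    tauto
  · intro x _ hx
    exact if_neg fun h => hx (by rw [h.1])
  · simp

/-! ### The gqIND challenge -/

section GQIND

variable {a l w : ℕ}

/-- The part of `typeTwo` before the evaluation: the input register is split off, and the other
contents of `drop` are discarded. -/
def splitInput (inp : Fin a ↪ Fin w) (drop : Finset (Fin w)) (s : Bits w) :
    (Bits a × Bits w) × Bits w :=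
  ((fun i => s (inp i), fun i => if i ∈ drop ∨ (∃ j, inp j = i) then false else s i),
    fun i => if i ∈ drop ∧ ¬ (∃ j, inp j = i) then s i else false)

theorem splitInput_injective (inp : Fin a ↪ Fin w) (drop : Finset (Fin w)) :
    Function.Injective (splitInput inp drop) := by
  intro s s' h
  simp only [splitInput, Prod.mk.injEq] at h
  obtain ⟨⟨h1, h2⟩, h3⟩ := h
  funext i
  by_cases hi : ∃ j, inp j = i
  · obtain ⟨j, rfl⟩ := hi
    exact congrFun h1 j
  · by_cases hd : i ∈ drop
    · simpa [hi, hd] using congrFun h3 i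
    · simpa [hi, hd] using congrFun h2 i

/-- This separates the preparation of the plaintext, which depends on the challenge bit, from the
encryption, which does not. Wires of `out` that lie in `inp` or `drop` have already been zeroed by
`splitInput`, so both sides discard the same information. -/
theorem typeTwo_eq (f : Bits a → Bits l) (inp : Fin a ↪ Fin w) (drop : Finset (Fin w))
    (out : Fin l ↪ Fin w) (ρ : QState w) :
    typeTwo f inp drop out ρ =
      isoChannel (encOut f out) (isoChannel (splitInput inp drop) ρ) := by
  rw [isoChannel_comp, typeTwo, basisChannel_eq]
  apply isoChannel_congr
  · intro s; rfl
  · intro s s'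
    simp only [splitInput, encOut, Prod.mk.injEq, funext_iff]
    constructor
    · intro h
      refine ⟨fun i => ?_, fun j => ?_⟩
      · have := h i
        by_cases hi : ∃ j, inp j = i
        · simp [hi]
        · by_cases hd : i ∈ drop
          · simpa [hi, hd] using this
          · simp [hd]
      · have := h (out j)
        by_cases hi : ∃ k, inp k = out j
        · simp [hi]
        · by_cases hd : out j ∈ drop
          · simp [hd]
          · simpa [hi, hd] using this
    · rintro ⟨h1, h2⟩ i
      by_cases hi : ∃ j, inp j = i
      · simp [hi]
      · by_cases hd : i ∈ drop
        · simpa [hi, hd] using h1 i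
        · by_cases ho : ∃ j, out j = i
          · obtain ⟨j, rfl⟩ := ho
            simpa [hi, hd] using h2 j
          · simp [ho, hd]

/-- The plaintext to be encrypted and the rest of the state in the gqIND challenge. -/
def GQINDAdversary.preState (A : GQINDAdversary a l) (b : Bool) (ρ : QState A.width) :
    Matrix (Bits a × Bits A.width) (Bits a × Bits A.width) ℂ :=
  isoChannel (splitInput (A.plainReg b) (Finset.univ.map (A.plainReg (!b)))) ρ

theorem GQINDAdversary.preState_isChannel (A : GQINDAdversary a l) (b : Bool) :
    IsChannel (A.preState b) :=
  isoChannel_isChannel (splitInput_injective _ _)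

theorem GQINDAdversary.challenge_eq {R : Type} [Fintype R] (A : GQINDAdversary a l)
    (f : R → Bits a → Bits l) (b : Bool) (ρ : QState A.width) :
    A.challenge f b ρ = coinAverage fun r => isoChannel (encOut (f r) A.cipher) (A.preState b ρ) := by
  simp only [GQINDAdversary.challenge, typeTwo_eq, GQINDAdversary.preState]

/-- Whichever register is to be encrypted, in the end both have been removed from the remaining
state: one is traced out by the challenger, the other by the sum over x. -/
theorem GQINDAdversary.sum_preState (A : GQINDAdversary a l) (ρ : QState A.width)
    (s s' : Bits A.width) :
    ∑ x, A.preState true ρ (x, s) (x, s') = ∑ x, A.preState false ρ (x, s) (x, s') := by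
  have hr : ∀ b i, (∃ j, A.plainReg b j = i) ↔ ∃ j, A.plain (b, j) = i := fun b i => Iff.rfl
  simp only [GQINDAdversary.preState, sum_isoChannel]
  refine congrFun (congrFun ?_ s) s'
  apply isoChannel_congr
  · intro s
    funext i
    simp only [splitInput, Finset.mem_map, Finset.mem_univ, true_and, hr]
    exact if_congr (by simp [or_comm]) rfl rfl
  · have key : ∀ b (s s' : Bits A.width),
        (((splitInput (A.plainReg b) (Finset.univ.map (A.plainReg (!b))) s).1.1,
          (splitInput (A.plainReg b) (Finset.univ.map (A.plainReg (!b))) s).2) =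
        ((splitInput (A.plainReg b) (Finset.univ.map (A.plainReg (!b))) s').1.1,
          (splitInput (A.plainReg b) (Finset.univ.map (A.plainReg (!b))) s').2)) ↔
        ∀ p, s (A.plain p) = s' (A.plain p) := by
      intro b s s'
      simp only [splitInput, Prod.mk.injEq, funext_iff, Finset.mem_map, Finset.mem_univ, true_and,
        hr]
      constructor
      · rintro ⟨h1, h2⟩ ⟨c, j⟩
        by_cases hc : c = b
        · subst hc; exact h1 j
        · have hc' : c = !b := by cases b <;> cases c <;> simp_all
          subst hc'
          simpa using h2 (A.plain (!b, j))
      · intro h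
        refine ⟨fun j => h (b, j), fun i => ?_⟩
        split_ifs with hi
        · obtain ⟨⟨j, rfl⟩, -⟩ := hi
          exact h (!b, j)
        · rfl
    intro s s'
    rw [key true, key false]

end GQIND

/-! ### The qIND challenge -/

section QIND

variable {v g a l : ℕ}

theorem reducedState_eq (o : Fin a ↪ Fin v) (σ : QState v) :
    reducedState o σ =
      isoChannel (fun u => (fun i => u (o i), fun i => if ∃ j, o j = i then false else u i)) σ := by
  ext x x'
  simp only [reducedState, isoChannel, Matrix.of_apply, funext_iff]
  refine Finset.sum_congr rfl fun u _ => Finset.sum_congr rfl fun u' _ => if_congr ?_ rfl rfl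
  refine and_congr_right fun _ => and_congr_right fun _ => forall_congr' fun i => ?_
  by_cases hi : ∃ j, o j = i
  · simp only [hi, if_true, iff_true]
    intro h
    obtain ⟨j, hj⟩ := hi
    exact absurd hj (h j)
  · simp only [hi, if_false]
    push Not at hi
    simp [hi]

theorem reducedState_isChannel (o : Fin a ↪ Fin v) : IsChannel (reducedState o) := by
  have h : reducedState o = _ := funext (reducedState_eq o)
  rw [h]
  refine isoChannel_isChannel fun u u' h => ?_
  simp only [Prod.mk.injEq] at h
  funext i
  by_cases hi : ∃ j, o j = i
  · obtain ⟨j, rfl⟩ := hi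
    exact congrFun h.1 j
  · simpa [hi] using congrFun h.2 i

theorem foldl_gates_isChannel (C : List (Gate v)) :
    IsChannel fun ρ : QState v => C.foldl (fun σ gt => gt.apply σ) ρ := by
  induction C with
  | nil => exact ⟨⟨⟨fun _ _ => rfl, fun _ _ => rfl⟩, fun _ h => h⟩, fun _ => rfl⟩
  | cons gt C ih => exact ih.comp gt.apply_isChannel

theorem describedState_posSemidef (o : Fin a ↪ Fin v) (z : Bits (gateTable v g).length) :
    (describedState o z).PosSemidef :=
  (reducedState_isChannel o).psd _ ((foldl_gates_isChannel _).psd _ zeroState_posSemidef)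

theorem describedState_trace (o : Fin a ↪ Fin v) (z : Bits (gateTable v g).length) :
    (describedState o z).trace = 1 :=
  ((reducedState_isChannel o).trace_eq _).trans
    (((foldl_gates_isChannel _).trace_eq _).trans zeroState_trace)

/-- The plaintext to be encrypted and the rest of the state in the qIND challenge. -/
def QINDAdversary.preState (A : QINDAdversary a l) (b : Bool) (ρ : QState A.width) :
    Matrix (Bits a × Bits A.width) (Bits a × Bits A.width) ℂ :=
  Matrix.of fun y y' => if ∀ p, y.2 (A.desc p) = y'.2 (A.desc p) then
    describedState A.prepOut (fun i => y.2 (A.desc (b, i))) y.1 y'.1 * ρ y.2 y'.2 else 0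

theorem QINDAdversary.preState_isChannel (A : QINDAdversary a l) (b : Bool) :
    IsChannel (A.preState b) where
  lin := by
    constructor
    · intro ρ ρ'
      ext y y'
      simp only [preState, Matrix.of_apply, Matrix.add_apply]
      split_ifs
      · ring
      · ring
    · intro c ρ
      ext y y'
      simp only [preState, Matrix.of_apply, Matrix.smul_apply, smul_eq_mul]
      split_ifs <;> ring
  psd ρ hρ := by
    let P : (Bool × Fin (gateTable A.prepWidth A.prepRounds).length → Bool) →
        Matrix (Bits A.width) (Bits A.width) ℂ := fun d =>
      Matrix.diagonal fun s => if (fun p => s (A.desc p)) = d then 1 else 0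
    -- Sum over the measured descriptions d: the described state tensored with the projection of ρ
    -- onto d, which is visibly positive.
    have e : A.preState b ρ = ∑ d, Matrix.kronecker
        (describedState A.prepOut fun i => d (b, i)) (P d * ρ * (P d)ᴴ) := by
      ext y y'
      rw [Matrix.sum_apply, Finset.sum_eq_single fun p => y.2 (A.desc p)]
      · simp only [preState, Matrix.of_apply, Matrix.kronecker, Matrix.kroneckerMap_apply, P,
          Matrix.diagonal_conjTranspose, Matrix.mul_diagonal, Matrix.diagonal_mul, if_true, one_mul]
        by_cases h : ∀ p, y.2 (A.desc p) = y'.2 (A.desc p)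
        · have h' : (fun p => y'.2 (A.desc p)) = fun p => y.2 (A.desc p) :=
            funext fun p => (h p).symm
          simp [h, h']
        · have h' : (fun p => y'.2 (A.desc p)) ≠ fun p => y.2 (A.desc p) :=
            fun h' => h fun p => (congrFun h' p).symm
          simp only [Pi.star_apply, if_neg h, if_neg h', star_zero, mul_zero]
      · intro d _ hd
        simp [P, Matrix.mul_diagonal, Matrix.diagonal_mul, hd.symm]
      · simp
    rw [e]
    exact Matrix.posSemidef_sum _ fun d _ =>
      (describedState_posSemidef _ _).kronecker (hρ.mul_mul_conjTranspose_same _)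
  trace_eq ρ := by
    simp only [preState, Matrix.trace, Matrix.diag, Matrix.of_apply, implies_true, if_true,
      Fintype.sum_prod_type]
    rw [Finset.sum_comm]
    refine Finset.sum_congr rfl fun s _ => ?_
    rw [← Finset.sum_mul]
    have := describedState_trace A.prepOut fun i => s (A.desc (b, i))
    simp only [Matrix.trace, Matrix.diag] at this
    rw [this, one_mul]

theorem QINDAdversary.challenge_eq {R : Type} [Fintype R] (A : QINDAdversary a l)
    (f : R → Bits a → Bits l) (b : Bool) (ρ : QState A.width) :
    A.challenge f b ρ = coinAverage fun r => isoChannel (encOut (f r) A.cipher) (A.preState b ρ) := by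
  rw [QINDAdversary.challenge]
  congr 1
  funext r
  ext t t'
  simp only [isoChannel, Matrix.of_apply, encOut, preState, Fintype.sum_prod_type, funext_iff]
  conv_rhs => rw [Finset.sum_comm]
  refine Finset.sum_congr rfl fun s _ => ?_
  conv_rhs => enter [2, x]; rw [Finset.sum_comm]
  conv_rhs => rw [Finset.sum_comm]
  refine Finset.sum_congr rfl fun s' _ => Finset.sum_congr rfl fun x _ =>
    Finset.sum_congr rfl fun x' _ => ?_
  by_cases hd : ∀ p, s (A.desc p) = s' (A.desc p)
  · simp only [eq_true hd, true_and, if_true]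
    exact if_congr (by tauto) rfl rfl
  · simp only [eq_false hd, false_and, if_false, ite_self]

/-- A described state has trace 1, so tracing it out leaves ρ with both descriptions measured,
whatever b is. -/
theorem QINDAdversary.sum_preState (A : QINDAdversary a l) (ρ : QState A.width)
    (s s' : Bits A.width) :
    ∑ x, A.preState true ρ (x, s) (x, s') = ∑ x, A.preState false ρ (x, s) (x, s') := by
  have h : ∀ b, ∑ x, A.preState b ρ (x, s) (x, s') =
      if ∀ p, s (A.desc p) = s' (A.desc p) then ρ s s' else 0 := by
    intro b
    simp only [preState, Matrix.of_apply]
    split_ifs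
    · have := describedState_trace A.prepOut fun i => s (A.desc (b, i))
      simp only [Matrix.trace, Matrix.diag] at this
      rw [← Finset.sum_mul, this, one_mul]
    · simp
  rw [h, h]

end QIND

/-! ### Oracle circuits over arbitrary sets of wires -/

/-- One step of an oracle circuit for a permutation of `N`-bit strings, on qubits labelled by `ι`.
Type-(2) queries are made in place. -/
inductive WStep (ι : Type) (N : ℕ)
  | gate (k : GateKind) (t : ι) (c : Finset ι) (h : t ∉ c)
  | query₁ (e : Fin N ⊕ Fin N ↪ ι)
  | query₂ (e : Fin N ↪ ι)

/-- Only queries whose type lies in `Q` are used. -/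
def WStep.Allowed {ι : Type} {N : ℕ} (Q : Set QueryType) : WStep ι N → Prop
  | .gate _ _ _ _ => True
  | .query₁ _ => QueryType.one ∈ Q
  | .query₂ _ => QueryType.two ∈ Q

/-- The operator `|v⟩ ↦ |F v⟩`. -/
def funMat {X : Type} [DecidableEq X] (F : X → X) : Matrix X X ℂ :=
  Matrix.of fun u v => if u = F v then 1 else 0

theorem funMat_mul {X : Type} [Fintype X] [DecidableEq X] (F G : X → X) :
    funMat F * funMat G = funMat (F ∘ G) := by
  ext u v
  simp [funMat, Matrix.mul_apply]

theorem funMat_id {X : Type} [Fintype X] [DecidableEq X] : funMat (id : X → X) = 1 := by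
  ext u v
  simp [funMat, Matrix.one_apply]

/-- An environment that is the same for all basis states causes no decoherence. -/
theorem isoChannel_funMat {X E : Type} [Fintype X] [DecidableEq X] [DecidableEq E]
    {F : X → X × E} (h : ∀ s s', (F s).2 = (F s').2) (ρ : Matrix X X ℂ) :
    isoChannel F ρ = funMat (fun s => (F s).1) * ρ * (funMat fun s => (F s).1)ᴴ := by
  ext t t'
  simp only [isoChannel, funMat, Matrix.of_apply, Matrix.mul_apply, Matrix.conjTranspose_apply,
    Finset.sum_mul]
  rw [Finset.sum_comm]
  refine Finset.sum_congr rfl fun s _ => Finset.sum_congr rfl fun s' _ => ?_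
  have := h s' s
  by_cases h1 : (F s').1 = t <;> by_cases h2 : (F s).1 = t' <;>
    simp [h1, h2, this, eq_comm (a := t), eq_comm (a := t')]

section Wires

variable {ι ι' κ lam : Type} [Fintype ι] [DecidableEq ι] [Fintype ι'] [DecidableEq ι']
  [Fintype κ] [DecidableEq κ] [Fintype lam] [DecidableEq lam] {N : ℕ}

/-- The classical action of a type-(1) query. -/
def queryFun₁ (f : Bits N → Bits N) (x y : Fin N → ι) (v : ι → Bool) : ι → Bool :=
  Function.extend y (fun j => xor (v (y j)) (f (fun i => v (x i)) j)) v

/-- The classical action of a type-(2) query in place. -/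
def queryFun₂ (f : Bits N → Bits N) (e : Fin N → ι) (v : ι → Bool) : ι → Bool :=
  Function.extend e (f fun i => v (e i)) v

/-- The operator of a step. -/
def WStep.mat (π : Equiv.Perm (Bits N)) : WStep ι N → Matrix (ι → Bool) (ι → Bool) ℂ
  | .gate k t c _ => Matrix.of fun u v =>
      if ∀ i ∈ c, v i = true then (if ∀ i, i ≠ t → u i = v i then k.mat (u t) (v t) else 0)
      else (if u = v then 1 else 0)
  | .query₁ e => funMat (queryFun₁ π (fun j => e (Sum.inl j)) fun j => e (Sum.inr j))
  | .query₂ e => funMat (queryFun₂ π e)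

/-- The operator of a circuit. -/
def circMat (π : Equiv.Perm (Bits N)) : List (WStep ι N) → Matrix (ι → Bool) (ι → Bool) ℂ
  | [] => 1
  | s :: C => circMat π C * s.mat π

theorem circMat_append (π : Equiv.Perm (Bits N)) (C C' : List (WStep ι N)) :
    circMat π (C ++ C') = circMat π C' * circMat π C := by
  induction C with
  | nil => simp [circMat]
  | cons s C ih => simp [circMat, ih, Matrix.mul_assoc]

/-- Relabelling of the wires. -/
def WStep.map (e : ι ↪ ι') : WStep ι N → WStep ι' N
  | .gate k t c h => .gate k (e t) (c.map e) (by simpa using h)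
  | .query₁ q => .query₁ (q.trans e)
  | .query₂ q => .query₂ (q.trans e)

theorem WStep.Allowed.map {Q : Set QueryType} {s : WStep ι N} (h : s.Allowed Q) (e : ι ↪ ι') :
    (s.map e).Allowed Q := by
  cases s <;> exact h

/-- The operator `M` acting on the wires in the range of `e`. -/
def liftMat (e : ι ↪ ι') (M : Matrix (ι → Bool) (ι → Bool) ℂ) :
    Matrix (ι' → Bool) (ι' → Bool) ℂ :=
  Matrix.of fun u v =>
    if ∀ i, (¬ ∃ j, e j = i) → u i = v i then M (fun j => u (e j)) (fun j => v (e j)) else 0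

theorem extend_comp_eq {α : Type} (e : ι ↪ ι') {q : α → ι} (hq : Function.Injective q) (g : α → Bool)
    (v : ι' → Bool) (j : ι) :
    Function.extend (fun a => e (q a)) g v (e j) = Function.extend q g (fun j => v (e j)) j := by
  by_cases h : ∃ a, q a = j
  · obtain ⟨a, rfl⟩ := h
    rw [hq.extend_apply]
    exact (e.injective.comp hq).extend_apply g v a
  · rw [Function.extend_apply' _ _ _ h, Function.extend_apply']
    rintro ⟨a, ha⟩
    exact h ⟨a, e.injective ha⟩

theorem eq_extend_iff {α : Type} (e : ι ↪ ι') {q : α → ι} (hq : Function.Injective q)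
    (g : α → Bool) (u v : ι' → Bool) :
    u = Function.extend (fun a => e (q a)) g v ↔ (∀ i, (¬ ∃ j, e j = i) → u i = v i) ∧
      (fun j => u (e j)) = Function.extend q g (fun j => v (e j)) := by
  constructor
  · rintro rfl
    refine ⟨fun i hi => Function.extend_apply' _ _ _ ?_, funext fun j => extend_comp_eq e hq g v j⟩
    rintro ⟨a, ha⟩
    exact hi ⟨_, ha⟩
  · rintro ⟨h1, h2⟩
    funext i
    by_cases hi : ∃ j, e j = i
    · obtain ⟨j, rfl⟩ := hi
      rw [extend_comp_eq e hq, ← h2]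
    · rw [h1 i hi, Function.extend_apply']
      rintro ⟨a, ha⟩
      exact hi ⟨_, ha⟩

theorem forall_off_iff (e : ι ↪ ι') (p : ι → Prop) (q : ι' → Prop) :
    (∀ i, (∀ j, p j → i ≠ e j) → q i) ↔
      (∀ i, (¬ ∃ j, e j = i) → q i) ∧ ∀ j, ¬ p j → q (e j) := by
  constructor
  · intro h
    refine ⟨fun i hi => h i fun j _ hj => hi ⟨j, hj.symm⟩, fun j hj => h _ fun k hk hjk => hj ?_⟩
    rwa [e.injective hjk]
  · rintro ⟨h1, h2⟩ i hi
    by_cases hr : ∃ j, e j = i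
    · obtain ⟨j, rfl⟩ := hr
      exact h2 j fun hj => hi j hj rfl
    · exact h1 i hr

theorem ite_eq_ite_ite {p q r : Prop} [Decidable p] [Decidable q] [Decidable r]
    (h : p ↔ q ∧ r) : (if p then (1 : ℂ) else 0) = if q then (if r then 1 else 0) else 0 := by
  by_cases hq : q <;> by_cases hr : r <;> simp [h, hq, hr]

theorem WStep.mat_map (π : Equiv.Perm (Bits N)) (e : ι ↪ ι') (s : WStep ι N) :
    (s.map e).mat π = liftMat e (s.mat π) := by
  ext u v
  cases s with
  | gate k t c h =>
    have h1 : (∀ i ∈ c.map e, v i = true) ↔ ∀ i ∈ c, v (e i) = true := by simp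
    have h2 : (∀ i, i ≠ e t → u i = v i) ↔ (∀ i, (¬ ∃ j, e j = i) → u i = v i) ∧
        ∀ j, j ≠ t → u (e j) = v (e j) := by
      rw [← forall_off_iff e (fun j => j = t) fun i => u i = v i]
      simp
    have h3 : u = v ↔ (∀ i, (¬ ∃ j, e j = i) → u i = v i) ∧
        (fun j => u (e j)) = fun j => v (e j) := by
      have := forall_off_iff e (fun _ => False) fun i => u i = v i
      simpa [funext_iff] using this
    simp only [WStep.map, WStep.mat, liftMat, Matrix.of_apply, h1, h2, h3]
    by_cases hoff : ∀ i, (¬ ∃ j, e j = i) → u i = v i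
    · simp only [eq_true hoff, true_and, if_true]
    · simp only [eq_false hoff, false_and, if_false, ite_self]
  | query₁ q =>
    simp only [WStep.map, WStep.mat, liftMat, Matrix.of_apply, funMat, queryFun₁,
      Function.Embedding.trans_apply]
    exact ite_eq_ite_ite (eq_extend_iff e (q.injective.comp Sum.inr_injective) _ u v)
  | query₂ q =>
    simp only [WStep.map, WStep.mat, liftMat, Matrix.of_apply, funMat, queryFun₂,
      Function.Embedding.trans_apply]
    exact ite_eq_ite_ite (eq_extend_iff e q.injective _ u v)

theorem liftMat_mul (e : ι ↪ ι') (M M' : Matrix (ι → Bool) (ι → Bool) ℂ) :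
    liftMat e M * liftMat e M' = liftMat e (M * M') := by
  ext u v
  rw [Matrix.mul_apply]
  simp only [liftMat, Matrix.of_apply]
  by_cases h : ∀ i, (¬ ∃ j, e j = i) → u i = v i
  · rw [if_pos h, Matrix.mul_apply]
    symm
    -- Only intermediate states that agree with `v` off the range of `e` contribute; they are the
    -- extensions of the states y of the small register.
    refine Fintype.sum_of_injective (fun y : ι → Bool => Function.extend e y v)
      (fun y y' hy => funext fun j => ?_) _ _ (fun x hx => ?_) (fun y => ?_)
    · simpa [e.injective.extend_apply] using congrFun hy (e j)
    · by_cases hxv : ∀ i, (¬ ∃ j, e j = i) → x i = v i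
      · refine absurd ⟨fun j => x (e j), funext fun i => ?_⟩ hx
        by_cases hi : ∃ j, e j = i
        · obtain ⟨j, rfl⟩ := hi
          exact e.injective.extend_apply _ _ j
        · rw [hxv i hi]
          exact Function.extend_apply' _ _ _ hi
      · rw [if_neg hxv, mul_zero]
    · have h1 : ∀ i, (¬ ∃ j, e j = i) → Function.extend e y v i = v i := fun i hi =>
        Function.extend_apply' _ _ _ hi
      have h2 : ∀ i, (¬ ∃ j, e j = i) → u i = Function.extend e y v i := fun i hi =>
        (h i hi).trans (h1 i hi).symm
      have h3 : (fun j => Function.extend e y v (e j)) = y :=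
        funext fun j => e.injective.extend_apply _ _ j
      simp only [if_pos h1, if_pos h2, h3]
  · rw [if_neg h]
    refine Finset.sum_eq_zero fun x _ => ?_
    by_cases h1 : ∀ i, (¬ ∃ j, e j = i) → u i = x i
    · by_cases h2 : ∀ i, (¬ ∃ j, e j = i) → x i = v i
      · exact absurd (fun i hi => (h1 i hi).trans (h2 i hi)) h
      · rw [if_neg h2, mul_zero]
    · rw [if_neg h1, zero_mul]

theorem liftMat_one (e : ι ↪ ι') : liftMat e 1 = 1 := by
  ext u v
  simp only [liftMat, Matrix.of_apply, Matrix.one_apply, ← ite_and]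
  refine if_congr ?_ rfl rfl
  have := forall_off_iff e (fun _ => False) fun i => u i = v i
  simpa [funext_iff] using this.symm

theorem circMat_map (π : Equiv.Perm (Bits N)) (e : ι ↪ ι') (C : List (WStep ι N)) :
    circMat π (C.map (WStep.map e)) = liftMat e (circMat π C) := by
  induction C with
  | nil => exact (liftMat_one e).symm
  | cons s C ih => rw [List.map_cons, circMat, ih, WStep.mat_map, liftMat_mul, circMat]

/-! ### Simulation by circuits with ancillas -/

/-- The Kraus operator of the outcome `g` on the ancillas, which start in `|0…0⟩`. -/
def kraus (π : Equiv.Perm (Bits N)) (C : List (WStep (ι ⊕ κ) N)) (g : κ → Bool) :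
    Matrix (ι → Bool) (ι → Bool) ℂ :=
  Matrix.of fun t s => circMat π C (Sum.elim t g) (Sum.elim s fun _ => false)

/-- The circuit `C` with ancillas `κ` implements the operation `Φ`. -/
def Implements (π : Equiv.Perm (Bits N)) (C : List (WStep (ι ⊕ κ) N))
    (Φ : Matrix (ι → Bool) (ι → Bool) ℂ → Matrix (ι → Bool) (ι → Bool) ℂ) : Prop :=
  ∀ ρ, Φ ρ = ∑ g, kraus π C g * ρ * (kraus π C g)ᴴ

/-- Two circuits in sequence, each with its own ancillas. -/
def seqCirc (C : List (WStep (ι ⊕ κ) N)) (C' : List (WStep (ι ⊕ lam) N)) :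
    List (WStep (ι ⊕ (κ ⊕ lam)) N) :=
  C.map (WStep.map ((Function.Embedding.refl ι).sumMap Function.Embedding.inl)) ++
    C'.map (WStep.map ((Function.Embedding.refl ι).sumMap Function.Embedding.inr))

/-- The first circuit leaves the ancillas of the second at zero, and the second leaves those of the
first at the outcome `g`. Hence the intermediate state is free only on the main wires, and the sum
over it is the matrix product. -/
theorem kraus_seqCirc (π : Equiv.Perm (Bits N)) (C : List (WStep (ι ⊕ κ) N))
    (C' : List (WStep (ι ⊕ lam) N)) (g : κ → Bool) (g' : lam → Bool) :
    kraus π (seqCirc C C') (Sum.elim g g') = kraus π C' g' * kraus π C g := by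
  ext t s
  rw [Matrix.mul_apply]
  simp only [kraus, Matrix.of_apply, seqCirc, circMat_append, circMat_map, Matrix.mul_apply]
  symm
  refine Fintype.sum_of_injective (fun x : ι → Bool => Sum.elim x (Sum.elim g fun _ => false))
    (fun x x' h => funext fun i => congrFun h (Sum.inl i)) _ _ (fun x hx => ?_) (fun x => ?_)
  · simp only [liftMat, Matrix.of_apply]
    by_cases h1 : ∀ k, x (Sum.inr (Sum.inl k)) = g k
    · by_cases h2 : ∀ k, x (Sum.inr (Sum.inr k)) = false
      · refine absurd ⟨fun i => x (Sum.inl i), funext ?_⟩ hx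
        rintro (i | k | k) <;> simp [h1, h2]
      · push Not at h2
        obtain ⟨k, hk⟩ := h2
        rw [if_neg (c := ∀ i, _ → x i = _), mul_zero]
        intro h
        exact hk (by simpa using h (Sum.inr (Sum.inr k)) (by simp))
    · push Not at h1
      obtain ⟨k, hk⟩ := h1
      rw [if_neg, zero_mul]
      intro h
      exact hk (by simpa using (h (Sum.inr (Sum.inl k)) (by simp)).symm)
  · simp only [liftMat, Matrix.of_apply]
    rw [if_pos, if_pos]
    · congr 2 <;> funext i <;> rcases i with i | i <;> rfl
    · rintro (i | k | k) hi
      · exact absurd ⟨Sum.inl i, rfl⟩ hi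
      · exact absurd ⟨Sum.inr k, rfl⟩ hi
      · rfl
    · rintro (i | k | k) hi
      · exact absurd ⟨Sum.inl i, rfl⟩ hi
      · rfl
      · exact absurd ⟨Sum.inr k, rfl⟩ hi

theorem Implements.seq {π : Equiv.Perm (Bits N)} {C : List (WStep (ι ⊕ κ) N)}
    {C' : List (WStep (ι ⊕ lam) N)}
    {Φ Ψ : Matrix (ι → Bool) (ι → Bool) ℂ → Matrix (ι → Bool) (ι → Bool) ℂ}
    (h : Implements π C Φ) (h' : Implements π C' Ψ) :
    Implements π (seqCirc C C') fun ρ => Ψ (Φ ρ) := by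
  intro ρ
  have e : ∀ φ : (κ ⊕ lam → Bool) → Matrix (ι → Bool) (ι → Bool) ℂ,
      ∑ g, φ g = ∑ g : κ → Bool, ∑ g' : lam → Bool, φ (Sum.elim g g') := by
    intro φ
    rw [← Fintype.sum_prod_type']
    exact Fintype.sum_equiv (Equiv.sumArrowEquivProdArrow κ lam Bool) _ _ fun g => by
      congr 1; funext i; rcases i with i | i <;> rfl
  change Ψ (Φ ρ) = _
  rw [h' (Φ ρ), h ρ, e, Finset.sum_comm]
  simp only [kraus_seqCirc, Matrix.conjTranspose_mul, Matrix.mul_sum, Matrix.sum_mul,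
    Matrix.mul_assoc]

/-- `Φ`, given black-box access to a permutation, is implemented by a circuit of length at most `L`
with at most `k` ancillas and queries of the types in `Q`. -/
def Simulable (Q : Set QueryType) (Φ : Equiv.Perm (Bits N) →
    Matrix (ι → Bool) (ι → Bool) ℂ → Matrix (ι → Bool) (ι → Bool) ℂ) (k L : ℕ) : Prop :=
  ∃ (κ : Type) (_ : Fintype κ) (_ : DecidableEq κ) (C : List (WStep (ι ⊕ κ) N)),
    Fintype.card κ ≤ k ∧ C.length ≤ L ∧ (∀ s ∈ C, s.Allowed Q) ∧ ∀ π, Implements π C (Φ π)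

variable {Q : Set QueryType} {Φ Ψ : Equiv.Perm (Bits N) →
    Matrix (ι → Bool) (ι → Bool) ℂ → Matrix (ι → Bool) (ι → Bool) ℂ} {k L k' L' : ℕ}

theorem Simulable.mono (h : Simulable Q Φ k L) (hk : k ≤ k') (hL : L ≤ L') :
    Simulable Q Φ k' L' := by
  obtain ⟨κ, i1, i2, C, h1, h2, h3⟩ := h
  exact ⟨κ, i1, i2, C, h1.trans hk, h2.trans hL, h3⟩

theorem Simulable.seq (h : Simulable Q Φ k L) (h' : Simulable Q Ψ k' L') :
    Simulable Q (fun π ρ => Ψ π (Φ π ρ)) (k + k') (L + L') := by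
  obtain ⟨κ, i1, i2, C, h1, h2, h3, h4⟩ := h
  obtain ⟨κ', i1', i2', C', h1', h2', h3', h4'⟩ := h'
  refine ⟨κ ⊕ κ', inferInstance, inferInstance, seqCirc C C', ?_, ?_, ?_, fun π =>
    (h4 π).seq (h4' π)⟩
  · rw [Fintype.card_sum]; omega
  · simp only [seqCirc, List.length_append, List.length_map]; omega
  · intro s hs
    simp only [seqCirc, List.mem_append, List.mem_map] at hs
    rcases hs with ⟨s, hs, rfl⟩ | ⟨s, hs, rfl⟩
    · exact (h3 s hs).map _
    · exact (h3' s hs).map _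

theorem sum_elim_isEmpty [IsEmpty κ] (φ : (κ → Bool) → Matrix (ι → Bool) (ι → Bool) ℂ) :
    ∑ g, φ g = φ fun _ => false := by
  rw [Fintype.sum_unique]
  congr 1
  exact Subsingleton.elim _ _

/-- A circuit without ancillas. -/
theorem Simulable.of_circ (C : List (WStep ι N)) (hC : ∀ s ∈ C, s.Allowed Q)
    (h : ∀ π ρ, Φ π ρ = circMat π C * ρ * (circMat π C)ᴴ) : Simulable Q Φ 0 C.length := by
  refine ⟨Empty, inferInstance, inferInstance, C.map (WStep.map Function.Embedding.inl), by simp,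
    by simp, ?_, fun π ρ => ?_⟩
  · intro s hs
    obtain ⟨s', hs', rfl⟩ := List.mem_map.1 hs
    exact (hC s' hs').map _
  · have : kraus π (C.map (WStep.map (Function.Embedding.inl : ι ↪ ι ⊕ Empty)))
        (fun _ => false) = circMat π C := by
      ext t s
      rw [kraus, Matrix.of_apply, circMat_map, liftMat, Matrix.of_apply, if_pos]
      · rfl
      · rintro (i | i) hi
        · exact absurd ⟨i, rfl⟩ hi
        · exact i.elim
    rw [sum_elim_isEmpty, this, h]

theorem Simulable.id : Simulable Q (fun (_ : Equiv.Perm (Bits N)) ρ => ρ :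
    Equiv.Perm (Bits N) → Matrix (ι → Bool) (ι → Bool) ℂ → Matrix (ι → Bool) (ι → Bool) ℂ) 0 0 :=
  Simulable.of_circ [] (by simp) (by simp [circMat])

end Wires

/-! ### Distinguishers from simulations -/

/-- A step on numbered wires as a step of a distinguisher. -/
def WStep.toStep {W N : ℕ} : WStep (Fin W) N → Step W N N
  | .gate k t c h => .gate ⟨k, t, c, h⟩
  | .query₁ e => .query₁ e
  | .query₂ e => .query₂ e e

theorem WStep.Allowed.toStep {W N : ℕ} {Q : Set QueryType} {s : WStep (Fin W) N}
    (h : s.Allowed Q) : s.toStep.Allowed Q := by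
  cases s <;> exact h

theorem coinAverage_unit {w : ℕ} (ρ : Unit → QState w) : coinAverage ρ = ρ () := by
  simp [coinAverage]

theorem WStep.toStep_run {W N : ℕ} (π : Equiv.Perm (Bits N)) (s : WStep (Fin W) N)
    (ρ : QState W) :
    s.toStep.run (fun _ : Unit => ⇑π) ρ = s.mat π * ρ * (s.mat π)ᴴ := by
  cases s with
  | gate k t c h =>
    have : (⟨k, t, c, h⟩ : Gate W).mat = (WStep.gate k t c h : WStep (Fin W) N).mat π := by
      ext u v
      simp only [Gate.mat, WStep.mat, Matrix.of_apply]
      split_ifs <;> rfl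
    simp only [WStep.toStep, Step.run, Gate.apply, this]
  | query₁ e =>
    simp only [WStep.toStep, Step.run, coinAverage_unit, typeOne, basisChannel_eq]
    exact isoChannel_funMat (fun _ _ => rfl) ρ
  | query₂ e =>
    simp only [WStep.toStep, Step.run, coinAverage_unit, typeTwo, basisChannel_eq]
    refine (isoChannel_funMat (fun s s' => ?_) ρ).trans ?_
    · funext i
      by_cases hi : ∃ j, e j = i <;> simp [hi]
    · have : (fun s : Bits W => Function.extend e (π fun i => s (e i)) fun i =>
          if i ∈ (∅ : Finset (Fin W)) ∨ (∃ j, e j = i) then false else s i) = queryFun₂ π e := by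
        funext s i
        by_cases hi : ∃ j, e j = i
        · obtain ⟨j, rfl⟩ := hi
          rw [queryFun₂, e.injective.extend_apply, e.injective.extend_apply]
        · rw [queryFun₂, Function.extend_apply' _ _ _ hi, Function.extend_apply' _ _ _ hi]
          simp [hi]
      simp only [this, WStep.mat]

theorem runSteps_toStep {W N : ℕ} (π : Equiv.Perm (Bits N)) (C : List (WStep (Fin W) N))
    (ρ : QState W) :
    runSteps (fun _ : Unit => ⇑π) (C.map WStep.toStep) ρ = circMat π C * ρ * (circMat π C)ᴴ := by
  induction C generalizing ρ with
  | nil => simp [runSteps, circMat]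
  | cons s C ih =>
    change runSteps _ (C.map WStep.toStep) (s.toStep.run _ ρ) = _
    rw [ih, WStep.toStep_run, circMat, Matrix.conjTranspose_mul]
    simp only [Matrix.mul_assoc]

theorem mul_zeroState_mul {w : ℕ} {X : Type} [Fintype X] (M : Matrix X (Bits w) ℂ) (t t' : X) :
    (M * zeroState w * Mᴴ) t t' = M t (fun _ => false) * star (M t' fun _ => false) := by
  simp only [Matrix.mul_apply, zeroState, Matrix.of_apply, Matrix.conjTranspose_apply]
  rw [Finset.sum_eq_single fun _ => false, Finset.sum_eq_single fun _ => false]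
  · simp
  · intro b _ hb; simp [hb]
  · simp
  · intro b _ hb; simp [hb]
  · simp

/-- A simulated operation yields a distinguisher that reads qubit `i` of its result. -/
theorem Simulable.exists_distinguisher {w N k L : ℕ} {Q : Set QueryType}
    {Φ : Equiv.Perm (Bits N) → QState w → QState w} (h : Simulable Q Φ k L) (i : Fin w) :
    ∃ D : Distinguisher N, (∀ s ∈ D.steps, s.Allowed Q) ∧ D.size ≤ w + k + L ∧
      ∀ π, D.acceptProb π = measureProb i true (Φ π (zeroState w)) := by
  obtain ⟨κ, i1, i2, C, h1, h2, h3, h4⟩ := h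
  have hcard : Fintype.card (Fin w ⊕ κ) = w + Fintype.card κ := by simp
  let e : Fin w ⊕ κ ≃ Fin (w + Fintype.card κ) := Fintype.equivFinOfCardEq hcard
  refine ⟨⟨w + Fintype.card κ, (C.map (WStep.map e.toEmbedding)).map WStep.toStep, e (Sum.inl i)⟩,
    ?_, ?_, fun π => ?_⟩
  · intro s hs
    simp only [List.mem_map] at hs
    obtain ⟨_, ⟨s, hs, rfl⟩, rfl⟩ := hs
    exact ((h3 s hs).map _).toStep
  · simp only [Distinguisher.size, List.length_map]
    omega
  · have hl : ∀ u v, circMat π (C.map (WStep.map e.toEmbedding)) u v =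
        circMat π C (fun j => u (e j)) fun j => v (e j) := by
      intro u v
      rw [circMat_map, liftMat, Matrix.of_apply, if_pos]
      · rfl
      · intro i hi
        exact absurd ⟨e.symm i, e.apply_symm_apply i⟩ hi
    have hk : ∀ g t, (kraus π C g * zeroState w * (kraus π C g)ᴴ) t t =
        circMat π C (Sum.elim t g) (fun _ => false) *
          star (circMat π C (Sum.elim t g) fun _ => false) := by
      intro g t
      rw [mul_zeroState_mul]
      have : (Sum.elim (fun _ => false) fun _ => false : Fin w ⊕ κ → Bool) = fun _ => false := by
        funext j; rcases j with j | j <;> rfl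
      simp only [kraus, Matrix.of_apply, this]
    simp only [Distinguisher.acceptProb, runSteps_toStep, measureProb, mul_zeroState_mul, hl,
      h4 π (zeroState w), Matrix.sum_apply, hk]
    -- A measurement of qubit `i` alone sums over all contents of the ancillas, and this is the
    -- Kraus sum for `Φ π`.
    let E : (Fin (w + Fintype.card κ) → Bool) ≃ (Fin w → Bool) × (κ → Bool) :=
      (Equiv.arrowCongr e.symm (Equiv.refl Bool)).trans (Equiv.sumArrowEquivProdArrow _ _ _)
    rw [Fintype.sum_equiv E _ (fun p => if p.1 i = true then
      (circMat π C (Sum.elim p.1 p.2) (fun _ => false) *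
          star (circMat π C (Sum.elim p.1 p.2) fun _ => false)).re else 0)]
    · rw [Fintype.sum_prod_type]
      refine Finset.sum_congr rfl fun t _ => ?_
      split_ifs with ht
      · rw [Complex.re_sum]
      · simp
    · intro u
      have : (Sum.elim (E u).1 (E u).2) = fun j => u (e j) := by
        funext j; rcases j with j | j <;> rfl
      rw [this]
      rfl

/-! ### Auxiliary registers that start in `|0⟩` and are discarded -/

section Ancilla

variable {ι κ lam : Type} [Fintype ι] [DecidableEq ι]
  [Fintype κ] [DecidableEq κ] [Fintype lam] [DecidableEq lam] {N : ℕ}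

/-- The operator `|s⟩ ↦ |s⟩|0…0⟩`. -/
def zeroIso (ι lam : Type) [Fintype ι] [DecidableEq ι] [Fintype lam] [DecidableEq lam] :
    Matrix (ι ⊕ lam → Bool) (ι → Bool) ℂ :=
  Matrix.of fun x s => if x = Sum.elim s (fun _ => false) then 1 else 0

/-- The operator `⟨g|` on the second register. -/
def braRight (ι : Type) [Fintype ι] [DecidableEq ι] (g : lam → Bool) :
    Matrix (ι → Bool) (ι ⊕ lam → Bool) ℂ :=
  Matrix.of fun t x => if x = Sum.elim t g then 1 else 0

/-- Use `Ψ` with an auxiliary register `lam` starting in `|0⟩` and discarded in the end. -/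
def withAncilla (Ψ : Matrix (ι ⊕ lam → Bool) (ι ⊕ lam → Bool) ℂ →
    Matrix (ι ⊕ lam → Bool) (ι ⊕ lam → Bool) ℂ) (ρ : Matrix (ι → Bool) (ι → Bool) ℂ) :
    Matrix (ι → Bool) (ι → Bool) ℂ :=
  ∑ g : lam → Bool, braRight ι g * Ψ (zeroIso ι lam * ρ * (zeroIso ι lam)ᴴ) * (braRight ι g)ᴴ

theorem braRight_mul_mul_zeroIso (M : Matrix (ι ⊕ lam → Bool) (ι ⊕ lam → Bool) ℂ) (g : lam → Bool)
    (t s : ι → Bool) : (braRight ι g * M * zeroIso ι lam) t s =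
      M (Sum.elim t g) (Sum.elim s fun _ => false) := by
  simp [Matrix.mul_apply, braRight, zeroIso]

theorem braRight_mul_mul (M : Matrix (ι ⊕ lam → Bool) (ι ⊕ lam → Bool) ℂ) (g : lam → Bool)
    (t t' : ι → Bool) : (braRight ι g * M * (braRight ι g)ᴴ) t t' =
      M (Sum.elim t g) (Sum.elim t' g) := by
  simp [Matrix.mul_apply, braRight, Matrix.conjTranspose_apply, apply_ite]

theorem sum_sumElim {M : Type} [AddCommMonoid M] (φ : (κ ⊕ lam → Bool) → M) :
    ∑ g, φ g = ∑ g : κ → Bool, ∑ g' : lam → Bool, φ (Sum.elim g g') := by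
  rw [← Fintype.sum_prod_type']
  exact Fintype.sum_equiv (Equiv.sumArrowEquivProdArrow κ lam Bool) _ _ fun g => by
    congr 1; funext i; rcases i with i | i <;> rfl

/-- The auxiliary register starts in zero and is discarded, so it simply joins the ancillas; only
the wires are regrouped. -/
theorem Simulable.withAncilla {Q : Set QueryType} {k L : ℕ}
    {Ψ : Equiv.Perm (Bits N) → Matrix (ι ⊕ lam → Bool) (ι ⊕ lam → Bool) ℂ →
      Matrix (ι ⊕ lam → Bool) (ι ⊕ lam → Bool) ℂ} (h : Simulable Q Ψ k L) :
    Simulable Q (fun π => QEnc.withAncilla (Ψ π)) (Fintype.card lam + k) L := by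
  obtain ⟨κ, i1, i2, C, h1, h2, h3, h4⟩ := h
  refine ⟨lam ⊕ κ, inferInstance, inferInstance,
    C.map (WStep.map (Equiv.sumAssoc ι lam κ).toEmbedding), ?_, by simpa using h2, ?_, ?_⟩
  · rw [Fintype.card_sum]; omega
  · intro s hs
    obtain ⟨s', hs', rfl⟩ := List.mem_map.1 hs
    exact (h3 s' hs').map _
  · intro π ρ
    have hk : ∀ (g : lam → Bool) (g' : κ → Bool),
        kraus π (C.map (WStep.map (Equiv.sumAssoc ι lam κ).toEmbedding)) (Sum.elim g g') =
          braRight ι g * kraus π C g' * zeroIso ι lam := by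
      intro g g'
      ext t s
      rw [braRight_mul_mul_zeroIso, kraus, kraus, Matrix.of_apply, Matrix.of_apply, circMat_map,
        liftMat, Matrix.of_apply, if_pos]
      · congr 1 <;> funext i <;> rcases i with (i | i) | i <;> rfl
      · intro i hi
        exact absurd ⟨(Equiv.sumAssoc ι lam κ).symm i, (Equiv.sumAssoc ι lam κ).apply_symm_apply i⟩ hi
    rw [sum_sumElim]
    change ∑ g : lam → Bool, braRight ι g * Ψ π (zeroIso ι lam * ρ * (zeroIso ι lam)ᴴ) *
      (braRight ι g)ᴴ = _
    rw [h4 π]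
    simp only [hk, Matrix.conjTranspose_mul, Matrix.mul_sum, Matrix.sum_mul,
      Matrix.mul_assoc]

end Ancilla

/-! ### Classical circuits -/

section Layers

variable {ι κ J : Type} [Fintype ι] [DecidableEq ι] [Fintype κ] [DecidableEq κ] [Fintype J]
  [DecidableEq J] {N : ℕ}

/-- Local updates with disjoint targets, none of which reads the target of another. -/
theorem foldl_updates {α : Type} (tgt : J → α → ι)
    (hinj : ∀ j j' a a', tgt j a = tgt j' a' → j = j' ∧ a = a') (G : J → (ι → Bool) → α → Bool)
    (hG : ∀ j (v v' : ι → Bool), (∀ i, (∀ k, k ≠ j → ∀ a, tgt k a ≠ i) → v i = v' i) →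
      G j v = G j v') (L : List J) (hL : L.Nodup) (v : ι → Bool) :
    (∀ j ∈ L, ∀ a, L.foldl (fun v j => Function.extend (tgt j) (G j v) v) v (tgt j a) = G j v a) ∧
      ∀ i, (∀ j ∈ L, ∀ a, tgt j a ≠ i) →
        L.foldl (fun v j => Function.extend (tgt j) (G j v) v) v i = v i := by
  induction L generalizing v with
  | nil => simp
  | cons j L ih =>
    obtain ⟨hj, hL⟩ := List.nodup_cons.1 hL
    obtain ⟨h1, h2⟩ := ih hL (Function.extend (tgt j) (G j v) v)
    have hoff : ∀ i, (∀ a, tgt j a ≠ i) → Function.extend (tgt j) (G j v) v i = v i :=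
      fun i hi => Function.extend_apply' _ _ _ fun ⟨a, ha⟩ => hi a ha
    have hon : ∀ a, Function.extend (tgt j) (G j v) v (tgt j a) = G j v a := fun a =>
      Function.Injective.extend_apply (fun a a' h => (hinj _ _ _ _ h).2) _ _ _
    refine ⟨?_, ?_⟩
    · intro k hk a
      rcases List.mem_cons.1 hk with rfl | hk
      · rw [List.foldl_cons, h2, hon]
        intro l hl a' h
        exact hj ((hinj _ _ _ _ h).1 ▸ hl)
      · rw [List.foldl_cons, h1 k hk]
        refine congrFun (hG k _ _ fun i hi => hoff i (hi j ?_)) a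
        rintro rfl
        exact hj hk
    · intro i hi
      rw [List.foldl_cons, h2 i fun k hk => hi k (List.mem_cons_of_mem _ hk),
        hoff i (hi j List.mem_cons_self)]

/-- One step for every element of `J`. -/
def layer (s : J → WStep ι N) : List (WStep ι N) := (Finset.univ : Finset J).toList.map s

theorem length_layer (s : J → WStep ι N) : (layer s).length = Fintype.card J := by
  simp [layer]

theorem mem_layer {s : J → WStep ι N} {x : WStep ι N} : x ∈ layer s ↔ ∃ j, s j = x := by
  simp [layer]

theorem circMat_map_funMat (π : Equiv.Perm (Bits N)) (s : J → WStep ι N)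
    (F : J → (ι → Bool) → ι → Bool) (h : ∀ j, (s j).mat π = funMat (F j)) (L : List J) :
    circMat π (L.map s) = funMat fun v => L.foldl (fun v j => F j v) v := by
  induction L with
  | nil => exact funMat_id.symm
  | cons j L ih =>
    rw [List.map_cons, circMat, ih, h, funMat_mul]
    rfl

/-- By `hG` no update depends on the targets of the others, so the sequential updates amount to one
simultaneous update computed from the initial values. -/
theorem circMat_layer {α : Type} (π : Equiv.Perm (Bits N)) (s : J → WStep ι N) (tgt : J → α → ι)
    (hinj : ∀ j j' a a', tgt j a = tgt j' a' → j = j' ∧ a = a') (G : J → (ι → Bool) → α → Bool)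
    (hG : ∀ j (v v' : ι → Bool), (∀ i, (∀ k, k ≠ j → ∀ a, tgt k a ≠ i) → v i = v' i) →
      G j v = G j v')
    (h : ∀ j, (s j).mat π = funMat fun v => Function.extend (tgt j) (G j v) v) :
    circMat π (layer s) = funMat fun v =>
      Function.extend (fun p : J × α => tgt p.1 p.2) (fun p => G p.1 v p.2) v := by
  rw [layer, circMat_map_funMat π s _ h]
  congr 1
  funext v i
  obtain ⟨h1, h2⟩ := foldl_updates tgt hinj G hG Finset.univ.toList (Finset.nodup_toList _) v
  by_cases hi : ∃ p : J × α, tgt p.1 p.2 = i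
  · obtain ⟨p, rfl⟩ := hi
    rw [h1 p.1 (by simp) p.2]
    have hinj' : Function.Injective fun p : J × α => tgt p.1 p.2 := fun p p' h =>
      Prod.ext (hinj _ _ _ _ h).1 (hinj _ _ _ _ h).2
    exact (hinj'.extend_apply (fun p => G p.1 v p.2) v p).symm
  · rw [Function.extend_apply' _ _ _ hi]
    exact h2 i fun j _ a ha => hi ⟨(j, a), ha⟩

/-- The gate CNOT. -/
def cnot {a b : ι} (h : a ≠ b) : WStep ι N := .gate .X b {a} (by simpa using h.symm)

theorem cnot_mat (π : Equiv.Perm (Bits N)) {a b : ι} (h : a ≠ b) :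
    (cnot h : WStep ι N).mat π = funMat fun v =>
      Function.extend (fun _ : Unit => b) (fun _ => xor (v b) (v a)) v := by
  have hinj : Function.Injective fun _ : Unit => b := fun _ _ _ => rfl
  ext u v
  have he : u = Function.extend (fun _ : Unit => b) (fun _ => xor (v b) (v a)) v ↔
      (∀ i, i ≠ b → u i = v i) ∧ u b = xor (v b) (v a) := by
    constructor
    · rintro rfl
      exact ⟨fun i hi => Function.extend_apply' _ _ _ fun ⟨_, hb⟩ => hi hb.symm,
        hinj.extend_apply _ _ ()⟩
    · rintro ⟨h1, h2⟩
      funext i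
      by_cases hi : i = b
      · subst hi; rw [h2]; exact (hinj.extend_apply (fun _ => xor (v i) (v a)) v ()).symm
      · rw [h1 i hi, Function.extend_apply' _ _ _ fun ⟨_, hb⟩ => hi hb.symm]
  simp only [cnot, WStep.mat, funMat, Matrix.of_apply, he, Finset.mem_singleton, forall_eq,
    GateKind.mat]
  by_cases ha : v a = true
  · rw [if_pos ha, ite_eq_ite_ite Iff.rfl]
    congr 1
    rw [ha]
    cases u b <;> cases v b <;> rfl
  · rw [if_neg ha]
    rw [Bool.not_eq_true] at ha
    refine if_congr ?_ rfl rfl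
    rw [ha, Bool.xor_false]
    constructor
    · rintro rfl; simp
    · rintro ⟨h1, h2⟩
      funext i
      by_cases hi : i = b
      · rw [hi, h2]
      · exact h1 i hi

/-- Copy the wires `src j` to the wires `tgt j`. -/
def cnotLayer (src tgt : J → ι) (h : ∀ j j', src j ≠ tgt j') : List (WStep ι N) :=
  layer fun j => cnot (h j j)

theorem circMat_cnotLayer (π : Equiv.Perm (Bits N)) {src tgt : J → ι} (h : ∀ j j', src j ≠ tgt j')
    (ht : Function.Injective tgt) :
    circMat π (cnotLayer src tgt h : List (WStep ι N)) = funMat fun v =>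
      Function.extend tgt (fun j => xor (v (tgt j)) (v (src j))) v := by
  rw [cnotLayer, circMat_layer π _ (fun j (_ : Unit) => tgt j) (fun j j' _ _ hj => ⟨ht hj, rfl⟩)
    (fun j v _ => xor (v (tgt j)) (v (src j))) ?_ fun j => cnot_mat π (h j j)]
  · congr 1
    funext v i
    have hinj : Function.Injective fun p : J × Unit => tgt p.1 := fun p p' hp =>
      Prod.ext (ht hp) rfl
    by_cases hi : ∃ j, tgt j = i
    · obtain ⟨j, rfl⟩ := hi
      rw [ht.extend_apply]
      exact hinj.extend_apply (fun p : J × Unit => xor (v (tgt p.1)) (v (src p.1))) v (j, ())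
    · rw [Function.extend_apply' _ _ _ hi, Function.extend_apply']
      rintro ⟨p, hp⟩
      exact hi ⟨p.1, hp⟩
  · intro j v v' hv
    funext _
    rw [hv (tgt j) fun k hk _ hkj => hk (ht hkj), hv (src j) fun k _ _ hkj => h j k hkj.symm]

/-- Hadamard gates on the wires `c j`. -/
def hadamardLayer (c : J → ι) : List (WStep ι N) := layer fun j => .gate .H (c j) ∅ (by simp)

/-- A Hadamard gate on a zero wire gives the amplitude 1/√2 to both values. The only intermediate
state that contributes takes the final value `u` on the wire just treated. -/
theorem circMat_hadamard_list (π : Equiv.Perm (Bits N)) {c : J → ι} (hc : Function.Injective c)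
    (L : List J) (hL : L.Nodup) (u v : ι → Bool) (hv : ∀ j ∈ L, v (c j) = false) :
    circMat π (L.map fun j => (.gate .H (c j) ∅ (by simp) : WStep ι N)) u v =
      if ∀ i, (∀ j ∈ L, c j ≠ i) → u i = v i then ((Real.sqrt 2 : ℂ)⁻¹) ^ L.length else 0 := by
  induction L generalizing v with
  | nil => simp [circMat, Matrix.one_apply, funext_iff]
  | cons j L ih =>
    obtain ⟨hj, hL⟩ := List.nodup_cons.1 hL
    rw [List.map_cons, circMat, Matrix.mul_apply]
    have hcoef : ∀ x, (WStep.gate .H (c j) ∅ (by simp) : WStep ι N).mat π x v =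
        if ∀ i, i ≠ c j → x i = v i then (Real.sqrt 2 : ℂ)⁻¹ else 0 := by
      intro x
      simp [WStep.mat, GateKind.mat, hv j List.mem_cons_self]
    have hx : ∀ x : ι → Bool, (∀ i, i ≠ c j → x i = v i) → ∀ k ∈ L, x (c k) = false := by
      intro x hx k hk
      rw [hx, hv k (List.mem_cons_of_mem _ hk)]
      intro h
      exact hj (hc h ▸ hk)
    rw [Finset.sum_eq_single (Function.update v (c j) (u (c j)))]
    · have h0 : ∀ i, i ≠ c j → Function.update v (c j) (u (c j)) i = v i := fun i hi =>
        Function.update_of_ne hi _ _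
      rw [ih hL _ (hx _ h0), hcoef, if_pos h0]
      have : (∀ i, (∀ k ∈ L, c k ≠ i) → u i = Function.update v (c j) (u (c j)) i) ↔
          ∀ i, (∀ k ∈ j :: L, c k ≠ i) → u i = v i := by
        constructor
        · intro h i hi
          rw [h i fun k hk => hi k (List.mem_cons_of_mem _ hk), h0 i fun hij =>
            hi j List.mem_cons_self hij.symm]
        · intro h i hi
          by_cases hij : i = c j
          · subst hij; simp
          · rw [h0 i hij]
            refine h i fun k hk => ?_
            rcases List.mem_cons.1 hk with rfl | hk
            · exact fun h => hij h.symm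
            · exact hi k hk
      rw [if_congr this rfl rfl, List.length_cons, pow_succ, ite_mul, zero_mul]
    · intro x _ hne
      rw [hcoef]
      by_cases h0 : ∀ i, i ≠ c j → x i = v i
      · rw [ih hL x (hx x h0), if_neg, zero_mul]
        intro h
        refine hne (funext fun i => ?_)
        by_cases hi : i = c j
        · subst hi
          rw [Function.update_self]
          exact (h (c j) fun k hk hkj => hj (hc hkj ▸ hk)).symm
        · rw [h0 i hi, Function.update_of_ne hi]
      · rw [if_neg h0, mul_zero]
    · simp

theorem circMat_hadamardLayer (π : Equiv.Perm (Bits N)) {c : J → ι} (hc : Function.Injective c)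
    (M : Matrix (ι → Bool) (ι → Bool) ℂ) (u v : ι → Bool) (hv : ∀ j, v (c j) = false) :
    (M * circMat π (hadamardLayer c : List (WStep ι N))) u v =
      ((Real.sqrt 2 : ℂ)⁻¹) ^ Fintype.card J * ∑ r : J → Bool, M u (Function.extend c r v) := by
  rw [Matrix.mul_apply, Finset.mul_sum]
  simp only [hadamardLayer, layer,
    circMat_hadamard_list π hc _ (Finset.nodup_toList _) _ v fun j _ => hv j]
  symm
  refine Fintype.sum_of_injective (fun r : J → Bool => Function.extend c r v)
    (fun r r' h => funext fun j => ?_) _ _ (fun x hx => ?_) (fun r => ?_)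
  · simpa [hc.extend_apply] using congrFun h (c j)
  · rw [if_neg, mul_zero]
    intro h
    refine hx ⟨fun j => x (c j), funext fun i => ?_⟩
    by_cases hi : ∃ j, c j = i
    · obtain ⟨j, rfl⟩ := hi
      exact hc.extend_apply _ _ j
    · rw [h i fun j _ hj => hi ⟨j, hj⟩]
      exact Function.extend_apply' _ _ _ hi
  · rw [if_pos, mul_comm]
    · simp
    · intro i hi
      exact Function.extend_apply' _ _ _ fun ⟨j, hj⟩ => hi j (by simp) hj

/-- A circuit that first tosses coins and then acts classically. -/
theorem implements_coins {E : Type} [DecidableEq E] (π : Equiv.Perm (Bits N)) {c : J → κ}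
    (hc : Function.Injective c) {C : List (WStep (ι ⊕ κ) N)} {P : (ι ⊕ κ → Bool) → ι ⊕ κ → Bool}
    (hC : circMat π C = funMat P) (F : (J → Bool) → (ι → Bool) → (ι → Bool) × E)
    (h1 : ∀ r s, (fun i => P (Sum.elim s (Function.extend c r fun _ => false)) (Sum.inl i)) =
      (F r s).1)
    (h2 : ∀ r r' s s', (∀ k, P (Sum.elim s (Function.extend c r fun _ => false)) (Sum.inr k) =
      P (Sum.elim s' (Function.extend c r' fun _ => false)) (Sum.inr k)) ↔
      r = r' ∧ (F r s).2 = (F r' s').2) :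
    Implements π (hadamardLayer (fun j => Sum.inr (c j)) ++ C) fun ρ =>
      (Fintype.card (J → Bool) : ℂ)⁻¹ • ∑ r, isoChannel (F r) ρ := by
  intro ρ
  ext t t'
  set α : ℂ := ((Real.sqrt 2 : ℂ)⁻¹) ^ Fintype.card J with hα
  -- The squared amplitude is the probability of one coin sequence.
  have hαα : α * star α = (Fintype.card (J → Bool) : ℂ)⁻¹ := by
    have h2 : ((Real.sqrt 2 : ℝ) : ℂ) * ((Real.sqrt 2 : ℝ) : ℂ) = 2 := by
      rw [← Complex.ofReal_mul, Real.mul_self_sqrt (by norm_num)]; norm_num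
    have hst : star ((Real.sqrt 2 : ℂ)⁻¹) = (Real.sqrt 2 : ℂ)⁻¹ := by
      simp
    rw [hα, star_pow, hst, ← mul_pow, ← mul_inv, h2]
    simp
  have hinj : Function.Injective fun j => (Sum.inr (c j) : ι ⊕ κ) := Sum.inr_injective.comp hc
  have hk : ∀ g t s, kraus π (hadamardLayer (fun j => Sum.inr (c j)) ++ C) g t s =
      α * ∑ r : J → Bool, if Sum.elim t g = P (Sum.elim s (Function.extend c r fun _ => false))
        then 1 else 0 := by
    intro g t s
    rw [kraus, Matrix.of_apply, circMat_append, hC, circMat_hadamardLayer π hinj _ _ _ (by simp)]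
    congr 1
    refine Finset.sum_congr rfl fun r _ => ?_
    have : Function.extend (fun j => (Sum.inr (c j) : ι ⊕ κ)) r (Sum.elim s fun _ => false) =
        Sum.elim s (Function.extend c r fun _ => false) := by
      funext i
      rcases i with i | k
      · exact Function.extend_apply' _ _ _ fun ⟨j, hj⟩ => by simp at hj
      · by_cases hk : ∃ j, c j = k
        · obtain ⟨j, rfl⟩ := hk
          rw [Sum.elim_inr, hc.extend_apply]
          exact hinj.extend_apply r _ j
        · rw [Sum.elim_inr, Function.extend_apply' _ _ _ hk, Function.extend_apply']
          · rfl
          · rintro ⟨j, hj⟩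
            exact hk ⟨j, Sum.inr_injective hj⟩
    rw [this]
    rfl
  let G : (J → Bool) × (ι → Bool) → (ι → Bool) × (κ → Bool) := fun p =>
    (fun i => P (Sum.elim p.2 (Function.extend c p.1 fun _ => false)) (Sum.inl i),
      fun k => P (Sum.elim p.2 (Function.extend c p.1 fun _ => false)) (Sum.inr k))
  -- Up to the factor α, the circuit adjoins all coin sequences in superposition (S) and then maps
  -- basis states by G, with the ancillas as environment (the operators V).
  let S : Matrix ((J → Bool) × (ι → Bool)) (ι → Bool) ℂ :=
    Matrix.of fun p s => if p.2 = s then 1 else 0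
  let V : (κ → Bool) → Matrix (ι → Bool) ((J → Bool) × (ι → Bool)) ℂ := fun g =>
    Matrix.of fun t p => if G p = (t, g) then 1 else 0
  have hV : ∀ g, kraus π (hadamardLayer (fun j => Sum.inr (c j)) ++ C) g = α • (V g * S) := by
    intro g
    ext t s
    rw [hk, Matrix.smul_apply, smul_eq_mul, Matrix.mul_apply, Fintype.sum_prod_type]
    congr 1
    refine Finset.sum_congr rfl fun r _ => ?_
    rw [Finset.sum_eq_single s]
    · simp only [V, S, G, Matrix.of_apply, if_true, mul_one]
      refine if_congr ?_ rfl rfl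
      rw [Prod.mk.injEq]
      constructor
      · intro h
        exact ⟨funext fun i => (congrFun h (Sum.inl i)).symm,
          funext fun i => (congrFun h (Sum.inr i)).symm⟩
      · rintro ⟨h, h'⟩
        funext i
        rcases i with i | i
        · exact (congrFun h i).symm
        · exact (congrFun h' i).symm
    · intro s' _ hs'
      simp [S, hs']
    · simp
  have hS : ∀ p p', (S * ρ * Sᴴ) p p' = ρ p.2 p'.2 := by
    intro p p'
    simp [S, Matrix.mul_apply, Matrix.conjTranspose_apply]
  have e1 : ∑ g, kraus π (hadamardLayer (fun j => Sum.inr (c j)) ++ C) g * ρ *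
      (kraus π (hadamardLayer (fun j => Sum.inr (c j)) ++ C) g)ᴴ =
      (Fintype.card (J → Bool) : ℂ)⁻¹ • isoChannel G (S * ρ * Sᴴ) := by
    rw [isoChannel_eq_sum, Finset.smul_sum, ← hαα]
    refine Finset.sum_congr rfl fun g _ => ?_
    rw [hV, Matrix.conjTranspose_smul, Matrix.conjTranspose_mul, Matrix.smul_mul, Matrix.smul_mul,
      Matrix.mul_smul, smul_smul]
    simp only [V, Matrix.mul_assoc]
  -- By `h2` the final ancillas carry exactly the coins and the environment of `F`. The coins are
  -- therefore discarded, and only pairs with equal coins survive.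
  have e2 : isoChannel G (S * ρ * Sᴴ) =
      isoChannel (fun p : (J → Bool) × (ι → Bool) => ((F p.1 p.2).1, (p.1, (F p.1 p.2).2)))
        (S * ρ * Sᴴ) := by
    apply isoChannel_congr
    · intro p; exact h1 p.1 p.2
    · intro p p'
      rw [Prod.mk.injEq, ← h2 p.1 p'.1 p.2 p'.2, funext_iff]
  rw [e1, e2]
  simp only [Matrix.smul_apply, Matrix.sum_apply, isoChannel, Matrix.of_apply, hS,
    Fintype.sum_prod_type, Prod.mk.injEq]
  congr 1
  refine Finset.sum_congr rfl fun r _ => Finset.sum_congr rfl fun s _ => ?_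
  rw [Finset.sum_eq_single r]
  · simp
  · intro r' _ hr'
    exact Finset.sum_eq_zero fun s' _ => if_neg fun h => hr' h.2.2.1.symm
  · simp

end Layers

/-! ### Circuits for encryption queries -/

section Encryption

variable {ι : Type} [Fintype ι] [DecidableEq ι] {m τ μ : ℕ} {Q : Set QueryType}

theorem coinAverage_curry {w : ℕ} (φ : (Fin μ → Bits τ) → QState w) :
    coinAverage φ = (Fintype.card (Fin μ × Fin τ → Bool) : ℂ)⁻¹ •
      ∑ r : Fin μ × Fin τ → Bool, φ fun k i => r (k, i) := by
  rw [coinAverage, Fintype.card_congr (Equiv.curry (Fin μ) (Fin τ) Bool)]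
  congr 1
  exact (Fintype.sum_equiv (Equiv.curry (Fin μ) (Fin τ) Bool) _ _ fun r => rfl).symm

theorem extend_comp_equiv {α β : Type} (e : α ≃ β) (t : β → ι) (ht : Function.Injective t)
    (g : β → Bool) (v : ι → Bool) :
    Function.extend (fun a => t (e a)) (fun a => g (e a)) v = Function.extend t g v := by
  funext i
  by_cases hi : ∃ b, t b = i
  · obtain ⟨b, rfl⟩ := hi
    obtain ⟨a, rfl⟩ := e.surjective b
    rw [ht.extend_apply]
    exact (ht.comp e.injective).extend_apply (fun a => g (e a)) v a
  · rw [Function.extend_apply' _ _ _ hi, Function.extend_apply']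
    rintro ⟨a, ha⟩
    exact hi ⟨_, ha⟩

theorem extend_id_left {α : Type} (r g : α → Bool) : Function.extend id r g = r :=
  funext fun a => Function.injective_id.extend_apply r g a

/-- The action of type-(1) evaluation on basis states. -/
def oneFun {a l : ℕ} (f : Bits a → Bits l) (e : Fin a ⊕ Fin l ↪ ι) (s : ι → Bool) :
    (ι → Bool) × (ι → Bool) :=
  (Function.extend (fun j : Fin l => e (Sum.inr j))
    (fun j => xor (s (e (Sum.inr j))) (f (fun i => s (e (Sum.inl i))) j)) s, fun _ => false)

/-- The action of type-(2) evaluation on basis states, with the environment. -/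
def twoFun {a l : ℕ} (f : Bits a → Bits l) (inp : Fin a ↪ ι) (drop : Finset ι)
    (out : Fin l ↪ ι) (s : ι → Bool) : (ι → Bool) × (ι → Bool) :=
  (Function.extend out (f (fun i => s (inp i)))
    (fun i => if i ∈ drop ∨ (∃ j, inp j = i) then false else s i),
    fun i => if (i ∈ drop ∨ ∃ j, out j = i) ∧ ¬ (∃ j, inp j = i) then s i else false)

/-- The average over the coins of an operation on basis states. -/
def avgChannel (F : (Fin μ → Bits τ) → (ι → Bool) → (ι → Bool) × (ι → Bool))
    (ρ : Matrix (ι → Bool) (ι → Bool) ℂ) : Matrix (ι → Bool) (ι → Bool) ℂ :=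
  (Fintype.card (Fin μ × Fin τ → Bool) : ℂ)⁻¹ •
    ∑ r : Fin μ × Fin τ → Bool, isoChannel (F fun k i => r (k, i)) ρ

/-- The input of the permutation in block `k`, with the coins on the wires `inr (k, i)`. -/
def blockInput (x : Fin (μ * m) → ι) (k : Fin μ) : Fin (m + τ) → ι ⊕ (Fin μ × Fin τ) :=
  Fin.addCases (fun i => Sum.inl (x (finProdFinEquiv (k, i)))) fun i => Sum.inr (k, i)

theorem blockInput_injective {x : Fin (μ * m) → ι} (hx : Function.Injective x) (k : Fin μ) :
    Function.Injective (blockInput (τ := τ) x k) := by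
  intro j j' h
  induction j using Fin.addCases with
  | left i =>
    induction j' using Fin.addCases with
    | left i' =>
      simp only [blockInput, Fin.addCases_left, Sum.inl.injEq, hx.eq_iff,
        finProdFinEquiv.injective.eq_iff, Prod.mk.injEq, true_and] at h
      rw [h]
    | right i' => simp [blockInput] at h
  | right i =>
    induction j' using Fin.addCases with
    | left i' => simp [blockInput] at h
    | right i' =>
      simp only [blockInput, Fin.addCases_right, Sum.inr.injEq, Prod.mk.injEq, true_and] at h
      rw [h]

theorem blockInput_apply (x : Fin (μ * m) → ι) (k : Fin μ) (s : ι → Bool)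
    (r : Fin μ × Fin τ → Bool) :
    (fun j => Sum.elim s r (blockInput x k j)) =
      Fin.append (block (fun i => s (x i)) k) fun i => r (k, i) := by
  funext j
  induction j using Fin.addCases with
  | left i => simp [blockInput, block]
  | right i => simp [blockInput]

/-- The query for block `k` in a type-(1) encryption. -/
def blockQuery₁ (e : Fin (μ * m) ⊕ Fin (μ * (m + τ)) ↪ ι) (k : Fin μ) :
    Fin (m + τ) ⊕ Fin (m + τ) ↪ ι ⊕ (Fin μ × Fin τ) where
  toFun := Sum.elim (blockInput (fun i => e (Sum.inl i)) k)
    fun j => Sum.inl (e (Sum.inr (finProdFinEquiv (k, j))))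
  inj' := by
    have h1 : Function.Injective fun i => e (Sum.inl i) := e.injective.comp Sum.inl_injective
    have h2 : ∀ (j : Fin (m + τ)) (j' : Fin (m + τ)), blockInput (fun i => e (Sum.inl i)) k j ≠
        Sum.inl (e (Sum.inr (finProdFinEquiv (k, j')))) := by
      intro j j'
      induction j using Fin.addCases with
      | left i => simp [blockInput]
      | right i => simp [blockInput]
    refine (blockInput_injective h1 k).sumElim (fun j j' h => ?_) h2
    simpa using h

/-- Each block needs one type-(1) query that reads the plaintext block and its coin ancillas and
XORs into the target block. No query writes to a wire read by another, so the μ queries form a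
layer, and the coins are the only ancillas. -/
theorem simulable_oneFun (hQ : QueryType.one ∈ Q)
    (e : Fin (μ * m) ⊕ Fin (μ * (m + τ)) ↪ ι) :
    Simulable Q (fun π => avgChannel fun r => oneFun (ecbEnc π r) e) (μ * τ) (μ * τ + μ) := by
  let C : List (WStep (ι ⊕ (Fin μ × Fin τ)) (m + τ)) := layer fun k => .query₁ (blockQuery₁ e k)
  refine ⟨Fin μ × Fin τ, inferInstance, inferInstance,
    hadamardLayer (fun j => Sum.inr (id j)) ++ C, by simp, ?_, ?_, fun π => ?_⟩
  · simp [hadamardLayer, C, length_layer]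
  · intro s hs
    simp only [hadamardLayer, C, List.mem_append, mem_layer] at hs
    rcases hs with ⟨j, rfl⟩ | ⟨k, rfl⟩
    · trivial
    · exact hQ
  let tgt : Fin μ → Fin (m + τ) → ι ⊕ (Fin μ × Fin τ) := fun k j =>
    Sum.inl (e (Sum.inr (finProdFinEquiv (k, j))))
  have htgt : ∀ j j' a a', tgt j a = tgt j' a' → j = j' ∧ a = a' := by
    intro j j' a a' h
    simpa [tgt] using h
  have hC : circMat π C = _ := circMat_layer π _ tgt htgt
    (fun k v j => xor (v (tgt k j)) (π (fun i => v (blockInput (fun i => e (Sum.inl i)) k i)) j))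
    (fun k v v' hv => by
      funext j
      have h1 : v (tgt k j) = v' (tgt k j) := hv _ fun k' hk' a ha => hk' (htgt _ _ _ _ ha).1
      have h2 : (fun i => v (blockInput (fun i => e (Sum.inl i)) k i)) =
          fun i => v' (blockInput (fun i => e (Sum.inl i)) k i) := by
        funext i
        refine hv _ fun k' _ a => ?_
        induction i using Fin.addCases with
        | left i => simp [blockInput, tgt]
        | right i => simp [blockInput, tgt]
      rw [h1, h2])
    fun k => rfl
  have hmain : ∀ (s : ι → Bool) (r : Fin μ × Fin τ → Bool), Function.extend
      (fun p : Fin μ × Fin (m + τ) => tgt p.1 p.2) (fun p => xor (Sum.elim s r (tgt p.1 p.2))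
        (π (fun i => Sum.elim s r (blockInput (fun i => e (Sum.inl i)) p.1 i)) p.2))
      (Sum.elim s r) = Sum.elim (oneFun (ecbEnc π fun k i => r (k, i)) e s).1 r := by
    intro s r
    have hi : Function.Injective fun j : Fin (μ * (m + τ)) => e (Sum.inr j) :=
      e.injective.comp Sum.inr_injective
    have ho : (oneFun (ecbEnc π fun k i => r (k, i)) e s).1 = Function.extend
        (fun p => e (Sum.inr (finProdFinEquiv p))) (fun p => xor (s (e (Sum.inr (finProdFinEquiv p))))
          (ecbEnc π (fun k i => r (k, i)) (fun i => s (e (Sum.inl i))) (finProdFinEquiv p))) s :=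
      (extend_comp_equiv finProdFinEquiv _ hi (fun j => xor (s (e (Sum.inr j)))
        (ecbEnc π (fun k i => r (k, i)) (fun i => s (e (Sum.inl i))) j)) s).symm
    rw [ho]
    funext i
    have hinj : Function.Injective fun p : Fin μ × Fin (m + τ) => tgt p.1 p.2 := fun p p' h =>
      Prod.ext (htgt _ _ _ _ h).1 (htgt _ _ _ _ h).2
    have hinj' : Function.Injective fun p : Fin μ × Fin (m + τ) =>
      e (Sum.inr (finProdFinEquiv p)) := hi.comp finProdFinEquiv.injective
    rcases i with i | i
    · by_cases hp : ∃ p, e (Sum.inr (finProdFinEquiv p)) = i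
      · obtain ⟨p, rfl⟩ := hp
        refine (hinj.extend_apply _ _ p).trans ?_
        rw [Sum.elim_inl, Sum.elim_inl]
        rw [hinj'.extend_apply (fun p => xor (s (e (Sum.inr (finProdFinEquiv p))))
          (ecbEnc π (fun k i => r (k, i)) (fun i => s (e (Sum.inl i))) (finProdFinEquiv p))) s p]
        rw [blockInput_apply]
        simp [ecbEnc, unblock]
      · rw [Sum.elim_inl, Function.extend_apply' _ _ _ hp, Function.extend_apply']
        · rfl
        · rintro ⟨p, h⟩
          exact hp ⟨p, Sum.inl_injective h⟩
    · rw [Function.extend_apply']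
      · rfl
      · rintro ⟨p, h⟩
        simp [tgt] at h
  refine implements_coins π Function.injective_id hC
    (fun r => oneFun (ecbEnc π fun k i => r (k, i)) e) ?_ ?_
  · intro r s
    simp only [extend_id_left, hmain, Sum.elim_inl]
  · intro r r' s s'
    simp only [extend_id_left, hmain, Sum.elim_inr, oneFun, and_true, funext_iff]

/-! ### Circuits for type-(2) encryption -/

section Two

/-- Contents of the main wires, the coins, the input of the permutations and the discarded wires. -/
def encState (s : ι → Bool) (r : Fin μ × Fin τ → Bool) (v : Fin μ × Fin (m + τ) → Bool)
    (d : ι → Bool) : ι ⊕ ((Fin μ × Fin τ) ⊕ ((Fin μ × Fin (m + τ)) ⊕ ι)) → Bool :=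
  Sum.elim s (Sum.elim r (Sum.elim v d))

variable {s : ι → Bool} {r : Fin μ × Fin τ → Bool} {v : Fin μ × Fin (m + τ) → Bool} {d : ι → Bool}

theorem extend_main {J : Type} {t : J → ι} (ht : Function.Injective t) (g : J → Bool) :
    Function.extend (fun j => Sum.inl (t j)) g (encState s r v d) =
      encState (Function.extend t g s) r v d := by
  funext i
  by_cases hi : ∃ j, Sum.inl (t j) = i
  · obtain ⟨j, rfl⟩ := hi
    have h : Function.Injective fun j => (Sum.inl (t j) :
      ι ⊕ ((Fin μ × Fin τ) ⊕ ((Fin μ × Fin (m + τ)) ⊕ ι))) := Sum.inl_injective.comp ht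
    exact (h.extend_apply g _ j).trans (ht.extend_apply g s j).symm
  · rw [Function.extend_apply' _ _ _ hi]
    rcases i with i | i
    · have hi' : ¬ ∃ j, t j = i := fun ⟨j, hj⟩ => hi ⟨j, by rw [hj]⟩
      exact (Function.extend_apply' g s _ hi').symm
    · rfl

theorem extend_input (g : Fin μ × Fin (m + τ) → Bool) :
    Function.extend (fun p => Sum.inr (Sum.inr (Sum.inl p))) g (encState s r v d) =
      encState s r g d := by
  have h : Function.Injective fun p => (Sum.inr (Sum.inr (Sum.inl p)) :
      ι ⊕ ((Fin μ × Fin τ) ⊕ ((Fin μ × Fin (m + τ)) ⊕ ι))) := fun p p' hp => by simpa using hp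
  funext i
  rcases i with i | i | i | i
  · exact Function.extend_apply' _ _ _ fun ⟨j, hj⟩ => by simp at hj
  · exact Function.extend_apply' _ _ _ fun ⟨j, hj⟩ => by simp at hj
  · exact h.extend_apply g _ i
  · exact Function.extend_apply' _ _ _ fun ⟨j, hj⟩ => by simp at hj

theorem extend_discard {J : Type} {t : J → ι} (ht : Function.Injective t) (g : J → Bool) :
    Function.extend (fun j => Sum.inr (Sum.inr (Sum.inr (t j)))) g (encState s r v d) =
      encState s r v (Function.extend t g d) := by
  have h : Function.Injective fun j => (Sum.inr (Sum.inr (Sum.inr (t j))) :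
      ι ⊕ ((Fin μ × Fin τ) ⊕ ((Fin μ × Fin (m + τ)) ⊕ ι))) := fun p p' hp => ht (by simpa using hp)
  funext i
  rcases i with i | i | i | i
  · exact Function.extend_apply' _ _ _ fun ⟨j, hj⟩ => by simp at hj
  · exact Function.extend_apply' _ _ _ fun ⟨j, hj⟩ => by simp at hj
  · exact Function.extend_apply' _ _ _ fun ⟨j, hj⟩ => by simp at hj
  · by_cases hi : ∃ j, t j = i
    · obtain ⟨j, rfl⟩ := hi
      exact (h.extend_apply g _ j).trans (ht.extend_apply g d j).symm
    · rw [Function.extend_apply']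
      · exact (Function.extend_apply' _ _ _ hi).symm
      · rintro ⟨j, hj⟩
        exact hi ⟨j, by simpa using hj⟩

variable (inp : Fin (μ * m) ↪ ι) (drop : Finset ι) (out : Fin (μ * (m + τ)) ↪ ι)

/-- The action of a layer of CNOT gates on basis states. -/
def xorFun {κ J : Type} (src tgt : J → κ) (v : κ → Bool) : κ → Bool :=
  Function.extend tgt (fun j => xor (v (tgt j)) (v (src j))) v

theorem circMat_cnotLayer_eq {κ J : Type} [Fintype κ] [DecidableEq κ] [Fintype J]
    [DecidableEq J] {N : ℕ}
    (π : Equiv.Perm (Bits N)) {src tgt : J → κ} (h : ∀ j j', src j ≠ tgt j')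
    (ht : Function.Injective tgt) : circMat π (cnotLayer src tgt h) = funMat (xorFun src tgt) :=
  circMat_cnotLayer π h ht

/-- The action of the permutation queries on basis states. -/
def permFun (π : Equiv.Perm (Bits (m + τ)))
    (v : ι ⊕ ((Fin μ × Fin τ) ⊕ ((Fin μ × Fin (m + τ)) ⊕ ι)) → Bool) :
    ι ⊕ ((Fin μ × Fin τ) ⊕ ((Fin μ × Fin (m + τ)) ⊕ ι)) → Bool :=
  Function.extend (fun p => Sum.inr (Sum.inr (Sum.inl p)))
    (fun p => π (fun j => v (Sum.inr (Sum.inr (Sum.inl (p.1, j))))) p.2) v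

/-- The query for block `k` in a type-(2) encryption. -/
def blockQuery₂ (k : Fin μ) :
    Fin (m + τ) ↪ ι ⊕ ((Fin μ × Fin τ) ⊕ ((Fin μ × Fin (m + τ)) ⊕ ι)) where
  toFun j := Sum.inr (Sum.inr (Sum.inl (k, j)))
  inj' j j' h := by simpa using h

/-- The classical part of the circuit for type-(2) encryption. -/
def twoCirc : List (WStep (ι ⊕ ((Fin μ × Fin τ) ⊕ ((Fin μ × Fin (m + τ)) ⊕ ι))) (m + τ)) :=
  cnotLayer (fun p : Fin μ × Fin (m + τ) => (Sum.map id Sum.inl (blockInput inp p.1 p.2) :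
      ι ⊕ ((Fin μ × Fin τ) ⊕ ((Fin μ × Fin (m + τ)) ⊕ ι))))
    (fun p => Sum.inr (Sum.inr (Sum.inl p)))
    (fun p p' => by cases blockInput inp p.1 p.2 <;> simp) ++
  (cnotLayer (fun p : Fin μ × Fin m => Sum.inr (Sum.inr (Sum.inl (p.1, Fin.castAdd τ p.2))))
    (fun p => Sum.inl (inp (finProdFinEquiv p))) (by simp) ++
  (cnotLayer (fun i : {i // i ∈ drop ∨ ∃ j, out j = i} => Sum.inl i.1)
    (fun i => Sum.inr (Sum.inr (Sum.inr i.1))) (by simp) ++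
  (cnotLayer (fun i : {i // i ∈ drop ∨ ∃ j, out j = i} => Sum.inr (Sum.inr (Sum.inr i.1)))
    (fun i => Sum.inl i.1) (by simp) ++
  (layer (fun k : Fin μ => .query₂ (blockQuery₂ k)) ++
  (cnotLayer (fun p : Fin μ × Fin (m + τ) => Sum.inr (Sum.inr (Sum.inl p)))
    (fun p => Sum.inl (out (finProdFinEquiv p))) (by simp) ++
  cnotLayer (fun p : Fin μ × Fin (m + τ) => Sum.inl (out (finProdFinEquiv p)))
    (fun p => Sum.inr (Sum.inr (Sum.inl p))) (by simp))))))

theorem length_twoCirc : (twoCirc inp drop out).length ≤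
    μ * (m + τ) + μ * m + 2 * Fintype.card ι + μ + 2 * (μ * (m + τ)) := by
  have h : Fintype.card {i // i ∈ drop ∨ ∃ j, out j = i} ≤ Fintype.card ι :=
    Fintype.card_subtype_le _
  simp only [twoCirc, cnotLayer, List.length_append, length_layer, Fintype.card_prod,
    Fintype.card_fin]
  omega

theorem twoCirc_allowed (hQ : QueryType.two ∈ Q) : ∀ s ∈ twoCirc inp drop out, s.Allowed Q := by
  intro s hs
  simp only [twoCirc, cnotLayer, List.mem_append, mem_layer] at hs
  rcases hs with ⟨j, rfl⟩ | ⟨j, rfl⟩ | ⟨j, rfl⟩ | ⟨j, rfl⟩ | ⟨j, rfl⟩ | ⟨j, rfl⟩ | ⟨j, rfl⟩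
  · trivial
  · trivial
  · trivial
  · trivial
  · exact hQ
  · trivial
  · trivial

/-- The circuit moves inputs and discarded contents to ancillas, permutes in place, and copies the
result out. In the end only the coins and the discarded wires are left in the ancillas, which is the
environment of the operation to be simulated. -/
theorem circMat_twoCirc (π : Equiv.Perm (Bits (m + τ))) :
    ∃ P, circMat π (twoCirc inp drop out) = funMat P ∧ ∀ (s : ι → Bool) (r : Fin μ × Fin τ → Bool),
      P (encState s r (fun _ => false) fun _ => false) =
        encState (twoFun (ecbEnc π fun k i => r (k, i)) inp drop out s).1 r (fun _ => false)
          (twoFun (ecbEnc π fun k i => r (k, i)) inp drop out s).2 := by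
  have hin : Function.Injective fun p : Fin μ × Fin m => inp (finProdFinEquiv p) :=
    inp.injective.comp finProdFinEquiv.injective
  have hout : Function.Injective fun p : Fin μ × Fin (m + τ) => out (finProdFinEquiv p) :=
    out.injective.comp finProdFinEquiv.injective
  have hin' : Function.Injective fun p : Fin μ × Fin m => (Sum.inl (inp (finProdFinEquiv p)) :
      ι ⊕ ((Fin μ × Fin τ) ⊕ ((Fin μ × Fin (m + τ)) ⊕ ι))) := Sum.inl_injective.comp hin
  have hout' : Function.Injective fun p : Fin μ × Fin (m + τ) =>
      (Sum.inl (out (finProdFinEquiv p)) : ι ⊕ ((Fin μ × Fin τ) ⊕ ((Fin μ × Fin (m + τ)) ⊕ ι))) :=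
    Sum.inl_injective.comp hout
  have hv : Function.Injective fun p => (Sum.inr (Sum.inr (Sum.inl p)) :
      ι ⊕ ((Fin μ × Fin τ) ⊕ ((Fin μ × Fin (m + τ)) ⊕ ι))) := fun p p' hp => by simpa using hp
  have hd : Function.Injective fun i : {i // i ∈ drop ∨ ∃ j, out j = i} =>
      (Sum.inr (Sum.inr (Sum.inr i.1)) : ι ⊕ ((Fin μ × Fin τ) ⊕ ((Fin μ × Fin (m + τ)) ⊕ ι))) :=
    fun p p' hp => Subtype.ext (by simpa using hp)
  have hm : Function.Injective fun i : {i // i ∈ drop ∨ ∃ j, out j = i} =>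
      (Sum.inl i.1 : ι ⊕ ((Fin μ × Fin τ) ⊕ ((Fin μ × Fin (m + τ)) ⊕ ι))) :=
    fun p p' hp => Subtype.ext (by simpa using hp)
  have hq : circMat π (layer fun k : Fin μ => .query₂ (blockQuery₂ k)) =
      funMat (permFun (ι := ι) (m := m) (τ := τ) π) := circMat_layer π (fun k : Fin μ => (.query₂ (blockQuery₂ k) :
        WStep (ι ⊕ ((Fin μ × Fin τ) ⊕ ((Fin μ × Fin (m + τ)) ⊕ ι))) (m + τ)))
    (fun k j => Sum.inr (Sum.inr (Sum.inl (k, j)))) (fun j j' a a' h => by simpa using h)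
    (fun k v => π fun j => v (Sum.inr (Sum.inr (Sum.inl (k, j)))))
    (fun k v v' h => by
      congr 1
      funext j
      exact h _ fun k' hk' a ha => hk' (by simpa using congrArg id ha : k' = k ∧ a = j).1)
    fun k => rfl
  -- The right side of this trivial equation is rewritten into the form `funMat P`, from which the
  -- witness `P` is taken.
  have e : circMat π (twoCirc inp drop out) = circMat π (twoCirc inp drop out) := rfl
  conv_rhs at e =>
    rw [twoCirc, circMat_append, circMat_append, circMat_append, circMat_append, circMat_append,
      circMat_append, circMat_cnotLayer_eq π _ hv, circMat_cnotLayer_eq π _ hin',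
      circMat_cnotLayer_eq π _ hd, circMat_cnotLayer_eq π _ hm, hq,
      circMat_cnotLayer_eq π _ hout', circMat_cnotLayer_eq π _ hv,
      funMat_mul, funMat_mul, funMat_mul, funMat_mul, funMat_mul, funMat_mul]
  refine ⟨_, e, fun s r => ?_⟩
  -- `y` and `z` are the block inputs and outputs of π, and `d` holds the discarded contents. `s1`,
  -- `s2` and `s3` are the main wires after clearing the input, clearing the handed-over wires, and
  -- writing the ciphertext.
  let y : Fin μ × Fin (m + τ) → Bool := fun p => Sum.elim s r (blockInput inp p.1 p.2)
  let z : Fin μ × Fin (m + τ) → Bool := fun p => π (fun j => y (p.1, j)) p.2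
  let s1 : ι → Bool := fun i => if ∃ j, inp j = i then false else s i
  let d : ι → Bool := fun i => if i ∈ drop ∨ ∃ j, out j = i then s1 i else false
  let s2 : ι → Bool := fun i => if i ∈ drop ∨ ∃ j, out j = i then false else s1 i
  let s3 : ι → Bool := Function.extend (fun p => out (finProdFinEquiv p)) z s2
  simp only [Function.comp_apply]
  have l1 : xorFun (fun p : Fin μ × Fin (m + τ) => (Sum.map id Sum.inl (blockInput inp p.1 p.2) :
      ι ⊕ ((Fin μ × Fin τ) ⊕ ((Fin μ × Fin (m + τ)) ⊕ ι))))
      (fun p => Sum.inr (Sum.inr (Sum.inl p))) (encState s r (fun _ => false) fun _ => false) =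
      encState s r y fun _ => false := by
    rw [xorFun, extend_input]
    congr 1
    funext p
    simp only [encState, Sum.elim_inr, Sum.elim_inl, Bool.false_xor, y]
    cases blockInput inp p.1 p.2 <;> simp
  -- The plaintext wires are XORed with their own copy and become zero.
  have l2 : xorFun (fun p : Fin μ × Fin m => Sum.inr (Sum.inr (Sum.inl (p.1, Fin.castAdd τ p.2))))
      (fun p => Sum.inl (inp (finProdFinEquiv p))) (encState s r y fun _ => false) =
      encState s1 r y fun _ => false := by
    rw [xorFun, extend_main hin]
    congr 1
    funext i
    by_cases hi : ∃ p, inp (finProdFinEquiv p) = i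
    · obtain ⟨p, rfl⟩ := hi
      rw [hin.extend_apply _ _ p]
      simp [encState, y, s1, blockInput]
    · have hi' : ¬ ∃ j, inp j = i := fun ⟨j, hj⟩ =>
        hi ⟨finProdFinEquiv.symm j, by rw [Equiv.apply_symm_apply, hj]⟩
      rw [Function.extend_apply' _ _ _ hi]
      simp only [s1, if_neg hi']
  have l3 : xorFun (fun i : {i // i ∈ drop ∨ ∃ j, out j = i} => Sum.inl i.1)
      (fun i => Sum.inr (Sum.inr (Sum.inr i.1))) (encState s1 r y fun _ => false) =
      encState s1 r y d := by
    rw [xorFun, extend_discard Subtype.val_injective]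
    congr 1
    funext i
    by_cases hi : i ∈ drop ∨ ∃ j, out j = i
    · refine (Subtype.val_injective.extend_apply _ _ ⟨i, hi⟩).trans ?_
      simp only [encState, Sum.elim_inr, Sum.elim_inl, Bool.false_xor, d, if_pos hi]
    · rw [Function.extend_apply' _ _ _ fun ⟨j, hj⟩ => hi (hj ▸ j.2)]
      simp only [d, if_neg hi]
  have l4 : xorFun (fun i : {i // i ∈ drop ∨ ∃ j, out j = i} => Sum.inr (Sum.inr (Sum.inr i.1)))
      (fun i => Sum.inl i.1) (encState s1 r y d) = encState s2 r y d := by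
    rw [xorFun, extend_main Subtype.val_injective]
    congr 1
    funext i
    by_cases hi : i ∈ drop ∨ ∃ j, out j = i
    · refine (Subtype.val_injective.extend_apply _ _ ⟨i, hi⟩).trans ?_
      simp only [encState, Sum.elim_inr, Sum.elim_inl, s2, d, if_pos hi, Bool.xor_self]
    · rw [Function.extend_apply' _ _ _ fun ⟨j, hj⟩ => hi (hj ▸ j.2)]
      simp only [s2, if_neg hi]
  have l5 : permFun π (encState s2 r y d) = encState s2 r z d := by
    rw [permFun, extend_input]
    rfl
  have l6 : xorFun (fun p : Fin μ × Fin (m + τ) => Sum.inr (Sum.inr (Sum.inl p)))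
      (fun p => Sum.inl (out (finProdFinEquiv p))) (encState s2 r z d) = encState s3 r z d := by
    rw [xorFun, extend_main hout]
    congr 2
    funext p
    simp [encState, s2]
  -- The ancilla copy of the ciphertext is uncomputed from the output wires; left in place, it would
  -- act as a measurement of the ciphertext.
  have l7 : xorFun (fun p : Fin μ × Fin (m + τ) => Sum.inl (out (finProdFinEquiv p)))
      (fun p => Sum.inr (Sum.inr (Sum.inl p))) (encState s3 r z d) =
      encState s3 r (fun _ => false) d := by
    rw [xorFun, extend_input]
    congr 1
    funext p
    have h : s3 (out (finProdFinEquiv p)) = z p := hout.extend_apply z s2 p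
    simp only [encState, Sum.elim_inr, Sum.elim_inl, h, Bool.xor_self]
  rw [l1, l2, l3, l4, l5, l6, l7]
  congr 1
  · have hz : z = fun p => ecbEnc π (fun k i => r (k, i)) (fun i => s (inp i))
        (finProdFinEquiv p) := by
      funext p
      simp [z, y, ecbEnc, unblock, blockInput_apply]
    simp only [s3, hz]
    rw [extend_comp_equiv finProdFinEquiv out out.injective
      (ecbEnc π (fun k i => r (k, i)) fun i => s (inp i)) s2]
    funext i
    by_cases hi : ∃ j, out j = i
    · obtain ⟨j, rfl⟩ := hi
      simp only [twoFun, out.injective.extend_apply]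
    · simp only [twoFun, Function.extend_apply' _ _ _ hi, s2, s1, hi, or_false]
      split_ifs <;> simp_all
  · funext i
    simp only [twoFun, d, s1]
    split_ifs <;> simp_all

theorem simulable_twoFun (hQ : QueryType.two ∈ Q) :
    Simulable Q (fun π => avgChannel fun r => twoFun (ecbEnc π r) inp drop out)
      (μ * τ + (μ * (m + τ) + Fintype.card ι))
      (μ * τ + (μ * (m + τ) + μ * m + 2 * Fintype.card ι + μ + 2 * (μ * (m + τ)))) := by
  refine ⟨(Fin μ × Fin τ) ⊕ ((Fin μ × Fin (m + τ)) ⊕ ι), inferInstance, inferInstance,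
    hadamardLayer (fun j => Sum.inr (Sum.inl j)) ++ twoCirc inp drop out, by simp, ?_, ?_,
    fun π => ?_⟩
  · rw [List.length_append]
    refine Nat.add_le_add ?_ (length_twoCirc inp drop out)
    simp [hadamardLayer, length_layer]
  · intro s hs
    simp only [hadamardLayer, List.mem_append, mem_layer] at hs
    rcases hs with ⟨j, rfl⟩ | hs
    · trivial
    · exact twoCirc_allowed inp drop out hQ s hs
  obtain ⟨P, hP, h⟩ := circMat_twoCirc inp drop out π
  have hinit : ∀ (s : ι → Bool) (r : Fin μ × Fin τ → Bool),
      Sum.elim s (Function.extend Sum.inl r fun _ => false) =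
        encState (m := m) s r (fun _ => false) fun _ => false := by
    intro s r
    have h' : Function.extend (Sum.inl : Fin μ × Fin τ → (Fin μ × Fin τ) ⊕
        ((Fin μ × Fin (m + τ)) ⊕ ι)) r (fun _ => false) =
        Sum.elim r (Sum.elim (fun _ => false) fun _ => false) := by
      funext i
      rcases i with i | i | i
      · exact Sum.inl_injective.extend_apply r _ i
      · exact Function.extend_apply' _ _ _ fun ⟨j, hj⟩ => by simp at hj
      · exact Function.extend_apply' _ _ _ fun ⟨j, hj⟩ => by simp at hj
    rw [h', encState]
  refine implements_coins π Sum.inl_injective hP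
    (fun r => twoFun (ecbEnc π fun k i => r (k, i)) inp drop out) ?_ ?_
  · intro r s
    rw [hinit, h]
    rfl
  · intro r r' s s'
    rw [hinit, hinit, h, h]
    constructor
    · intro e
      refine ⟨funext fun j => ?_, funext fun i => ?_⟩
      · exact e (Sum.inl j)
      · exact e (Sum.inr (Sum.inr i))
    · rintro ⟨rfl, e⟩ k
      rw [e]
      rfl

end Two

end Encryption

/-! ### Simulation of the games by oracle circuits -/

section Games

variable {w m τ μ : ℕ} {Q : Set QueryType}

/-- A bound for the cost of one encryption query on `w` qubits. -/
def encCost (m τ μ w : ℕ) : ℕ := μ * τ + (μ * (m + τ) + μ * m + 2 * w + μ + 2 * (μ * (m + τ))) + 1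

theorem simulable_typeTwo (hQ : QueryType.two ∈ Q) (inp : Fin (μ * m) ↪ Fin w)
    (drop : Finset (Fin w)) (out : Fin (μ * (m + τ)) ↪ Fin w) :
    Simulable Q (fun π ρ => coinAverage fun r => typeTwo (ecbEnc π r) inp drop out ρ)
      (encCost m τ μ w) (encCost m τ μ w) := by
  have h := simulable_twoFun (Q := Q) inp drop out hQ
  have e : (fun π => avgChannel fun r => twoFun (ecbEnc π r) inp drop out) =
      fun π ρ => coinAverage fun r => typeTwo (ecbEnc π r) inp drop out ρ := by
    funext π ρ
    rw [coinAverage_curry]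
    rfl
  rw [e] at h
  refine h.mono ?_ ?_ <;> simp only [encCost, Fintype.card_fin] <;> omega

theorem simulable_step (hQ : QueryType.two ∈ Q) (s : Step w (μ * m) (μ * (m + τ)))
    (hs : s.Allowed Q) :
    Simulable Q (fun π => s.run (ecbEnc π)) (encCost m τ μ w) (encCost m τ μ w) := by
  cases s with
  | gate g =>
    refine (Simulable.of_circ [.gate g.kind g.target g.controls g.target_notMem] ?_
      fun π ρ => ?_).mono (Nat.zero_le _) ?_
    · simp [WStep.Allowed]
    · have : g.mat = circMat π [.gate g.kind g.target g.controls g.target_notMem] := by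
        rw [circMat, circMat, one_mul]
        ext u v
        simp only [Gate.mat, WStep.mat, Matrix.of_apply]
        split_ifs <;> rfl
      rw [← this]
      rfl
    · simp [encCost]
  | query₁ e =>
    have h := simulable_oneFun (Q := Q) hs e
    have e : (fun π => avgChannel fun r => oneFun (ecbEnc π r) e) =
        fun π => (Step.query₁ e).run (ecbEnc π) := by
      funext π ρ
      rw [Step.run, coinAverage_curry]
      rfl
    rw [e] at h
    refine h.mono ?_ ?_ <;> simp only [encCost] <;> omega
  | query₂ inp out => exact simulable_typeTwo hQ inp ∅ out

theorem simulable_runSteps (hQ : QueryType.two ∈ Q) (C : List (Step w (μ * m) (μ * (m + τ))))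
    (hC : ∀ s ∈ C, s.Allowed Q) :
    Simulable Q (fun π => runSteps (ecbEnc π) C) (C.length * encCost m τ μ w)
      (C.length * encCost m τ μ w) := by
  induction C with
  | nil => exact Simulable.id.mono (Nat.zero_le _) (Nat.zero_le _)
  | cons s C ih =>
    have h := (simulable_step hQ s (hC s List.mem_cons_self)).seq
      (ih fun s' hs' => hC s' (List.mem_cons_of_mem _ hs'))
    refine h.mono ?_ ?_ <;> rw [List.length_cons] <;> linarith

theorem GQINDAdversary.simulable_challenge (hQ : QueryType.two ∈ Q)
    (A : GQINDAdversary (μ * m) (μ * (m + τ))) (b : Bool) :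
    Simulable Q (fun π => A.challenge (ecbEnc π) b) (encCost m τ μ A.width)
      (encCost m τ μ A.width) :=
  simulable_typeTwo hQ _ _ _

end Games

/-! ### Controlled circuits and measurement of descriptions -/

section Described

variable {ι lam : Type} [Fintype ι] [DecidableEq ι] [Fintype lam] [DecidableEq lam] {N : ℕ}

/-- The operator that acts on the second register by a matrix determined by the basis state of the
first. -/
def blockMat (D : (ι → Bool) → Matrix (lam → Bool) (lam → Bool) ℂ) :
    Matrix (ι ⊕ lam → Bool) (ι ⊕ lam → Bool) ℂ :=
  Matrix.of fun x y => if (fun i => x (Sum.inl i)) = (fun i => y (Sum.inl i)) then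
    D (fun i => y (Sum.inl i)) (fun j => x (Sum.inr j)) (fun j => y (Sum.inr j)) else 0

theorem blockMat_elim (D : (ι → Bool) → Matrix (lam → Bool) (lam → Bool) ℂ) (s s' : ι → Bool)
    (u u' : lam → Bool) :
    blockMat D (Sum.elim s u) (Sum.elim s' u') = if s = s' then D s' u u' else 0 := rfl

theorem ext_elim {M M' : Matrix (ι ⊕ lam → Bool) (ι ⊕ lam → Bool) ℂ}
    (h : ∀ s u s' u', M (Sum.elim s u) (Sum.elim s' u') = M' (Sum.elim s u) (Sum.elim s' u')) :
    M = M' := by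
  ext x y
  have e : ∀ x : ι ⊕ lam → Bool, x = Sum.elim (fun i => x (Sum.inl i)) fun i => x (Sum.inr i) :=
    fun x => funext fun i => by cases i <;> rfl
  rw [e x, e y]
  exact h _ _ _ _

theorem blockMat_mul (D D' : (ι → Bool) → Matrix (lam → Bool) (lam → Bool) ℂ) :
    blockMat D * blockMat D' = blockMat fun s => D s * D' s := by
  refine ext_elim fun s u s' u' => ?_
  simp only [Matrix.mul_apply, sum_sumElim, blockMat_elim]
  rw [Finset.sum_eq_single s']
  · by_cases h : s = s' <;> simp [h]
  · intro t _ ht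
    simp [ht]
  · simp

theorem blockMat_conj (D : (ι → Bool) → Matrix (lam → Bool) (lam → Bool) ℂ)
    (M : Matrix (ι ⊕ lam → Bool) (ι ⊕ lam → Bool) ℂ) (s s' : ι → Bool) (u u' : lam → Bool) :
    (blockMat D * M * (blockMat D)ᴴ) (Sum.elim s u) (Sum.elim s' u') =
      (D s * (Matrix.of fun v v' => M (Sum.elim s v) (Sum.elim s' v')) * (D s')ᴴ) u u' := by
  simp only [Matrix.mul_apply, sum_sumElim, Matrix.conjTranspose_apply, Matrix.of_apply]
  rw [Finset.sum_eq_single s']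
  · refine Finset.sum_congr rfl fun v' _ => ?_
    rw [Finset.sum_eq_single s]
    · simp only [blockMat_elim, if_true]
    · intro t _ ht
      simp [blockMat_elim, ht.symm]
    · simp
  · intro t _ ht
    simp [blockMat_elim, ht.symm]
  · simp

theorem blockMat_one : blockMat (fun _ : ι → Bool => (1 : Matrix (lam → Bool) (lam → Bool) ℂ)) =
    1 := by
  refine ext_elim fun s u s' u' => ?_
  have : (Sum.elim s u = Sum.elim s' u') ↔ s = s' ∧ u = u' := by
    constructor
    · intro h
      exact ⟨funext fun i => congrFun h (Sum.inl i), funext fun i => congrFun h (Sum.inr i)⟩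
    · rintro ⟨rfl, rfl⟩; rfl
  simp only [blockMat_elim, Matrix.one_apply, this]
  by_cases h : s = s' <;> simp [h]

/-- The matrix of a sequence of gates. -/
def gatesMat {v : ℕ} : List (Gate v) → Matrix (Bits v) (Bits v) ℂ
  | [] => 1
  | g :: C => gatesMat C * g.mat

theorem foldl_gates_eq {v : ℕ} (C : List (Gate v)) (ρ : QState v) :
    C.foldl (fun σ gt => gt.apply σ) ρ = gatesMat C * ρ * (gatesMat C)ᴴ := by
  induction C generalizing ρ with
  | nil => simp [gatesMat]
  | cons g C ih =>
    rw [List.foldl_cons, ih, gatesMat, Gate.apply, Matrix.conjTranspose_mul]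
    simp only [Matrix.mul_assoc]

/-- The gate `g` on the second register with the additional control `c` in the first. -/
def ctrlGate {v : ℕ} (g : Gate v) (c : ι) : WStep (ι ⊕ Fin v) N :=
  .gate g.kind (Sum.inr g.target) (insert (Sum.inl c) (g.controls.map Function.Embedding.inr))
    (by simpa using g.target_notMem)

/-- A gate may have any number of controls, so making it conditional on a description bit costs no
extra gate. -/
theorem ctrlGate_mat {v : ℕ} (π : Equiv.Perm (Bits N)) (g : Gate v) (c : ι) :
    (ctrlGate g c : WStep (ι ⊕ Fin v) N).mat π = blockMat fun s => if s c then g.mat else 1 := by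
  refine ext_elim fun s u s' u' => ?_
  have h1 : Sum.elim s u = Sum.elim s' u' ↔ s = s' ∧ u = u' := by
    constructor
    · intro h
      exact ⟨funext fun i => congrFun h (Sum.inl i), funext fun i => congrFun h (Sum.inr i)⟩
    · rintro ⟨rfl, rfl⟩; rfl
  have h2 : (∀ i : ι ⊕ Fin v, i ≠ Sum.inr g.target → Sum.elim s u i = Sum.elim s' u' i) ↔
      s = s' ∧ ∀ i, i ≠ g.target → u i = u' i := by
    simp [Sum.forall, funext_iff]
  simp only [ctrlGate, WStep.mat, Matrix.of_apply, blockMat_elim, h1, h2, Finset.forall_mem_insert,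
    Finset.forall_mem_map, Function.Embedding.inr_apply, Sum.elim_inl, Sum.elim_inr]
  by_cases h : s = s'
  · subst h
    by_cases hc : s c = true
    · simp only [hc, true_and, if_true, Gate.mat, Matrix.of_apply]
    · simp only [hc, true_and, if_true]
      rfl
  · simp [h]

theorem circMat_ctrlGates {v n : ℕ} (π : Equiv.Perm (Bits N)) (g : Fin n → Gate v) (c : Fin n → ι)
    (L : List (Fin n)) :
    circMat π (L.map fun i => (ctrlGate (g i) (c i) : WStep (ι ⊕ Fin v) N)) =
      blockMat fun s => gatesMat (L.filterMap fun i => if s (c i) then some (g i) else none) := by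
  induction L with
  | nil => exact blockMat_one.symm
  | cons i L ih =>
    rw [List.map_cons, circMat, ih, ctrlGate_mat, blockMat_mul]
    congr 1
    funext s
    by_cases h : s (c i) = true <;> simp [h, gatesMat]

/-- Measurement of the qubits `d` in the computational basis. -/
def dephase {J : Type} [Fintype J] (d : J → ι) (ρ : Matrix (ι → Bool) (ι → Bool) ℂ) :
    Matrix (ι → Bool) (ι → Bool) ℂ :=
  isoChannel (fun x => (x, fun p => x (d p))) ρ

theorem dephase_apply {J : Type} [Fintype J] (d : J → ι) (ρ : Matrix (ι → Bool) (ι → Bool) ℂ)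
    (x x' : ι → Bool) : dephase d ρ x x' = if ∀ p, x (d p) = x' (d p) then ρ x x' else 0 := by
  simp only [dephase, isoChannel, Matrix.of_apply]
  rw [Finset.sum_eq_single x, Finset.sum_eq_single x']
  · simp [funext_iff]
  · intro y _ hy
    simp [hy]
  · simp
  · intro y _ hy
    simp [hy]
  · simp

/-- Copying the wires by CNOT to ancillas that are later discarded measures them. It is an instance
of `implements_coins` with an empty set of coins. -/
theorem simulable_dephase {Q : Set QueryType} {J : Type} [Fintype J] [DecidableEq J] (d : J → ι) :
    Simulable Q (fun (_ : Equiv.Perm (Bits N)) => dephase d) (Fintype.card J) (Fintype.card J) := by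
  have hJ : ∀ j j', (Sum.inl (d j) : ι ⊕ J) ≠ Sum.inr j' := by simp
  refine ⟨J, inferInstance, inferInstance,
    hadamardLayer (fun j : Empty => Sum.inr j.elim) ++ cnotLayer (fun j => Sum.inl (d j)) Sum.inr hJ,
    le_rfl, ?_, ?_, fun π => ?_⟩
  · simp [hadamardLayer, cnotLayer, length_layer]
  · intro s hs
    simp only [hadamardLayer, cnotLayer, List.mem_append, mem_layer] at hs
    rcases hs with ⟨j, rfl⟩ | ⟨j, rfl⟩
    · trivial
    · trivial
  have h := implements_coins (ι := ι) π (c := fun j : Empty => (j.elim : J)) (fun j => j.elim)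
    (circMat_cnotLayer_eq π hJ Sum.inr_injective) (fun _ x => (x, fun p => x (d p))) ?_ ?_
  · intro ρ
    rw [← h ρ]
    simp [dephase]
  · intro r s
    funext i
    exact Function.extend_apply' _ _ _ (by simp)
  · intro r r' s s'
    have e : ∀ r (s : ι → Bool) k, xorFun (fun j => Sum.inl (d j)) Sum.inr (Sum.elim s
        (Function.extend (fun j : Empty => (j.elim : J)) r fun _ => false)) (Sum.inr k) =
        s (d k) := by
      intro r s k
      refine (Sum.inr_injective.extend_apply _ _ k).trans ?_
      rw [Sum.elim_inr, Function.extend_apply' _ _ _ (by simp)]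
      simp
    simp only [e, funext_iff (f := fun p => _)]
    simp [Subsingleton.elim r r']

theorem sum_braRight (M : Matrix (ι ⊕ lam → Bool) (ι ⊕ lam → Bool) ℂ) :
    ∑ g : lam → Bool, braRight ι g * M * (braRight ι g)ᴴ =
      isoChannel (fun x => (fun i => x (Sum.inl i), fun j => x (Sum.inr j))) M := by
  ext t t'
  simp only [Matrix.sum_apply, braRight_mul_mul, isoChannel, Matrix.of_apply, sum_sumElim,
    Sum.elim_inl, Sum.elim_inr]
  rw [Finset.sum_eq_single t]
  · refine Finset.sum_congr rfl fun g _ => ?_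
    rw [Finset.sum_eq_single t', Finset.sum_eq_single g] <;> simp +contextual [eq_comm]
  · intro s _ hs
    simp [hs]
  · simp

theorem zeroIso_mul_mul (ρ : Matrix (ι → Bool) (ι → Bool) ℂ) {v : ℕ} (s s' : ι → Bool)
    (u u' : Bits v) : (zeroIso ι (Fin v) * ρ * (zeroIso ι (Fin v))ᴴ) (Sum.elim s u) (Sum.elim s' u') =
      zeroState v u u' * ρ s s' := by
  have h : ∀ (s : ι → Bool) (u : Bits v) t, (zeroIso ι (Fin v)) (Sum.elim s u) t =
      if s = t ∧ u = (fun _ => false) then 1 else 0 := by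
    intro s u t
    refine if_congr ?_ rfl rfl
    constructor
    · intro h
      exact ⟨funext fun i => congrFun h (Sum.inl i), funext fun i => congrFun h (Sum.inr i)⟩
    · rintro ⟨rfl, rfl⟩; rfl
  simp only [Matrix.mul_apply, Matrix.conjTranspose_apply, h, zeroState, Matrix.of_apply]
  by_cases hu : u = fun _ => false
  · by_cases hu' : u' = fun _ => false
    · simp [hu, hu', apply_ite]
    · simp [hu']
  · simp [hu]

end Described

/-! ### Simulation of the qIND challenge -/

section QINDChallenge

variable {m τ μ : ℕ} {Q : Set QueryType}

/-- The state after both descriptions are measured and the described state with label `b` is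
built on auxiliary qubits. -/
def QINDAdversary.prepared {a l : ℕ} (A : QINDAdversary a l) (b : Bool) (ρ : QState A.width) :
    Matrix (Fin A.width ⊕ Fin A.prepWidth → Bool) (Fin A.width ⊕ Fin A.prepWidth → Bool) ℂ :=
  Matrix.of fun x x' => if ∀ p, x (Sum.inl (A.desc p)) = x' (Sum.inl (A.desc p)) then
    (describedCircuit fun i => x (Sum.inl (A.desc (b, i)))).foldl (fun σ gt => gt.apply σ)
      (zeroState A.prepWidth) (fun i => x (Sum.inr i)) (fun i => x' (Sum.inr i)) *
      ρ (fun i => x (Sum.inl i)) (fun i => x' (Sum.inl i)) else 0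

theorem QINDAdversary.preState_eq {a l : ℕ} (A : QINDAdversary a l) (b : Bool)
    (ρ : QState A.width) :
    A.preState b ρ = isoChannel (fun x => ((fun i => x (Sum.inr (A.prepOut i)),
      fun i => x (Sum.inl i)), fun i => if ∃ j, A.prepOut j = i then false else x (Sum.inr i)))
      (A.prepared b ρ) := by
  ext ⟨y, s⟩ ⟨y', s'⟩
  simp only [isoChannel, Matrix.of_apply, sum_sumElim, Sum.elim_inl, Sum.elim_inr,
    QINDAdversary.prepared, Prod.mk.injEq, QINDAdversary.preState, describedState, reducedState_eq]
  rw [Finset.sum_eq_single s]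
  · by_cases h : ∀ p, s (A.desc p) = s' (A.desc p)
    · rw [if_pos h, Finset.sum_mul]
      refine Finset.sum_congr rfl fun u _ => ?_
      rw [Finset.sum_eq_single s', Finset.sum_mul]
      · refine Finset.sum_congr rfl fun u' _ => ?_
        simp only [eq_true h, and_true, if_true, ite_mul, zero_mul]
      · intro t _ ht
        simp [ht]
      · simp
    · rw [if_neg h]
      symm
      refine Finset.sum_eq_zero fun u _ => Finset.sum_eq_zero fun t _ =>
        Finset.sum_eq_zero fun u' _ => ?_
      by_cases ht : t = s'
      · subst ht
        simp only [eq_false h, if_false, ite_self]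
      · simp [ht]
  · intro t _ ht
    simp [ht]
  · simp

theorem QINDAdversary.simulable_prepared {a l N : ℕ} (A : QINDAdversary a l) (b : Bool) :
    ∃ Ψ : Equiv.Perm (Bits N) → _, Simulable Q Ψ A.width (2 * A.width) ∧
      ∀ π ρ, Ψ π (zeroIso (Fin A.width) (Fin A.prepWidth) * ρ *
        (zeroIso (Fin A.width) (Fin A.prepWidth))ᴴ) = A.prepared b ρ := by
  -- The adversary stores both descriptions in its own qubits, so the number of controlled gates is
  -- bounded by its width.
  have hL : Fintype.card (Bool × Fin (gateTable A.prepWidth A.prepRounds).length) ≤ A.width := by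
    simpa only [Fintype.card_fin] using Fintype.card_le_of_embedding A.desc
  let C : List (WStep (Fin A.width ⊕ Fin A.prepWidth) N) :=
    (List.finRange (gateTable A.prepWidth A.prepRounds).length).map fun i =>
      ctrlGate ((gateTable A.prepWidth A.prepRounds).get i) (A.desc (b, i))
  have hC : C.length ≤ A.width := by
    simp only [Fintype.card_prod, Fintype.card_bool, Fintype.card_fin] at hL
    simp only [C, List.length_map, List.length_finRange]
    omega
  have h1 := simulable_dephase (N := N) (Q := Q)
    (fun p => (Sum.inl (A.desc p) : Fin A.width ⊕ Fin A.prepWidth))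
  have h2 := Simulable.of_circ (Q := Q) (Φ := fun π ρ => circMat π C * ρ * (circMat π C)ᴴ) C
    (by
      intro s hs
      obtain ⟨i, -, rfl⟩ := List.mem_map.1 hs
      trivial) fun π ρ => rfl
  refine ⟨_, (h1.seq h2).mono (by omega) (by omega), fun π ρ => ?_⟩
  refine ext_elim fun s u s' u' => ?_
  simp only [C]
  rw [circMat_ctrlGates π _ fun i => A.desc (b, i), blockMat_conj]
  simp only [dephase_apply, zeroIso_mul_mul, Sum.elim_inl, QINDAdversary.prepared, Matrix.of_apply,
    Sum.elim_inr]
  by_cases h : ∀ p, s (A.desc p) = s' (A.desc p)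
  · simp only [eq_true h, if_true]
    -- After the measurement the row and the column carry the same description, so the same circuit
    -- acts on both sides of the zero state.
    have hd : (fun i => s' (A.desc (b, i))) = fun i => s (A.desc (b, i)) :=
      funext fun i => (h (b, i)).symm
    have e : ∀ s : Bits A.width, ((List.finRange (gateTable A.prepWidth A.prepRounds).length).filterMap
        fun i => if s (A.desc (b, i)) then some ((gateTable A.prepWidth A.prepRounds).get i)
          else none) = describedCircuit fun i => s (A.desc (b, i)) := fun s => rfl
    rw [e, e, hd, foldl_gates_eq]
    have hz : (Matrix.of fun v v' => zeroState A.prepWidth v v' * ρ s s') =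
        ρ s s' • zeroState A.prepWidth := by
      ext v v'
      simp [mul_comm]
    rw [hz, Matrix.mul_smul, Matrix.smul_mul, Matrix.smul_apply, smul_eq_mul, mul_comm]
  · simp only [eq_false h, if_false]
    have hz : (Matrix.of fun _ _ => 0 : QState A.prepWidth) = 0 := rfl
    rw [hz]
    simp

theorem twoFun_fst_out {ι : Type} [Fintype ι] [DecidableEq ι] {a l : ℕ} (f : Bits a → Bits l)
    (inp : Fin a ↪ ι) (drop : Finset ι) (out : Fin l ↪ ι) (s : ι → Bool) (j : Fin l) :
    (twoFun f inp drop out s).1 (out j) = f (fun i => s (inp i)) j := by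
  simp only [twoFun, out.injective.extend_apply]

theorem twoFun_fst_off {ι : Type} [Fintype ι] [DecidableEq ι] {a l : ℕ} (f : Bits a → Bits l)
    (inp : Fin a ↪ ι) (drop : Finset ι) (out : Fin l ↪ ι) (s : ι → Bool) {i : ι}
    (hi : ¬ ∃ j, out j = i) : (twoFun f inp drop out s).1 i =
      if i ∈ drop ∨ (∃ j, inp j = i) then false else s i := by
  simp only [twoFun, Function.extend_apply' _ _ _ hi]

/-- The preparation qubits outside `o` may be discarded after the encryption instead of before it,
because the encryption does not touch them. -/
theorem isoChannel_twoFun_sum {a l w v : ℕ} (o : Fin a ↪ Fin v) (c : Fin l ↪ Fin w)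
    (f : Bits a → Bits l) (σ : Matrix (Fin w ⊕ Fin v → Bool) (Fin w ⊕ Fin v → Bool) ℂ) :
    isoChannel (fun x => (fun i => x (Sum.inl i), fun j => x (Sum.inr j)))
      (isoChannel (twoFun f (o.trans Function.Embedding.inr) ∅ (c.trans Function.Embedding.inl)) σ) =
    isoChannel (encOut f c) (isoChannel (fun x => ((fun i => x (Sum.inr (o i)),
      fun i => x (Sum.inl i)), fun i => if ∃ j, o j = i then false else x (Sum.inr i))) σ) := by
  have keyL : ∀ x i, (twoFun f (o.trans Function.Embedding.inr) ∅
      (c.trans Function.Embedding.inl) x).1 (Sum.inl i) =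
      Function.extend c (f fun i => x (Sum.inr (o i))) (fun i => x (Sum.inl i)) i := by
    intro x i
    by_cases hi : ∃ j, c j = i
    · obtain ⟨j, rfl⟩ := hi
      rw [c.injective.extend_apply]
      exact twoFun_fst_out f (o.trans Function.Embedding.inr) ∅ (c.trans Function.Embedding.inl) x j
    · rw [Function.extend_apply' _ _ _ hi, twoFun_fst_off]
      · simp
      · rintro ⟨j, hj⟩
        exact hi ⟨j, Sum.inl_injective hj⟩
  have keyR : ∀ x j, (twoFun f (o.trans Function.Embedding.inr) ∅
      (c.trans Function.Embedding.inl) x).1 (Sum.inr j) =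
      if ∃ i, o i = j then false else x (Sum.inr j) := by
    intro x j
    rw [twoFun_fst_off _ _ _ _ _ (by simp)]
    simp
  have key2 : ∀ x, (twoFun f (o.trans Function.Embedding.inr) ∅
      (c.trans Function.Embedding.inl) x).2 =
      Sum.elim (fun i => if ∃ j, c j = i then x (Sum.inl i) else false) fun _ => false := by
    intro x
    funext i
    rcases i with i | i <;> simp [twoFun]
  rw [isoChannel_comp, isoChannel_comp]
  refine isoChannel_congr (fun x => funext fun i => keyL x i) (fun x x' => ?_) σ
  simp only [keyR, key2, Prod.mk.injEq, encOut]
  constructor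
  · rintro ⟨h, h'⟩
    refine ⟨h', funext fun j => ?_⟩
    simpa using congrFun h (Sum.inl (c j))
  · rintro ⟨h, h'⟩
    refine ⟨?_, h⟩
    congr 1
    funext i
    split_ifs with hi
    · obtain ⟨j, rfl⟩ := hi
      exact congrFun h' j
    · rfl

/-- The described state is built on auxiliary wires, encrypted from there into `cipher` by one
type-(2) encryption on the enlarged register, and the auxiliary wires are discarded. -/
theorem QINDAdversary.simulable_challenge (hQ : QueryType.two ∈ Q)
    (A : QINDAdversary (μ * m) (μ * (m + τ))) (b : Bool) :
    Simulable Q (fun π => A.challenge (ecbEnc π) b)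
      (2 * A.width + A.prepWidth + encCost m τ μ (A.width + A.prepWidth))
      (2 * A.width + A.prepWidth + encCost m τ μ (A.width + A.prepWidth)) := by
  obtain ⟨Ψ, h1, h2⟩ := A.simulable_prepared (Q := Q) (N := m + τ) b
  let inp : Fin (μ * m) ↪ Fin A.width ⊕ Fin A.prepWidth := A.prepOut.trans Function.Embedding.inr
  let out : Fin (μ * (m + τ)) ↪ Fin A.width ⊕ Fin A.prepWidth :=
    A.cipher.trans Function.Embedding.inl
  have h3 := (h1.seq (simulable_twoFun inp ∅ out hQ)).withAncilla
  have e : (fun π => withAncilla fun ρ => avgChannel (fun r => twoFun (ecbEnc π r) inp ∅ out)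
      (Ψ π ρ)) = fun π => A.challenge (ecbEnc π) b := by
    funext π ρ
    rw [withAncilla, h2 π ρ, sum_braRight, A.challenge_eq, coinAverage_curry, A.preState_eq]
    simp only [avgChannel]
    have hs : ∀ φ : (Fin μ × Fin τ → Bool) → Matrix (Fin A.width ⊕ Fin A.prepWidth → Bool)
        (Fin A.width ⊕ Fin A.prepWidth → Bool) ℂ,
        isoChannel (fun x => (fun i => x (Sum.inl i), fun j => x (Sum.inr j))) (∑ r, φ r) =
        ∑ r, isoChannel (fun x => (fun i => x (Sum.inl i), fun j => x (Sum.inr j))) (φ r) :=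
      fun φ => map_sum ((isoChannel_isPos _).lin.mk' _) _ _
    rw [(isoChannel_isPos _).lin.map_smul, hs]
    congr 1
    refine Finset.sum_congr rfl fun r _ => ?_
    exact isoChannel_twoFun_sum A.prepOut A.cipher _ _
  rw [e] at h3
  refine h3.mono ?_ ?_ <;> simp only [encCost, Fintype.card_fin, Fintype.card_sum] <;> omega

end QINDChallenge

/-! ### Asymptotics -/

theorem PolyBounded.mono {f g : ℕ → ℕ} (hg : PolyBounded g) (h : ∀ n, f n ≤ g n) :
    PolyBounded f := by
  obtain ⟨p, hp⟩ := hg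
  exact ⟨p, hp.mono fun n hn => (h n).trans hn⟩

theorem PolyBounded.add {f g : ℕ → ℕ} (hf : PolyBounded f) (hg : PolyBounded g) :
    PolyBounded fun n => f n + g n := by
  obtain ⟨p, hp⟩ := hf
  obtain ⟨q, hq⟩ := hg
  refine ⟨p + q, ?_⟩
  filter_upwards [hp, hq] with n h1 h2
  rw [Polynomial.eval_add]
  exact Nat.add_le_add h1 h2

theorem PolyBounded.mul {f g : ℕ → ℕ} (hf : PolyBounded f) (hg : PolyBounded g) :
    PolyBounded fun n => f n * g n := by
  obtain ⟨p, hp⟩ := hf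
  obtain ⟨q, hq⟩ := hg
  refine ⟨p * q, ?_⟩
  filter_upwards [hp, hq] with n h1 h2
  rw [Polynomial.eval_mul]
  exact Nat.mul_le_mul h1 h2

theorem PolyBounded.const (c : ℕ) : PolyBounded fun _ => c :=
  ⟨Polynomial.C c, by simp⟩

theorem PolyBounded.exists_pow {f : ℕ → ℕ} (hf : PolyBounded f) :
    ∃ d, ∀ᶠ n in atTop, f n ≤ n ^ d := by
  obtain ⟨p, hp⟩ := hf
  -- The additional factor n absorbs `p.eval 1`, the sum of the coefficients.
  refine ⟨p.natDegree + 1, ?_⟩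
  filter_upwards [hp, eventually_ge_atTop (p.eval 1), eventually_ge_atTop 1] with n h1 h2 h3
  refine h1.trans ?_
  calc p.eval n = ∑ i ∈ Finset.range (p.natDegree + 1), p.coeff i * n ^ i :=
        Polynomial.eval_eq_sum_range n
    _ ≤ ∑ i ∈ Finset.range (p.natDegree + 1), p.coeff i * 1 ^ i * n ^ p.natDegree := by
        refine Finset.sum_le_sum fun i hi => ?_
        rw [one_pow, mul_one]
        exact Nat.mul_le_mul_left _ (Nat.pow_le_pow_right h3
          (Nat.lt_succ_iff.1 (Finset.mem_range.1 hi)))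
    _ = p.eval 1 * n ^ p.natDegree := by
        rw [← Finset.sum_mul, ← Polynomial.eval_eq_sum_range]
    _ ≤ n * n ^ p.natDegree := Nat.mul_le_mul_right _ h2
    _ = n ^ (p.natDegree + 1) := by rw [pow_succ, mul_comm]

theorem Negligible.mono {ε δ : ℕ → ℝ} (h : Negligible ε) (hle : ∀ n, δ n ≤ ε n) :
    Negligible δ := fun c => (h c).mono fun n hn => (hle n).trans hn

theorem Negligible.polyBounded_mul {f : ℕ → ℕ} {ε : ℕ → ℝ} (hf : PolyBounded f)
    (h : Negligible ε) : Negligible fun n => f n * ε n := by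
  obtain ⟨d, hd⟩ := hf.exists_pow
  intro c
  filter_upwards [hd, h (c + d), eventually_gt_atTop 0] with n h1 h2 h3
  have hn : (0 : ℝ) < n := by exact_mod_cast h3
  have h1' : (f n : ℝ) ≤ (n : ℝ) ^ d := by exact_mod_cast h1
  calc f n * ε n ≤ f n * (1 / (n : ℝ) ^ (c + d)) :=
        mul_le_mul_of_nonneg_left h2 (Nat.cast_nonneg _)
    _ ≤ (n : ℝ) ^ d * (1 / (n : ℝ) ^ (c + d)) := mul_le_mul_of_nonneg_right h1' (by positivity)
    _ = 1 / (n : ℝ) ^ c := by rw [pow_add]; field_simp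

theorem Negligible.add {ε δ : ℕ → ℝ} (h : Negligible ε) (h' : Negligible δ) :
    Negligible fun n => ε n + δ n := by
  intro c
  filter_upwards [h (c + 1), h' (c + 1), eventually_ge_atTop 2] with n h1 h2 h3
  have hn : (2 : ℝ) ≤ n := by exact_mod_cast h3
  have hp : (0 : ℝ) < (n : ℝ) ^ c := by positivity
  calc ε n + δ n ≤ 2 * (1 / (n : ℝ) ^ (c + 1)) := by linarith
    _ ≤ n * (1 / (n : ℝ) ^ (c + 1)) := mul_le_mul_of_nonneg_right hn (by positivity)
    _ = 1 / (n : ℝ) ^ c := by rw [pow_succ]; field_simp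

theorem Negligible.half_exponent {τ : ℕ → ℕ} (h : Negligible fun n => 1 / (2 : ℝ) ^ τ n) :
    Negligible fun n => 1 / (2 : ℝ) ^ (τ n / 2) := by
  intro c
  -- Squares are compared: rounding in τ/2 costs a factor 2, absorbed by one of the 2c + 1 powers of
  -- n.
  filter_upwards [h (2 * c + 1), eventually_ge_atTop 2] with n h1 h3
  have hn : (2 : ℝ) ≤ n := by exact_mod_cast h3
  refine le_of_sq_le_sq ?_ (by positivity)
  have h2 : (2 : ℝ) ^ τ n ≤ 2 * (2 ^ (τ n / 2)) ^ 2 := by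
    rw [← pow_mul, ← pow_succ']
    exact pow_le_pow_right₀ (by norm_num) (by omega)
  calc (1 / (2 : ℝ) ^ (τ n / 2)) ^ 2 ≤ 2 * (1 / (2 : ℝ) ^ τ n) := by
        rw [div_pow, one_pow, div_le_iff₀ (by positivity), mul_one_div, div_mul_eq_mul_div,
          le_div_iff₀ (by positivity)]
        linarith
    _ ≤ 2 * (1 / (n : ℝ) ^ (2 * c + 1)) := by linarith
    _ ≤ n * (1 / (n : ℝ) ^ (2 * c + 1)) := mul_le_mul_of_nonneg_right hn (by positivity)
    _ = (1 / (n : ℝ) ^ c) ^ 2 := by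
        rw [div_pow, one_pow, ← pow_mul, pow_succ, mul_comm c 2]; field_simp

/-! ### Averages over keys -/

theorem summable_pmf_mul {α : Type} (p : PMF α) {f : α → ℝ} (h0 : ∀ a, 0 ≤ f a)
    (h1 : ∀ a, f a ≤ 1) : Summable fun a => (p a).toReal * f a :=
  Summable.of_nonneg_of_le (fun a => mul_nonneg ENNReal.toReal_nonneg (h0 a))
    (fun a => mul_le_of_le_one_right ENNReal.toReal_nonneg (h1 a))
    (ENNReal.summable_toReal p.tsum_coe_ne_top)

theorem tsum_pmf_toReal {α : Type} (p : PMF α) : ∑' a, (p a).toReal = 1 := by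
  rw [← ENNReal.tsum_toReal_eq fun a => p.apply_ne_top a, p.tsum_coe, ENNReal.toReal_one]

/-- Averaging commutes with the affine expression of the winning probability in the two acceptance
probabilities; boundedness supplies the summability. -/
theorem tsum_pmf_guess {α : Type} (p : PMF α) {f g : α → ℝ} (f0 : ∀ a, 0 ≤ f a)
    (f1 : ∀ a, f a ≤ 1) (g0 : ∀ a, 0 ≤ g a) (g1 : ∀ a, g a ≤ 1) :
    ∑' a, (p a).toReal * ((f a + (1 - g a)) / 2) =
      (∑' a, (p a).toReal * f a + (1 - ∑' a, (p a).toReal * g a)) / 2 := by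
  have hf := summable_pmf_mul p f0 f1
  have hg := summable_pmf_mul p g0 g1
  have h1 : Summable fun a => (p a).toReal := ENNReal.summable_toReal p.tsum_coe_ne_top
  rw [← tsum_pmf_toReal p, ← h1.tsum_sub hg, ← hf.tsum_add (h1.sub hg), ← tsum_div_const]
  exact tsum_congr fun a => by rw [tsum_pmf_toReal]; ring

theorem avg_guess {α : Type} [Fintype α] [Nonempty α] (f g : α → ℝ) :
    (∑ a, (f a + (1 - g a)) / 2) / Fintype.card α =
      ((∑ a, f a) / Fintype.card α + (1 - (∑ a, g a) / Fintype.card α)) / 2 := by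
  have h : (Fintype.card α : ℝ) ≠ 0 := by exact_mod_cast Fintype.card_ne_zero
  rw [← Finset.sum_div, Finset.sum_add_distrib, Finset.sum_sub_distrib]
  simp only [Finset.sum_const, Finset.card_univ, nsmul_eq_mul, mul_one]
  field_simp

/-- A guessing game against `P` that is simulated by small oracle circuits, and that is hard for
random permutations, is hard. -/
theorem negligible_of_simulable {Q : Set QueryType} {P : PermFamily} {ℓ : ℕ → ℕ}
    (hP : IsQPRP Q P ℓ) {w K : ℕ → ℕ} (hw : PolyBounded w) (hK : PolyBounded K)
    (Φ : ∀ n, Bool → Equiv.Perm (Bits (ℓ n)) → QState (w n) → QState (w n)) (i : ∀ n, Fin (w n))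
    (hΦ : ∀ n b π, IsChannel (Φ n b π)) (hs : ∀ n b, Simulable Q (Φ n b) (K n) (K n))
    {ε : ℕ → ℝ} (hε : Negligible ε)
    (hideal : ∀ n, (∑ π, (∑ b, measureProb (i n) b (Φ n b π (zeroState (w n)))) / 2) /
      (Fintype.card (Equiv.Perm (Bits (ℓ n))) : ℝ) ≤ 1 / 2 + ε n) :
    Negligible fun n => (∑' k, (P.keyDist (ℓ n) k).toReal *
      ((∑ b, measureProb (i n) b (Φ n b (P.perm (ℓ n) k) (zeroState (w n)))) / 2)) - 1 / 2 := by
  -- One distinguisher for each challenge bit, both accepting when the guess reads `true`.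
  choose D hD1 hD2 hD3 using fun b n => (hs n b).exists_distinguisher (i n)
  have hsize : ∀ b, PolyBounded fun n => (D b n).size := fun b =>
    ((hw.add hK).add hK).mono (hD2 b)
  have hneg := fun b => hP (D b) (hD1 b) (hsize b)
  have hpsd : ∀ b n π, (Φ n b π (zeroState (w n))).PosSemidef := fun b n π =>
    (hΦ n b π).psd _ zeroState_posSemidef
  have htr : ∀ b n π, (Φ n b π (zeroState (w n))).trace.re = 1 := fun b n π => by
    rw [(hΦ n b π).trace_eq, zeroState_trace, Complex.one_re]
  have h0 : ∀ b n π, 0 ≤ (D b n).acceptProb π := fun b n π => by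
    rw [hD3]; exact (measureProb_isEffect _ _).nonneg _ (hpsd b n π)
  have h1 : ∀ b n π, (D b n).acceptProb π ≤ 1 := fun b n π => by
    rw [hD3]; exact ((measureProb_isEffect _ _).le_trace _ (hpsd b n π)).trans_eq (htr b n π)
  -- For the challenge bit `false`, a correct guess is the complement of acceptance, since the trace
  -- is 1.
  have hwin : ∀ n π, (∑ b, measureProb (i n) b (Φ n b π (zeroState (w n)))) / 2 =
      ((D true n).acceptProb π + (1 - (D false n).acceptProb π)) / 2 := by
    intro n π
    rw [Fintype.sum_bool, hD3, hD3, ← htr false n π, ← measureProb_add (i n)]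
    ring
  refine (((hneg true).add (hneg false)).add hε).mono fun n => ?_
  have hi := hideal n
  simp only [hwin] at hi ⊢
  rw [avg_guess] at hi
  rw [tsum_pmf_guess _ (fun k => h0 _ _ _) (fun k => h1 _ _ _) (fun k => h0 _ _ _)
    fun k => h1 _ _ _]
  have ht := le_abs_self ((∑' k, (P.keyDist (ℓ n) k).toReal *
    (D true n).acceptProb (P.perm (ℓ n) k)) - (∑ π, (D true n).acceptProb π) /
      (Fintype.card (Equiv.Perm (Bits (ℓ n))) : ℝ))
  have ht' := abs_nonneg ((∑' k, (P.keyDist (ℓ n) k).toReal *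
    (D true n).acceptProb (P.perm (ℓ n) k)) - (∑ π, (D true n).acceptProb π) /
      (Fintype.card (Equiv.Perm (Bits (ℓ n))) : ℝ))
  have hf := neg_abs_le ((∑' k, (P.keyDist (ℓ n) k).toReal *
    (D false n).acceptProb (P.perm (ℓ n) k)) - (∑ π, (D false n).acceptProb π) /
      (Fintype.card (Equiv.Perm (Bits (ℓ n))) : ℝ))
  have hf' := abs_nonneg ((∑' k, (P.keyDist (ℓ n) k).toReal *
    (D false n).acceptProb (P.perm (ℓ n) k)) - (∑ π, (D false n).acceptProb π) /
      (Fintype.card (Equiv.Perm (Bits (ℓ n))) : ℝ))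
  linarith

/-! ### Security of randomized ECB -/

theorem avg_guess_random_perm_le {m τ μ w : ℕ} (C₁ C₂ : List (Step w (μ * m) (μ * (m + τ))))
    (cipher : Fin (μ * (m + τ)) ↪ Fin w) (i : Fin w)
    {pre : Bool → QState w → Matrix (Bits (μ * m) × Bits w) (Bits (μ * m) × Bits w) ℂ}
    (hpre : ∀ b, IsChannel (pre b))
    (htr : ∀ ρ s s', ∑ x, pre true ρ (x, s) (x, s') = ∑ x, pre false ρ (x, s) (x, s')) :
    (∑ π : Equiv.Perm (Bits (m + τ)), (∑ b, measureProb i b (runSteps (ecbEnc π) C₂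
      (coinAverage fun r => isoChannel (encOut (ecbEnc π r) cipher)
        (pre b (runSteps (ecbEnc π) C₁ (zeroState w)))))) / 2) /
      (Fintype.card (Equiv.Perm (Bits (m + τ))) : ℝ) ≤
      1 / 2 + (μ * (1 + (C₁.length + C₂.length + 1) * μ) : ℕ) * (1 / (2 : ℝ) ^ (τ / 2)) := by
  -- Any bijections serve, since the permutation is uniformly random. Splitting τ evenly balances
  -- the errors 1/|B| and 1/|A|.
  let ζ : Bits m ≃ ZMod (2 ^ m) := Fintype.equivOfCardEq (by simp [ZMod.card])
  let θ : Bits τ ≃ ZMod (2 ^ (τ / 2)) × ZMod (2 ^ (τ - τ / 2)) := Fintype.equivOfCardEq (by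
    rw [Fintype.card_prod, ZMod.card, ZMod.card, ← pow_add]
    simp [Nat.add_sub_cancel' (Nat.div_le_self τ 2)])
  have h := guess_random_perm_le ζ θ C₁ C₂ cipher i hpre htr
  have hP : (0 : ℝ) < Fintype.card (Equiv.Perm (Bits (m + τ))) := by
    exact_mod_cast Fintype.card_pos
  rw [div_le_iff₀ hP, mul_comm _ (Fintype.card (Equiv.Perm (Bits (m + τ))) : ℝ)]
  refine h.trans (mul_le_mul_of_nonneg_left (add_le_add_right ?_ _) hP.le)
  rw [ZMod.card, ZMod.card]
  have h2 : 1 / ((2 ^ (τ - τ / 2) : ℕ) : ℝ) ≤ 1 / (2 : ℝ) ^ (τ / 2) := by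
    push_cast
    exact one_div_le_one_div_of_le (by positivity) (pow_le_pow_right₀ (by norm_num) (by omega))
  calc (μ : ℝ) * (1 / ((2 ^ (τ - τ / 2) : ℕ) : ℝ) + (C₁.length + C₂.length + 1) *
        (μ / ((2 ^ (τ / 2) : ℕ) : ℝ)))
      ≤ μ * (1 / (2 : ℝ) ^ (τ / 2) + (C₁.length + C₂.length + 1) *
        (μ / ((2 ^ (τ / 2) : ℕ) : ℝ))) :=
        mul_le_mul_of_nonneg_left (add_le_add_left h2 _) (Nat.cast_nonneg _)
    _ = (μ * (1 + (C₁.length + C₂.length + 1) * μ) : ℕ) * (1 / (2 : ℝ) ^ (τ / 2)) := by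
        push_cast
        ring

theorem runSteps_ecbEnc_isChannel {m τ μ w : ℕ} (π : Equiv.Perm (Bits (m + τ)))
    (C : List (Step w (μ * m) (μ * (m + τ)))) : IsChannel (runSteps (ecbEnc π) C) := by
  rw [runSteps_eq_runStepsW]
  refine runStepsW_isChannel (fun _ => by positivity) ?_ (fun r => ecbEnc_injective π r) C
  rw [Finset.sum_const, Finset.card_univ, nsmul_eq_mul]
  exact mul_inv_cancel₀ (by exact_mod_cast Fintype.card_ne_zero)

theorem coinAverage_isChannel {w : ℕ} {R Y : Type} [Fintype R] [Nonempty R] [Fintype Y]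
    {Φ : R → Matrix Y Y ℂ → QState w} (h : ∀ r, IsChannel (Φ r)) :
    IsChannel fun ρ => coinAverage fun r => Φ r ρ := by
  have e : (fun ρ => coinAverage fun r => Φ r ρ) =
      fun ρ => ∑ r, (((Fintype.card R : ℝ)⁻¹ : ℝ) : ℂ) • Φ r ρ := by
    funext ρ
    simp [coinAverage, Finset.smul_sum]
  rw [e]
  refine ⟨isPos_sum _ _ (fun _ => by positivity) fun r => (h r).toIsPos, fun X => ?_⟩
  simp only [Matrix.trace_sum, Matrix.trace_smul, (h _).trace_eq]
  rw [Finset.sum_const, Finset.card_univ, ← smul_assoc, nsmul_eq_mul]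
  push_cast
  rw [mul_inv_cancel₀ (by exact_mod_cast Fintype.card_ne_zero), one_smul]

theorem PolyBounded.encCost {m τ μ w : ℕ → ℕ} (hm : PolyBounded m) (hτ : PolyBounded τ)
    (hμ : PolyBounded μ) (hw : PolyBounded w) :
    PolyBounded fun n => encCost (m n) (τ n) (μ n) (w n) := by
  have h := hμ.mul (hm.add hτ)
  exact ((hμ.mul hτ).add ((((h.add (hμ.mul hm)).add ((PolyBounded.const 2).mul hw)).add hμ).add
    ((PolyBounded.const 2).mul h))).add (PolyBounded.const 1)

theorem encCost_mono (m τ μ : ℕ) {w w' : ℕ} (h : w ≤ w') : encCost m τ μ w ≤ encCost m τ μ w' := by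
  simp only [encCost]
  omega

/-- A bound for the cost of the simulation of a game with an adversary of size `s`. -/
def gameCost (m τ μ s : ℕ) : ℕ := 2 * s + (s + 1) * encCost m τ μ s

theorem simulable_game {m τ μ w : ℕ} {Q : Set QueryType} (hQ : QueryType.two ∈ Q)
    {C₁ C₂ : List (Step w (μ * m) (μ * (m + τ)))} (h1 : ∀ s ∈ C₁, s.Allowed Q)
    (h2 : ∀ s ∈ C₂, s.Allowed Q) {Φ : Equiv.Perm (Bits (m + τ)) → QState w → QState w} {s : ℕ}
    (hΦ : Simulable Q Φ (2 * s + encCost m τ μ s) (2 * s + encCost m τ μ s))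
    (hs : w + C₁.length + C₂.length ≤ s) :
    Simulable Q (fun π ρ => runSteps (ecbEnc π) C₂ (Φ π (runSteps (ecbEnc π) C₁ ρ)))
      (gameCost m τ μ s) (gameCost m τ μ s) := by
  have h := ((simulable_runSteps hQ C₁ h1).seq hΦ).seq (simulable_runSteps hQ C₂ h2)
  have hw : encCost m τ μ w ≤ encCost m τ μ s := encCost_mono m τ μ (by omega)
  have e : C₁.length * encCost m τ μ w + (2 * s + encCost m τ μ s) +
      C₂.length * encCost m τ μ w ≤ gameCost m τ μ s := by
    have e1 := Nat.mul_le_mul_left C₁.length hw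
    have e2 := Nat.mul_le_mul_left C₂.length hw
    have e3 : (C₁.length + C₂.length + 1) * encCost m τ μ s ≤ (s + 1) * encCost m τ μ s :=
      Nat.mul_le_mul_right _ (by omega)
    simp only [gameCost]
    linarith
  exact h.mono e e

theorem PolyBounded.gameCost {m τ μ s : ℕ → ℕ} (hm : PolyBounded m) (hτ : PolyBounded τ)
    (hμ : PolyBounded μ) (hs : PolyBounded s) :
    PolyBounded fun n => gameCost (m n) (τ n) (μ n) (s n) :=
  ((PolyBounded.const 2).mul hs).add
    ((hs.add (PolyBounded.const 1)).mul (PolyBounded.encCost hm hτ hμ hs))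

variable {P : PermFamily} {m τ μ : ℕ → ℕ} {Q : Set QueryType}

/-- The common core of both games: all that matters about the challenge is that it is simulable and
that the states with the plaintext traced out agree. -/
theorem negligible_game (hm : PolyBounded m) (hτ : PolyBounded τ) (hμ : PolyBounded μ)
    (hτneg : Negligible fun n => 1 / (2 : ℝ) ^ τ n) (hQ : QueryType.two ∈ Q)
    (hP : IsQPRP Q P fun n => m n + τ n) {w s : ℕ → ℕ} (hs : PolyBounded s)
    {C₁ C₂ : ∀ n, List (Step (w n) (μ n * m n) (μ n * (m n + τ n)))}
    (hC : ∀ n, ∀ step ∈ C₁ n ++ C₂ n, step.Allowed Q)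
    (hsize : ∀ n, w n + (C₁ n).length + (C₂ n).length ≤ s n)
    (cipher : ∀ n, Fin (μ n * (m n + τ n)) ↪ Fin (w n)) (i : ∀ n, Fin (w n))
    {pre : ∀ n, Bool → QState (w n) →
      Matrix (Bits (μ n * m n) × Bits (w n)) (Bits (μ n * m n) × Bits (w n)) ℂ}
    (hpre : ∀ n b, IsChannel (pre n b))
    (htr : ∀ n ρ s s', ∑ x, pre n true ρ (x, s) (x, s') = ∑ x, pre n false ρ (x, s) (x, s'))
    (hsim : ∀ n b, Simulable Q (fun π ρ => coinAverage fun r =>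
      isoChannel (encOut (ecbEnc π r) (cipher n)) (pre n b ρ))
      (2 * s n + encCost (m n) (τ n) (μ n) (s n)) (2 * s n + encCost (m n) (τ n) (μ n) (s n))) :
    Negligible fun n => (∑' k, (P.keyDist (m n + τ n) k).toReal *
      ((∑ b, measureProb (i n) b (runSteps (ecbEnc (P.perm (m n + τ n) k)) (C₂ n)
        (coinAverage fun r => isoChannel (encOut (ecbEnc (P.perm (m n + τ n) k) r) (cipher n))
          (pre n b (runSteps (ecbEnc (P.perm (m n + τ n) k)) (C₁ n) (zeroState (w n))))))) / 2)) -
      1 / 2 := by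
  have hbound : PolyBounded fun n => μ n * (1 + ((C₁ n).length + (C₂ n).length + 1) * μ n) := by
    have hl : PolyBounded fun n => (C₁ n).length + (C₂ n).length :=
      hs.mono fun n => by have := hsize n; omega
    exact hμ.mul ((PolyBounded.const 1).add ((hl.add (PolyBounded.const 1)).mul hμ))
  refine negligible_of_simulable hP (w := w) (hs.mono fun n => by have := hsize n; omega)
    (PolyBounded.gameCost hm hτ hμ hs)
    (fun n b π ρ => runSteps (ecbEnc π) (C₂ n) (coinAverage fun r =>
      isoChannel (encOut (ecbEnc π r) (cipher n)) (pre n b (runSteps (ecbEnc π) (C₁ n) ρ)))) i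
    (fun n b π => ?_) (fun n b => ?_) (Negligible.polyBounded_mul hbound hτneg.half_exponent)
    fun n => avg_guess_random_perm_le (C₁ n) (C₂ n) (cipher n) (i n) (hpre n) (htr n)
  · have hc : IsChannel fun ρ => coinAverage fun r =>
        isoChannel (encOut (ecbEnc π r) (cipher n)) (pre n b ρ) :=
      coinAverage_isChannel fun r => (isoChannel_isChannel
        (encOut_injective (ecbEnc_injective π r) _)).comp (hpre n b)
    exact (runSteps_ecbEnc_isChannel π (C₂ n)).comp (hc.comp (runSteps_ecbEnc_isChannel π (C₁ n)))
  · exact simulable_game hQ (fun st h => hC n st (List.mem_append_left _ h))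
      (fun st h => hC n st (List.mem_append_right _ h)) (hsim n b) (hsize n)

theorem gqind_secure (hm : PolyBounded m) (hτ : PolyBounded τ) (hμ : PolyBounded μ)
    (hτneg : Negligible fun n => 1 / (2 : ℝ) ^ τ n) (hQ : QueryType.two ∈ Q)
    (hP : IsQPRP Q P fun n => m n + τ n) : GQINDqCPASecure Q (randomizedECB P m τ μ) := by
  intro (A : ∀ n, GQINDAdversary (μ n * m n) (μ n * (m n + τ n))) hA hs
  have hc : ∀ n, ∀ f : (Fin (μ n) → Bits (τ n)) → _, (A n).winProb f =
      (∑ b, measureProb (A n).result b (runSteps f (A n).second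
        (coinAverage fun r => isoChannel (encOut (f r) (A n).cipher)
          ((A n).preState b (runSteps f (A n).first (zeroState _)))))) / 2 := by
    intro n f
    simp only [GQINDAdversary.winProb, GQINDAdversary.challenge_eq]
  have h := negligible_game (P := P) (Q := Q) hm hτ hμ hτneg hQ hP hs hA (fun n => le_rfl)
    (fun n => (A n).cipher) (fun n => (A n).result) (pre := fun n b => (A n).preState b)
    (fun n b => (A n).preState_isChannel b) (fun n => (A n).sum_preState) fun n b => ?_
  · change Negligible fun n => (∑' k, (P.keyDist (m n + τ n) k).toReal *
      (A n).winProb (ecbEnc (P.perm (m n + τ n) k))) - 1 / 2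
    simp only [hc]
    exact h
  · have hsim := GQINDAdversary.simulable_challenge (m := m n) (τ := τ n) (μ := μ n) hQ (A n) b
    have e : (fun π => (A n).challenge (ecbEnc π) b) = fun π ρ => coinAverage fun r =>
        isoChannel (encOut (ecbEnc π r) (A n).cipher) ((A n).preState b ρ) :=
      funext fun π => funext fun ρ => (A n).challenge_eq (ecbEnc π) b ρ
    rw [e] at hsim
    have hw : (A n).width ≤ (A n).size := by simp only [GQINDAdversary.size]; omega
    have hle := encCost_mono (m n) (τ n) (μ n) hw
    exact hsim.mono (hle.trans (Nat.le_add_left _ _)) (hle.trans (Nat.le_add_left _ _))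

theorem qind_secure (hm : PolyBounded m) (hτ : PolyBounded τ) (hμ : PolyBounded μ)
    (hτneg : Negligible fun n => 1 / (2 : ℝ) ^ τ n) (hQ : QueryType.two ∈ Q)
    (hP : IsQPRP Q P fun n => m n + τ n) : QINDqCPASecure Q (randomizedECB P m τ μ) := by
  intro (A : ∀ n, QINDAdversary (μ n * m n) (μ n * (m n + τ n))) hA hs
  have hc : ∀ n, ∀ f : (Fin (μ n) → Bits (τ n)) → _, (A n).winProb f =
      (∑ b, measureProb (A n).result b (runSteps f (A n).second
        (coinAverage fun r => isoChannel (encOut (f r) (A n).cipher)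
          ((A n).preState b (runSteps f (A n).first (zeroState _)))))) / 2 := by
    intro n f
    simp only [QINDAdversary.winProb, QINDAdversary.challenge_eq]
  have h := negligible_game (P := P) (Q := Q) hm hτ hμ hτneg hQ hP
    ((PolyBounded.const 2).mul hs) hA (fun n => ?_)
    (fun n => (A n).cipher) (fun n => (A n).result) (pre := fun n b => (A n).preState b)
    (fun n b => (A n).preState_isChannel b) (fun n => (A n).sum_preState) fun n b => ?_
  · change Negligible fun n => (∑' k, (P.keyDist (m n + τ n) k).toReal *
      (A n).winProb (ecbEnc (P.perm (m n + τ n) k))) - 1 / 2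
    simp only [hc]
    exact h
  · change _ ≤ 2 * ((A n).width + (A n).prepWidth + (A n).prepRounds + (A n).first.length +
      (A n).second.length)
    omega
  · have hsim := QINDAdversary.simulable_challenge (m := m n) (τ := τ n) (μ := μ n) hQ (A n) b
    have e : (fun π => (A n).challenge (ecbEnc π) b) = fun π ρ => coinAverage fun r =>
        isoChannel (encOut (ecbEnc π r) (A n).cipher) ((A n).preState b ρ) :=
      funext fun π => funext fun ρ => (A n).challenge_eq (ecbEnc π) b ρ
    rw [e] at hsim
    have hw : (A n).width + (A n).prepWidth ≤ (A n).size := by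
      simp only [QINDAdversary.size]; omega
    have hle := encCost_mono (m n) (τ n) (μ n) (hw.trans (Nat.le_mul_of_pos_left (A n).size
      (by norm_num : 0 < 2)))
    have hb := Nat.add_le_add (by omega : 2 * (A n).width + (A n).prepWidth ≤ 2 * (2 * (A n).size)) hle
    exact hsim.mono hb hb

end QEnc

end

theorem mainTheorem3 (P : QEnc.PermFamily) (m τ μ : ℕ → ℕ)
    (hm : QEnc.PolyBounded m) (hτ : QEnc.PolyBounded τ) (hμ : QEnc.PolyBounded μ)
    (hτneg : QEnc.Negligible fun n => 1 / (2 : ℝ) ^ τ n)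
    (Q : Set QEnc.QueryType) (hQ : QEnc.QueryType.two ∈ Q)
    (hP : QEnc.IsQPRP Q P (fun n => m n + τ n)) :
    QEnc.GQINDqCPASecure Q (QEnc.randomizedECB P m τ μ) ∧
      QEnc.QINDqCPASecure Q (QEnc.randomizedECB P m τ μ) :=
  ⟨QEnc.gqind_secure hm hτ hμ hτneg hQ hP, QEnc.qind_secure hm hτ hμ hτneg hQ hP⟩
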